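/- **Setting.** All norms are Euclidean / spectral, $B^\dagger$ is the Moore–Penrose pseudoinverse, $\kappa(B)=\|B\|\,\|B^\dagger\|$, and $|\cdot|$ of a matrix or vector is entrywise. A floating-point precision with unit roundoff $u_*\in(0,1)$ is a rounding map $\mathrm{fl}$ with $|\mathrm{fl}(t)-t|\le u_*|t|$ and $\mathrm{fl}(\mathrm{fl}(t))=\mathrm{fl}(t)$ for all real $t$ (no overflow or underflow); every elementary operation returns $\mathrm{fl}$ of the exact result. Let $n\ge 1$, let $A\in\mathbb R^{m\times n}$ have rank $n$, $0\neq b\in\mathbb R^m$, let $x$ minimize $\|b-Ax\|$, $r=b-Ax$, $d=(r,x)$, $\widetilde b=(b,0)$ and $$\widetilde A_\alpha=\begin{bmatrix}\alpha I&A\\A^T&0\end{bmatrix},\quad \widetilde A=\widetilde A_1,\quad \mathrm{cond}(M,v)=\frac{\|\,|M^{-1}||M||v|\,\|}{\|v\|},\quad \mathrm{cond}(M)=\|\,|M^{-1}||M|\,\|.$$ Let $p$ be the maximal number of nonzeros per row of $(\widetilde A\;\,d)$. Let $\Omega\in\mathbb R^{s\times m}$ with $\Omega A$ of rank $n$, let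 $\Omega A=QR$ be an economic QR factorization, let $\widehat Y=\Omega A+\Delta_s\in\mathbb R^{s\times n}$ be the computed sketch, and let $\widehat R$ be the R-factor computed by Householder QR of $\widehat Y$ in precision $u_{QR}$. For a constant $c>0$ put $L=2\log_2 n+4$ and $\widetilde\gamma=\frac{c\,sn\,u_{QR}}{1-c\,sn\,u_{QR}}$, and assume $$c\,sn\,u_{QR}<1,\qquad L\,n^{1/2}\,\widetilde\gamma\,\kappa(\widehat Y)<1,\qquad L\,n^{1/2}\,\|(\Omega A)^\dagger\|\,\|\Delta_s\|<1 .$$ Put $$\beta=\bigl(1+18L\,n^{1/2}\,\widetilde\gamma\,\kappa(\Omega A)\bigr)\bigl(1+2L\,n^{1/2}\|(\Omega A)^\dagger\|\|\Delta_s\|\bigr),\qquad \psi=\beta\max\{\|\Omega A\|,\|(\Omega A)^\dagger\|,\beta\,\kappa(\Omega A)\}.$$ **Algorithm (with scaling parameter $\alpha>0$; no scaling means $\alpha=1$).** From any start $\widehat d_0=(r_0,x_0)$, step $i$ does the following. (1) Compute $\widehat w_i=(f_i,g_i)\approx\widetilde b-\widetilde A\widehat d_i$ in precision $u_r\le u$.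 (2) Compute $h_i\approx\widehat R^{-T}\alpha^{-1}g_i$ in precision $u_r$ by a triangular solve. (3) Apply some number $k_i$ of FGMRES iterations (zero initial guess, modified Gram–Schmidt) to the system with matrix $M_L^{-1}\widetilde A_\alpha M_R^{-1}$ and right-hand side $(f_i,h_i)$, where $M_L=\mathrm{diag}(I,\widehat R^T)$ and $M_R=\mathrm{diag}(I,\widehat R)$; the products with $\widetilde A_\alpha$, $M_L^{-1}$, $M_R^{-1}$ are computed in precisions $u_A,u_L,u_R$ and all other operations in the working precision $u$. This yields an approximation $\widehat y_i$ of $(\alpha^{-1}\delta r_i,\delta x_i)$. (4) Update $\widehat d_{i+1}=\widehat d_i+(\delta r_i,\delta x_i)$ in precision $u$. The FGMRES precisions are said to *give a backward error at most $Ku$* if in every step the inner solve has backward error at most $Ku$ for the left-preconditioned system, that is, with $B=M_L^{-1}\widetilde A_\alpha$ and $t_i=M_L^{-1}(f_i,\alpha^{-1}g_i)$, $$\frac{\|t_i-B\widehat y_i\|}{\|B\|\|\widehat y_i\|+\|t_i\|}\le Ku .$$ **Theorem.** There is an absolute constant $c>0$ such that for all $K,\varepsilon,\tau>0$ there are a constant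 $C>0$ depending only on $(K,\varepsilon,\tau)$ and constants $C'_p$ depending only on $(K,\varepsilon,\tau)$ and $p$, such that in the setting above, with this $c$, the following holds. Every conclusion is meant for all sufficiently large $i$. 1. (Forward error, no scaling.) Let $\alpha=1$, let the FGMRES precisions give a backward error at most $Ku$, and let $\|AR^{-1}\|\ge\tau$ and $C\,p\,u_r\,\mathrm{cond}(\widetilde A)<1$. If $$C\,\beta\max\Bigl\{1,\bigl(\sqrt{1+4\beta^{-1}\|(AR^{-1})^\dagger\|^{-2}}-1\bigr)^{-1}\Bigr\}\|AR^{-1}\|\,\psi<u^{-1},$$ then $\|d-\widehat d_i\|/\|d\|\le(1+\varepsilon)\bigl(4pu_r\,\mathrm{cond}(\widetilde A,d)+u\bigr)$. 2. (Forward error, optimal scaling.) Let $\alpha=2^{-1/2}\sigma_{\min}(A\widehat R^{-1})$, let the FGMRES precisions give a backward error at most $Ku$, and let $$C\,\beta^2\,\kappa(AR^{-1})\,\psi<u^{-1}.$$ (a) Let $d_\alpha=(\alpha^{-1}r,x)$ and $\widehat d_{\alpha,i}=(\alpha^{-1}r_i,x_i)$ be the scaled unknowns. If $C\,p\,u_r\,\mathrm{cond}(\widetilde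 A_\alpha)<1$, then $\|d_\alpha-\widehat d_{\alpha,i}\|/\|d_\alpha\|\le(1+\varepsilon)\bigl(4pu_r\,\mathrm{cond}(\widetilde A_\alpha,d_\alpha)+u\bigr)$. (b) If $C\,p\,u_r\,\mathrm{cond}(\widetilde A)<1$ and $\tau\le\alpha\le\tau^{-1}$, then $\|d-\widehat d_i\|/\|d\|\le(1+\varepsilon)\bigl(4pu_r\,\mathrm{cond}(\widetilde A,d)+u\bigr)$. 3. (Backward error.) Let $\alpha=1$ and let the FGMRES precisions give a backward error at most $Ku$. If $C'_p\,\psi\,\kappa(\widetilde A)<u^{-1}$, then $$\frac{\|\widetilde b-\widetilde A\widehat d_i\|}{\|\widetilde b\|+\|\widetilde A\|\|\widehat d_i\|}\le(1+\varepsilon)\,p\,\max\{u,\,2\sqrt p\,u_r\};$$ in particular the bound is $(1+\varepsilon)\,p\,u$ whenever $2\sqrt p\,u_r\le u$. -/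

import Mathlib

noncomputable section

namespace LSIR

/-! ## Norms, pseudoinverse, condition numbers -/

/-- Euclidean norm of a real vector. -/
def vnorm {ι : Type*} [Fintype ι] (v : ι → ℝ) : ℝ := ‖WithLp.toLp 2 v‖

open scoped Matrix.Norms.L2Operator in
/-- Spectral norm (operator 2-norm) of a real matrix. -/
def norm2 {ι κ : Type*} [Fintype ι] [Fintype κ] [DecidableEq κ] (B : Matrix ι κ ℝ) : ℝ := ‖B‖

/-- Moore-Penrose pseudoinverse of a matrix of full column rank, `B† = (BᵀB)⁻¹Bᵀ`
(only ever used for such matrices; see `pinv_penrose`). -/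
def pinv {ι κ : Type*} [Fintype ι] [Fintype κ] [DecidableEq κ] (B : Matrix ι κ ℝ) :
    Matrix κ ι ℝ := (B.transpose * B)⁻¹ * B.transpose

/-- The four Penrose equations for matrices of full column rank. -/
theorem pinv_penrose {ι κ : Type*} [Fintype ι] [Fintype κ] [DecidableEq κ] (B : Matrix ι κ ℝ)
    (hB : IsUnit (B.transpose * B).det) :
    B * pinv B * B = B ∧ pinv B * B * pinv B = pinv B ∧
      (B * pinv B).transpose = B * pinv B ∧ (pinv B * B).transpose = pinv B * B := by
  have h1 : pinv B * B = 1 := by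
    rw [pinv, Matrix.mul_assoc, Matrix.nonsing_inv_mul _ hB]
  refine ⟨?_, ?_, ?_, ?_⟩
  · rw [Matrix.mul_assoc, h1, Matrix.mul_one]
  · rw [h1, Matrix.one_mul]
  · simp [pinv, Matrix.transpose_mul, Matrix.transpose_nonsing_inv, Matrix.mul_assoc]
  · rw [h1, Matrix.transpose_one]

/-- The 2-norm condition number `κ₂(B) = ‖B‖₂ ‖B†‖₂` (for an invertible matrix, `B† = B⁻¹`). -/
def cond2 {ι κ : Type*} [Fintype ι] [Fintype κ] [DecidableEq ι] [DecidableEq κ]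
    (B : Matrix ι κ ℝ) : ℝ := norm2 B * norm2 (pinv B)

/-- Smallest singular value of a matrix with `n ≥ 1` columns and at least as many rows
(Mathlib's singular values are indexed from `0` in decreasing order). -/
def sigmaMin {m n : ℕ} (B : Matrix (Fin m) (Fin n) ℝ) : ℝ :=
  (Matrix.toEuclideanLin B).singularValues (n - 1)

/-- Entrywise absolute value. -/
def absM {ι κ : Type*} (M : Matrix ι κ ℝ) : Matrix ι κ ℝ := M.map (fun t => |t|)

/-- `cond(M, d) = ‖ |M⁻¹| |M| |d| ‖ / ‖d‖`. -/
def condAt {ι : Type*} [Fintype ι] [DecidableEq ι] (M : Matrix ι ι ℝ) (d : ι → ℝ) : ℝ :=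
  vnorm ((absM M⁻¹ * absM M).mulVec (fun a => |d a|)) / vnorm d

/-- `cond(M) = ‖ |M⁻¹| |M| ‖`. -/
def condSkeel {ι : Type*} [Fintype ι] [DecidableEq ι] (M : Matrix ι ι ℝ) : ℝ :=
  norm2 (absM M⁻¹ * absM M)

open Classical in
/-- Maximum number of nonzeros per row of the matrix `(M d)`. -/
def maxRowNnz {ι : Type*} [Fintype ι] (M : Matrix ι ι ℝ) (d : ι → ℝ) : ℕ :=
  Finset.univ.sup fun a =>
    (Finset.univ.filter fun c => M a c ≠ 0).card + (if d a ≠ 0 then 1 else 0)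

/-! ## Floating-point arithmetic -/

/-- A floating-point format without overflow and underflow, under the standard model: a rounding
function `fl` onto the set of floating-point numbers (which it leaves fixed), with unit
roundoff `u`.  The computed value of an elementary operation is `fl` of the exact value. -/
structure Precision where
  fl : ℝ → ℝ
  u : ℝ
  u_pos : 0 < u
  u_lt_one : u < 1
  fl_err : ∀ t, |fl t - t| ≤ u * |t|
  fl_idem : ∀ t, fl (fl t) = fl t

/-- Computed inner product `∑ v a * w a` (recursive summation over the list `l`). -/
def Precision.dot {ι : Type*} (P : Precision) (l : List ι) (v w : ι → ℝ) : ℝ :=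
  l.foldl (fun t a => P.fl (t + P.fl (v a * w a))) 0

/-- Computed Euclidean norm. -/
def Precision.nrm {ι : Type*} (P : Precision) (l : List ι) (v : ι → ℝ) : ℝ :=
  P.fl (Real.sqrt (P.dot l v v))

/-- Computed solution of a triangular system `T h = g` by substitution, the unknowns being found
in the order of `ord` (increasing for lower, decreasing for upper triangular `T`). -/
def Precision.substitution {n : ℕ} (P : Precision) (ord : List (Fin n))
    (T : Matrix (Fin n) (Fin n) ℝ) (g : Fin n → ℝ) : Fin n → ℝ :=
  ord.foldl (fun h j => Function.update h j
    (P.fl ((ord.foldl (fun t l => if l = j ∨ T j l = 0 then t else P.fl (t - P.fl (T j l * h l)))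
      (g j)) / T j j))) 0

/-! ## Householder QR in floating-point arithmetic -/

/-- One stage of Householder QR: with `z` the part of column `k` in rows `≥ k`, put
`σ = sign(z₀) ‖z‖`, `v = z + σ e₀`, `η = 1 / (σ v₀)`, replace column `k` by `-σ e₀` and every later
column `a` by `a - η (vᵀ a) v`. -/
def householderStage {s n : ℕ} (P : Precision) (M : Matrix (Fin s) (Fin n) ℝ) (k : Fin n) :
    Matrix (Fin s) (Fin n) ℝ :=
  let z : Fin s → ℝ := fun i => if k.val ≤ i.val then M i k else 0
  let piv : ℝ := if h : k.val < s then M ⟨k.val, h⟩ k else 0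
  let nz : ℝ := P.nrm (List.finRange s) z
  let σ : ℝ := if 0 ≤ piv then nz else -nz
  let v0 : ℝ := P.fl (piv + σ)
  let v : Fin s → ℝ := fun i => if i.val = k.val then v0 else z i
  let η : ℝ := P.fl (1 / P.fl (σ * v0))
  fun i j =>
    if i.val < k.val ∨ j < k then M i j
    else if j = k then (if i.val = k.val then -σ else 0)
    else P.fl (M i j -
      P.fl (P.fl (η * P.dot (List.finRange s) v (fun a => M a j)) * v i))

/-- The `n × n` R-factor computed by Householder QR of the `s × n` matrix `Y`. -/
def householderR {s n : ℕ} (P : Precision) (Y : Matrix (Fin s) (Fin n) ℝ) :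
    Matrix (Fin n) (Fin n) ℝ :=
  let M := (List.finRange n).foldl (householderStage P) Y
  fun i j => if i ≤ j then (if h : i.val < s then M ⟨i.val, h⟩ j else 0) else 0

/-! ## The augmented system and its preconditioners -/

variable {m n : ℕ}

/-- `Ã_α = [α I, A; Aᵀ, 0]`; the augmented matrix `Ã` is the case `α = 1`. -/
def augM (A : Matrix (Fin m) (Fin n) ℝ) (α : ℝ) : Matrix (Fin m ⊕ Fin n) (Fin m ⊕ Fin n) ℝ :=
  Matrix.fromBlocks (α • (1 : Matrix (Fin m) (Fin m) ℝ)) A A.transpose 0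

/-- `M_L⁻¹ = diag(I, R⁻ᵀ)`. -/
def MLinv (m : ℕ) (R : Matrix (Fin n) (Fin n) ℝ) : Matrix (Fin m ⊕ Fin n) (Fin m ⊕ Fin n) ℝ :=
  Matrix.fromBlocks 1 0 0 (R⁻¹).transpose

/-- The vector `(α⁻¹ r, x)`: if `Ã (r, x) = (f, g)` then `Ã_α (α⁻¹ r, x) = (f, α⁻¹ g)`. -/
def scl (α : ℝ) (d : Fin m ⊕ Fin n → ℝ) : Fin m ⊕ Fin n → ℝ :=
  Sum.elim (fun i => α⁻¹ * d (Sum.inl i)) (fun j => d (Sum.inr j))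

/-- The vector `(f, α⁻¹ g)`. -/
def sclRhs (α : ℝ) (w : Fin m ⊕ Fin n → ℝ) : Fin m ⊕ Fin n → ℝ :=
  Sum.elim (fun i => w (Sum.inl i)) (fun j => α⁻¹ * w (Sum.inr j))

/-- The right-hand side `b̃ = (b, 0)`. -/
def rhs (n : ℕ) (b : Fin m → ℝ) : Fin m ⊕ Fin n → ℝ := Sum.elim b 0

/-- The indices of the augmented vectors in their natural order. -/
def idx (m n : ℕ) : List (Fin m ⊕ Fin n) :=
  (List.finRange m).map Sum.inl ++ (List.finRange n).map Sum.inr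

/-! ## Mixed-precision iterative refinement with split-preconditioned FGMRES -/

/-- The precisions of the refinement: working precision, precision of the residuals, and the
precisions in which FGMRES applies the augmented matrix, `M_L⁻¹` and `M_R⁻¹`. -/
structure Precisions where
  work : Precision
  res : Precision
  mat : Precision
  left : Precision
  right : Precision

/-- Computed product `Ã_α v`. -/
def applyAug (P : Precision) (A : Matrix (Fin m) (Fin n) ℝ) (α : ℝ) (v : Fin m ⊕ Fin n → ℝ) :
    Fin m ⊕ Fin n → ℝ :=
  Sum.elim
    (fun i => (List.finRange n).foldl (fun t j => P.fl (t + P.fl (A i j * v (Sum.inr j))))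
      (P.fl (α * v (Sum.inl i))))
    (fun j => P.dot (List.finRange m) (fun i => A i j) (fun i => v (Sum.inl i)))

/-- Computed `M_L⁻¹ v`, by a triangular solve with `Rᵀ` (`R` upper triangular). -/
def applyMLinv (P : Precision) (R : Matrix (Fin n) (Fin n) ℝ) (v : Fin m ⊕ Fin n → ℝ) :
    Fin m ⊕ Fin n → ℝ :=
  Sum.elim (fun i => v (Sum.inl i))
    (P.substitution (List.finRange n) R.transpose (fun j => v (Sum.inr j)))

/-- Computed `M_R⁻¹ v`, where `M_R = diag(I, R)`, by a triangular solve with `R`. -/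
def applyMRinv (P : Precision) (R : Matrix (Fin n) (Fin n) ℝ) (v : Fin m ⊕ Fin n → ℝ) :
    Fin m ⊕ Fin n → ℝ :=
  Sum.elim (fun i => v (Sum.inl i))
    (P.substitution (List.finRange n).reverse R (fun j => v (Sum.inr j)))

/-- The quantities built by the flexible Arnoldi process: orthonormal basis vectors `V 0, V 1, …`,
preconditioned basis vectors `Z 0, Z 1, …` and the Hessenberg matrix `H`. -/
structure Arnoldi (ι : Type) where
  V : ℕ → ι → ℝ
  Z : ℕ → ι → ℝ
  H : ℕ → ℕ → ℝ

/-- One step of the flexible Arnoldi process (modified Gram-Schmidt) for the split-preconditioned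
matrix `M_L⁻¹ Ã_α M_R⁻¹`. -/
def arnoldiStep (F : Precisions) (A : Matrix (Fin m) (Fin n) ℝ) (R : Matrix (Fin n) (Fin n) ℝ)
    (α : ℝ) (S : Arnoldi (Fin m ⊕ Fin n)) (j : ℕ) : Arnoldi (Fin m ⊕ Fin n) :=
  let z := applyMRinv F.right R (S.V j)
  let w0 := applyMLinv F.left R (applyAug F.mat A α z)
  let mgs := (List.range (j + 1)).foldl
    (fun (q : (Fin m ⊕ Fin n → ℝ) × (ℕ → ℝ)) i =>
      let h := F.work.dot (idx m n) (S.V i) q.1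
      (fun a => F.work.fl (q.1 a - F.work.fl (h * S.V i a)), Function.update q.2 i h))
    (w0, fun _ => 0)
  let hn := F.work.nrm (idx m n) mgs.1
  { V := Function.update S.V (j + 1) (fun a => F.work.fl (mgs.1 a / hn))
    Z := Function.update S.Z j z
    H := fun i l => if l = j then (if i = j + 1 then hn else mgs.2 i) else S.H i l }

/-- One Givens rotation, acting on rows `i` and `i + 1` of the Hessenberg matrix and of the
right-hand side of the small least-squares problem. -/
def givensStep (P : Precision) (q : (ℕ → ℕ → ℝ) × (ℕ → ℝ)) (i : ℕ) : (ℕ → ℕ → ℝ) × (ℕ → ℝ) :=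
  let H := q.1
  let g := q.2
  let ρ := P.fl (Real.sqrt (P.fl (P.fl (H i i * H i i) + P.fl (H (i + 1) i * H (i + 1) i))))
  let c := P.fl (H i i / ρ)
  let s := P.fl (H (i + 1) i / ρ)
  (fun a l =>
      if a = i then
        if l = i then ρ else P.fl (P.fl (c * H i l) + P.fl (s * H (i + 1) l))
      else if a = i + 1 then
        if l = i then 0 else P.fl (P.fl (c * H (i + 1) l) - P.fl (s * H i l))
      else H a l,
    fun a =>
      if a = i then P.fl (P.fl (c * g i) + P.fl (s * g (i + 1)))
      else if a = i + 1 then P.fl (P.fl (c * g (i + 1)) - P.fl (s * g i))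
      else g a)

/-- Computed minimizer of `‖ω e₁ - H y‖₂` for the `(k + 1) × k` Hessenberg matrix `H`, by Givens
rotations and back substitution. -/
def hessenbergLS (P : Precision) (k : ℕ) (H : ℕ → ℕ → ℝ) (ω : ℝ) : Fin k → ℝ :=
  let q := (List.range k).foldl (givensStep P) (H, fun a => if a = 0 then ω else 0)
  P.substitution (List.finRange k).reverse
    (fun i l => if i ≤ l then q.1 i.val l.val else 0) (fun i => q.2 i.val)

/-- Split-preconditioned FGMRES with zero initial guess and `k` iterations, applied to
`M_L⁻¹ Ã_α M_R⁻¹ y = s`; the output is the computed `M_R⁻¹ y`, formed as `Z_k y_k`. -/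
def fgmres (F : Precisions) (A : Matrix (Fin m) (Fin n) ℝ) (R : Matrix (Fin n) (Fin n) ℝ)
    (α : ℝ) (k : ℕ) (s : Fin m ⊕ Fin n → ℝ) : Fin m ⊕ Fin n → ℝ :=
  let ω := F.work.nrm (idx m n) s
  let S := (List.range k).foldl (arnoldiStep F A R α)
    { V := fun _ a => F.work.fl (s a / ω), Z := fun _ _ => 0, H := fun _ _ => 0 }
  let y := hessenbergLS F.work k S.H ω
  fun a => F.work.dot (List.finRange k) (fun l => S.Z l.val a) y

/-- Computed residual `(f, g) = (b - r - A x, -Aᵀ r)` of the augmented system at `d = (r, x)`. -/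
def computedRes (P : Precision) (A : Matrix (Fin m) (Fin n) ℝ) (b : Fin m → ℝ)
    (d : Fin m ⊕ Fin n → ℝ) : Fin m ⊕ Fin n → ℝ :=
  Sum.elim
    (fun i => (List.finRange n).foldl (fun t j => P.fl (t - P.fl (A i j * d (Sum.inr j))))
      (P.fl (b i - d (Sum.inl i))))
    (fun j => -P.dot (List.finRange m) (fun i => A i j) (fun i => d (Sum.inl i)))

/-- The output of the inner solver in the refinement step at `d`: the residual `(f, g)` and the
preconditioned right-hand side `(f, R⁻ᵀ α⁻¹ g)` are computed in the residual precision, then FGMRES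
is applied to the system scaled by `α`.  It approximates `(α⁻¹ δr, δx)`. -/
def innerSolve (F : Precisions) (A : Matrix (Fin m) (Fin n) ℝ) (b : Fin m → ℝ)
    (R : Matrix (Fin n) (Fin n) ℝ) (α : ℝ) (k : ℕ) (d : Fin m ⊕ Fin n → ℝ) :
    Fin m ⊕ Fin n → ℝ :=
  let w := computedRes F.res A b d
  fgmres F A R α k (applyMLinv F.res R
    (Sum.elim (fun i => w (Sum.inl i)) (fun j => F.res.fl (α⁻¹ * w (Sum.inr j)))))

/-- One step of the refinement: `d ↦ d + δd`, rounded to the working precision. -/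
def lsirStep (F : Precisions) (A : Matrix (Fin m) (Fin n) ℝ) (b : Fin m → ℝ)
    (R : Matrix (Fin n) (Fin n) ℝ) (α : ℝ) (k : ℕ) (d : Fin m ⊕ Fin n → ℝ) :
    Fin m ⊕ Fin n → ℝ :=
  let y := innerSolve F A b R α k d
  Sum.elim (fun i => F.work.fl (d (Sum.inl i) + F.work.fl (α * y (Sum.inl i))))
    (fun j => F.work.fl (d (Sum.inr j) + y (Sum.inr j)))

/-- The iterates `(r_i, x_i)`, with `k i` FGMRES iterations in step `i`; the algorithm without
scaling is the case `α = 1`. -/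
def lsir (F : Precisions) (A : Matrix (Fin m) (Fin n) ℝ) (b : Fin m → ℝ)
    (R : Matrix (Fin n) (Fin n) ℝ) (α : ℝ) (k : ℕ → ℕ) (d₀ : Fin m ⊕ Fin n → ℝ) :
    ℕ → Fin m ⊕ Fin n → ℝ
  | 0 => d₀
  | i + 1 => lsirStep F A b R α (k i) (lsir F A b R α k d₀ i)

/-- Normwise relative backward error `‖s - B y‖ / (‖B‖ ‖y‖ + ‖s‖)` of `y` for `B y = s`. -/
def backwardErr {ι : Type*} [Fintype ι] [DecidableEq ι] (B : Matrix ι ι ℝ) (s y : ι → ℝ) : ℝ :=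
  vnorm (s - B.mulVec y) / (norm2 B * vnorm y + vnorm s)

/-- Backward error committed by the preconditioned inner solver in the refinement step at `d`: the
backward error of its output for the left-preconditioned system
`(M_L⁻¹ Ã_α) y = M_L⁻¹ (f, α⁻¹ g)`, with `(f, g)` the computed residual. -/
def innerBackwardErr (F : Precisions) (A : Matrix (Fin m) (Fin n) ℝ) (b : Fin m → ℝ)
    (R : Matrix (Fin n) (Fin n) ℝ) (α : ℝ) (k : ℕ) (d : Fin m ⊕ Fin n → ℝ) : ℝ :=
  backwardErr (MLinv m R * augM A α)
    ((MLinv m R).mulVec (sclRhs α (computedRes F.res A b d))) (innerSolve F A b R α k d)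

/-! ## The quantities in the convergence conditions -/

/-- `2 log₂ n + 4`. -/
def logFactor (n : ℕ) : ℝ := 2 * Real.logb 2 n + 4

/-- `γ̃_N = c N u / (1 - c N u)`. -/
def gammaTilde (c : ℝ) (N : ℕ) (u : ℝ) : ℝ := c * N * u / (1 - c * N * u)

variable {s : ℕ}

/-- The conditions on the sketch `Y = S + Δ_s` of `S = Ω A` and on the roundoff `u` of the QR
factorization of `Y`. -/
def SketchOK (c : ℝ) (u : ℝ) (S Y : Matrix (Fin s) (Fin n) ℝ) : Prop :=
  c * (s * n : ℕ) * u < 1 ∧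
  logFactor n * Real.sqrt n * gammaTilde c (s * n) u * cond2 Y < 1 ∧
  logFactor n * Real.sqrt n * norm2 (pinv S) * norm2 (Y - S) < 1

/-- The amplification factor `β`. -/
def beta (c : ℝ) (u : ℝ) (S Y : Matrix (Fin s) (Fin n) ℝ) : ℝ :=
  (1 + 18 * logFactor n * Real.sqrt n * gammaTilde c (s * n) u * cond2 S) *
    (1 + 2 * logFactor n * Real.sqrt n * norm2 (pinv S) * norm2 (Y - S))

/-- `ψ(β, S) = β max {‖S‖₂, ‖S†‖₂, β κ₂(S)}`. -/
def psi (β : ℝ) (S : Matrix (Fin s) (Fin n) ℝ) : ℝ :=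
  β * max (norm2 S) (max (norm2 (pinv S)) (β * cond2 S))

end LSIR

end

/-! The inner solver stays a black box: FGMRES and its triangular solves enter only through the
assumed backward error `K u`. Rounding is analysed in just three places: Householder QR of the
sketch, the computed residual, and the update of the iterate.

Sketch. Each computed reflector is an exact reflector up to a relative error of order `s u_QR`, so
the computed R-factor acts on vectors like an isometry times `Y`, up to a small error
(`householderR_backward`). Because `2 log₂ n + 4 ≥ 4`, the assumptions make the sketching error and
the QR error at most 1/4 each in relative size. Hence `‖R̂ w‖`, `‖Ω A w‖` and `‖R w‖` agree within a
factor 2 (`householderR_equiv`). Of `β` only `β ≥ 1` is needed.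

Preconditioned system. `M_L⁻¹ Ã_α` is the augmented matrix of `A R̂⁻¹` times `diag(I, R̂)`
(`MLinv_mul_augM`). The block diagonal factor contributes at most `4ψ` to the conditioning
(`max_mul_max_le_psi`). The other factor is controlled by an energy identity (`augM_energy`): its
inverse is of order `max {1, ‖(A R⁻¹)†‖²}` without scaling, but only of order `σ⁻¹` when `α = σ/√2`,
where `σ = σ_min(A R̂⁻¹)`. The convergence conditions therefore say that `K u` times the
conditioning is below a small `η`, so every inner solve has relative error of order `η`
(`forward_of_backwardErr`).

Refinement. The forward error obeys a recursion with contraction factor `14η`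
(`forward_refinement`). Its forcing term is the update error `u ‖d‖` plus the residual error
propagated through `|Ã⁻¹| |Ã|`. With `γ = (1 + u_r)^p - 1`, the residual error is at most `γ (|b̃| +
|Ã| |d_i|)`; the bound `|b̃| ≤ |Ã| |d|` gives a factor 2 and `γ ≤ 2 p u_r` another, whence `4 p
u_r`. The backward error is treated likewise through the recursion for `Ã (d - d_i)`
(`backward_refinement`); there the passage from `|Ã|` to `‖Ã‖` costs `√p`, as rows have at most `p`
nonzeros. -/

namespace LSIR

open Matrix

/-! ### Euclidean and spectral norms, pseudoinverse bounds -/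

section Norms
variable {ι κ μ : Type*} [Fintype ι] [Fintype κ] [Fintype μ]

theorem vnorm_nonneg (v : ι → ℝ) : 0 ≤ vnorm v := norm_nonneg _

theorem vnorm_sq (v : ι → ℝ) : vnorm v ^ 2 = ∑ a, v a ^ 2 := by
  simp [vnorm, EuclideanSpace.norm_sq_eq]

theorem vnorm_zero : vnorm (0 : ι → ℝ) = 0 := by simp [vnorm]

theorem vnorm_eq_zero {v : ι → ℝ} : vnorm v = 0 ↔ v = 0 := by simp [vnorm]

theorem vnorm_pos {v : ι → ℝ} (h : v ≠ 0) : 0 < vnorm v :=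
  lt_of_le_of_ne (vnorm_nonneg v) fun h' => h (vnorm_eq_zero.1 h'.symm)

theorem vnorm_add_le (v w : ι → ℝ) : vnorm (v + w) ≤ vnorm v + vnorm w := by
  simpa [vnorm] using norm_add_le (WithLp.toLp 2 v) (WithLp.toLp 2 w)

theorem vnorm_neg (v : ι → ℝ) : vnorm (-v) = vnorm v := by
  simp [vnorm]

theorem vnorm_sub_le (v w : ι → ℝ) : vnorm (v - w) ≤ vnorm v + vnorm w := by
  simpa [vnorm] using norm_sub_le (WithLp.toLp 2 v) (WithLp.toLp 2 w)

theorem vnorm_sub_comm (v w : ι → ℝ) : vnorm (v - w) = vnorm (w - v) := by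
  rw [← vnorm_neg, neg_sub]

theorem vnorm_le_add_sub (v w : ι → ℝ) : vnorm v ≤ vnorm w + vnorm (v - w) := by
  simpa using vnorm_add_le w (v - w)

theorem vnorm_smul (c : ℝ) (v : ι → ℝ) : vnorm (c • v) = |c| * vnorm v := by
  simp [vnorm, norm_smul]

theorem le_of_sq_le {x y : ℝ} (hy : 0 ≤ y) (h : x ^ 2 ≤ y ^ 2) : x ≤ y :=
  le_of_sq_le_sq h hy

theorem vnorm_mono {v w : ι → ℝ} (h : ∀ a, |v a| ≤ |w a|) : vnorm v ≤ vnorm w := by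
  refine le_of_sq_le (vnorm_nonneg _) ?_
  rw [vnorm_sq, vnorm_sq]
  exact Finset.sum_le_sum fun a _ => sq_le_sq.2 (h a)

theorem vnorm_abs (v : ι → ℝ) : vnorm (fun a => |v a|) = vnorm v :=
  le_antisymm (vnorm_mono fun a => by simp) (vnorm_mono fun a => by simp)

theorem vnorm_elim_sq (f : ι → ℝ) (g : κ → ℝ) :
    vnorm (Sum.elim f g) ^ 2 = vnorm f ^ 2 + vnorm g ^ 2 := by
  simp [vnorm_sq]

theorem vnorm_inl_le (v : ι ⊕ κ → ℝ) : vnorm (fun i => v (Sum.inl i)) ≤ vnorm v := by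
  refine le_of_sq_le (vnorm_nonneg _) ?_
  rw [vnorm_sq, vnorm_sq, Fintype.sum_sum_type]
  have : 0 ≤ ∑ a, v (Sum.inr a) ^ 2 := Finset.sum_nonneg fun _ _ => sq_nonneg _
  linarith

theorem vnorm_inr_le (v : ι ⊕ κ → ℝ) : vnorm (fun i => v (Sum.inr i)) ≤ vnorm v := by
  refine le_of_sq_le (vnorm_nonneg _) ?_
  rw [vnorm_sq, vnorm_sq, Fintype.sum_sum_type]
  have : 0 ≤ ∑ a, v (Sum.inl a) ^ 2 := Finset.sum_nonneg fun _ _ => sq_nonneg _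
  linarith

theorem vnorm_le_inl_add_inr (v : ι ⊕ κ → ℝ) :
    vnorm v ≤ vnorm (fun i => v (Sum.inl i)) + vnorm (fun j => v (Sum.inr j)) := by
  have h1 := vnorm_nonneg (fun i => v (Sum.inl i))
  have h2 := vnorm_nonneg (fun i => v (Sum.inr i))
  refine le_of_sq_le (by positivity) ?_
  have : vnorm v ^ 2 = vnorm (fun i => v (Sum.inl i)) ^ 2 + vnorm (fun i => v (Sum.inr i)) ^ 2 := by
    simp [vnorm_sq]
  rw [this]; nlinarith

theorem dotProduct_self_eq (v : ι → ℝ) : v ⬝ᵥ v = vnorm v ^ 2 := by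
  rw [vnorm_sq]; simp [dotProduct, sq]

theorem sum_abs_mul_le (v w : ι → ℝ) : ∑ a, |v a * w a| ≤ vnorm v * vnorm w := by
  have h := Finset.sum_mul_sq_le_sq_mul_sq Finset.univ (fun a => |v a|) (fun a => |w a|)
  refine le_of_sq_le (mul_nonneg (vnorm_nonneg _) (vnorm_nonneg _)) ?_
  rw [mul_pow, vnorm_sq, vnorm_sq]
  simpa [abs_mul] using h

theorem abs_dotProduct_le (v w : ι → ℝ) : |v ⬝ᵥ w| ≤ vnorm v * vnorm w :=
  (Finset.abs_sum_le_sum_abs _ _).trans (sum_abs_mul_le v w)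

open scoped Matrix.Norms.L2Operator in
theorem vnorm_mulVec_le [DecidableEq κ] (M : Matrix ι κ ℝ) (v : κ → ℝ) :
    vnorm (M *ᵥ v) ≤ norm2 M * vnorm v :=
  Matrix.l2_opNorm_mulVec M (WithLp.toLp 2 v)

theorem norm2_nonneg [DecidableEq κ] (M : Matrix ι κ ℝ) : 0 ≤ norm2 M := by
  rw [norm2, Matrix.l2_opNorm_def]; exact norm_nonneg _

open scoped Matrix.Norms.L2Operator in
theorem norm2_le [DecidableEq κ] {M : Matrix ι κ ℝ} {c : ℝ} (hc : 0 ≤ c)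
    (h : ∀ v, vnorm (M *ᵥ v) ≤ c * vnorm v) : norm2 M ≤ c := by
  rw [norm2, Matrix.l2_opNorm_def]
  exact ContinuousLinearMap.opNorm_le_bound _ hc fun x => h x.ofLp

open scoped Matrix.Norms.L2Operator in
theorem norm2_transpose [DecidableEq ι] [DecidableEq κ] (M : Matrix ι κ ℝ) :
    norm2 Mᵀ = norm2 M := by
  have := Matrix.l2_opNorm_conjTranspose M
  rwa [Matrix.conjTranspose_eq_transpose_of_trivial] at this

theorem pinv_mul_self [DecidableEq κ] {B : Matrix ι κ ℝ} (h : IsUnit (Bᵀ * B).det) :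
    pinv B * B = 1 := by
  rw [pinv, Matrix.mul_assoc, Matrix.nonsing_inv_mul _ h]

/-- `BᵀB v = 0` forces `‖B v‖² = 0`, so injectivity passes to the Gram matrix and `pinv B` is a
genuine left inverse. -/
theorem isUnit_det_gram [DecidableEq κ] {B : Matrix ι κ ℝ} (h : ∀ v, B *ᵥ v = 0 → v = 0) :
    IsUnit (Bᵀ * B).det := by
  rw [← Matrix.isUnit_iff_isUnit_det, ← Matrix.mulVec_injective_iff_isUnit,
    ← Matrix.coe_mulVecLin, ← LinearMap.ker_eq_bot, LinearMap.ker_eq_bot']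
  intro v hv
  apply h
  have : Matrix.mulVec Bᵀ (B *ᵥ v) = 0 := by
    rw [Matrix.mulVec_mulVec]; simpa only [Matrix.mulVecLin_apply] using hv
  have h2 : (B *ᵥ v) ⬝ᵥ (B *ᵥ v) = 0 := by
    rw [Matrix.dotProduct_mulVec, ← Matrix.mulVec_transpose, this, zero_dotProduct]
  exact dotProduct_self_eq_zero.1 h2

theorem isUnit_det_of_ker [DecidableEq κ] {B : Matrix κ κ ℝ} (h : ∀ v, B *ᵥ v = 0 → v = 0) :
    IsUnit B.det := by
  rw [← Matrix.isUnit_iff_isUnit_det, ← Matrix.mulVec_injective_iff_isUnit,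
    ← Matrix.coe_mulVecLin, ← LinearMap.ker_eq_bot, LinearMap.ker_eq_bot']
  simpa using h

theorem eq_zero_of_rank {m n : ℕ} {B : Matrix (Fin m) (Fin n) ℝ} (h : B.rank = n) :
    ∀ v, B *ᵥ v = 0 → v = 0 := by
  have h1 := LinearMap.finrank_range_add_finrank_ker B.mulVecLin
  have h2 : Module.finrank ℝ (LinearMap.range B.mulVecLin) = n := h
  rw [h2] at h1
  have h3 : LinearMap.ker B.mulVecLin = ⊥ := by
    apply Submodule.finrank_eq_zero.1
    simpa using h1
  intro v hv
  exact LinearMap.ker_eq_bot'.1 h3 v (by simpa using hv)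

theorem vnorm_le_pinv [DecidableEq ι] [DecidableEq κ] {B : Matrix ι κ ℝ}
    (h : ∀ v, B *ᵥ v = 0 → v = 0) (v : κ → ℝ) :
    vnorm v ≤ norm2 (pinv B) * vnorm (B *ᵥ v) := by
  have : v = pinv B *ᵥ (B *ᵥ v) := by
    rw [Matrix.mulVec_mulVec, pinv_mul_self (isUnit_det_gram h), Matrix.one_mulVec]
  conv_lhs => rw [this]
  exact vnorm_mulVec_le _ _

theorem pinv_eq_inv [DecidableEq ι] {B : Matrix ι ι ℝ} (h : IsUnit B.det) : pinv B = B⁻¹ := by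
  rw [pinv, Matrix.mul_inv_rev, Matrix.mul_assoc, Matrix.nonsing_inv_mul, Matrix.mul_one]
  rwa [Matrix.det_transpose]

theorem exists_vnorm_pos [Nonempty κ] : ∃ v : κ → ℝ, 0 < vnorm v := by
  refine ⟨fun _ => 1, vnorm_pos ?_⟩
  intro h
  obtain ⟨a⟩ := ‹Nonempty κ›
  simpa using congrFun h a

theorem one_le_cond2 [DecidableEq ι] [DecidableEq κ] [Nonempty κ] {B : Matrix ι κ ℝ}
    (h : ∀ v, B *ᵥ v = 0 → v = 0) : 1 ≤ cond2 B := by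
  obtain ⟨v, hv⟩ := exists_vnorm_pos (κ := κ)
  have h1 := vnorm_le_pinv h v
  have h2 := mul_le_mul_of_nonneg_left (vnorm_mulVec_le B v) (norm2_nonneg (pinv B))
  have h3 : 1 * vnorm v ≤ cond2 B * vnorm v := by
    rw [cond2]; linarith
  exact le_of_mul_le_mul_right h3 hv

theorem one_le_of_vnorm_le [Nonempty κ] {c : ℝ} (h : ∀ v : κ → ℝ, vnorm v ≤ c * vnorm v) :
    1 ≤ c := by
  obtain ⟨v, hv⟩ := exists_vnorm_pos (κ := κ)
  exact le_of_mul_le_mul_right (by linarith [h v]) hv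

/-- Componentwise bound for a product with a matrix. -/
theorem abs_mulVec_le (M : Matrix ι κ ℝ) {v : κ → ℝ} {w : κ → ℝ} (h : ∀ a, |v a| ≤ w a) (i : ι) :
    |(M *ᵥ v) i| ≤ (absM M *ᵥ w) i := by
  refine (Finset.abs_sum_le_sum_abs _ _).trans (Finset.sum_le_sum fun a _ => ?_)
  rw [abs_mul]
  exact mul_le_mul_of_nonneg_left (h a) (abs_nonneg _)

end Norms

/-! ### The smallest singular value as a minimum -/

theorem sigmaMin_nonneg {m n : ℕ} (B : Matrix (Fin m) (Fin n) ℝ) : 0 ≤ sigmaMin B :=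
  LinearMap.singularValues_nonneg _ _

/-- In an eigenbasis of the symmetric map `T* T`, `‖T x‖²` is a weighted sum of squares, and the
index `n - 1` carries the smallest weight. -/
theorem sigmaMin_mul_le {m n : ℕ} (hn : 0 < n) (B : Matrix (Fin m) (Fin n) ℝ) (v : Fin n → ℝ) :
    sigmaMin B * vnorm v ≤ vnorm (B *ᵥ v) := by
  set T := Matrix.toEuclideanLin B with hT
  have hfin : Module.finrank ℝ (EuclideanSpace ℝ (Fin n)) = n := by simp
  have hS := T.isSymmetric_adjoint_comp_self
  set b := hS.eigenvectorBasis hfin with hb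
  set x : EuclideanSpace ℝ (Fin n) := WithLp.toLp 2 v with hx
  have h1 : ‖T x‖ ^ 2 = ∑ i, hS.eigenvalues hfin i * (b.repr x i) ^ 2 := by
    have e1 : ‖T x‖ ^ 2 = inner ℝ x ((T.adjoint ∘ₗ T) x) := by
      rw [LinearMap.comp_apply, LinearMap.adjoint_inner_right, real_inner_self_eq_norm_sq]
    rw [e1, ← b.repr.inner_map_map, PiLp.inner_apply]
    refine Finset.sum_congr rfl fun i _ => ?_
    rw [hS.eigenvectorBasis_apply_self_apply hfin x i]
    simp [hb]; ring
  have h2 : ‖x‖ ^ 2 = ∑ i, (b.repr x i) ^ 2 := by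
    rw [← b.repr.norm_map x, EuclideanSpace.norm_sq_eq]; simp
  have h3 : sigmaMin B ^ 2 * ‖x‖ ^ 2 ≤ ‖T x‖ ^ 2 := by
    rw [h1, h2, Finset.mul_sum]
    refine Finset.sum_le_sum fun i _ => mul_le_mul_of_nonneg_right ?_ (sq_nonneg _)
    have hl : n - 1 < n := by omega
    rw [sigmaMin, T.sq_singularValues_of_lt hfin hl]
    exact hS.eigenvalues_antitone hfin (by rw [Fin.le_def]; simp; omega)
  refine le_of_sq_le (vnorm_nonneg _) ?_
  rw [mul_pow]
  exact h3

theorem exists_vnorm_eq_sigmaMin {m n : ℕ} (hn : 0 < n) (B : Matrix (Fin m) (Fin n) ℝ) :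
    ∃ v : Fin n → ℝ, 0 < vnorm v ∧ vnorm (B *ᵥ v) = sigmaMin B * vnorm v := by
  set T := Matrix.toEuclideanLin B with hT
  have hfin : n - 1 < Module.finrank ℝ (EuclideanSpace ℝ (Fin n)) := by simp; omega
  obtain ⟨x, hx⟩ := (T.hasEigenvalue_adjoint_comp_self_sq_singularValues hfin).exists_hasEigenvector
  refine ⟨x.ofLp, vnorm_pos fun h => hx.2 (by ext i; simpa using congrFun h i), ?_⟩
  have h1 : ‖T x‖ ^ 2 = (sigmaMin B * ‖x‖) ^ 2 := by
    have e1 : ‖T x‖ ^ 2 = inner ℝ x ((T.adjoint ∘ₗ T) x) := by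
      rw [LinearMap.comp_apply, LinearMap.adjoint_inner_right, real_inner_self_eq_norm_sq]
    rw [e1, hx.apply_eq_smul, real_inner_smul_right, real_inner_self_eq_norm_sq, sigmaMin, mul_pow]; rfl
  exact (sq_eq_sq₀ (norm_nonneg _) (mul_nonneg (sigmaMin_nonneg B) (norm_nonneg _))).1 h1

/-! ### Elementary rounding errors -/

namespace Precision
variable (P : Precision)

theorem fl_zero : P.fl 0 = 0 := by simpa using P.fl_err 0

theorem abs_fl_le (t : ℝ) : |P.fl t| ≤ (1 + P.u) * |t| := by
  have h := P.fl_err t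
  have h2 : |P.fl t| ≤ |t| + |P.fl t - t| := by
    calc |P.fl t| = |t + (P.fl t - t)| := by ring_nf
      _ ≤ _ := abs_add_le _ _
  linarith

/-- In one accumulation step the new term is rounded twice and the partial sum once. The sign `s`
covers sums and successive subtractions alike. -/
theorem fl_sub_fl_err (t a s : ℝ) (hs : |s| = 1) :
    |P.fl (t + s * P.fl a) - (t + s * a)| ≤ P.u * |t| + ((1 + P.u) ^ 2 - 1) * |a| := by
  have h1 := P.fl_err (t + s * P.fl a)
  have h2 := P.fl_err a
  have h3 := P.abs_fl_le a
  have h4 : |t + s * P.fl a| ≤ |t| + |P.fl a| := by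
    refine (abs_add_le _ _).trans ?_
    rw [abs_mul, hs, one_mul]
  have h5 : |P.fl (t + s * P.fl a) - (t + s * a)| ≤
      |P.fl (t + s * P.fl a) - (t + s * P.fl a)| + |P.fl a - a| := by
    calc _ = |(P.fl (t + s * P.fl a) - (t + s * P.fl a)) + s * (P.fl a - a)| := by ring_nf
      _ ≤ _ := (abs_add_le _ _).trans (by rw [abs_mul s, hs, one_mul])
  have h6 := mul_le_mul_of_nonneg_left (h4.trans (add_le_add_right h3 _)) P.u_pos.le
  nlinarith

end Precision

/-! ### Recursive summation with sparsity -/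

section Accumulate
variable {ι : Type*}

open Classical in
/-- Number of nonzero values of `f` along the list `l`. -/
noncomputable def nnzList (f : ι → ℝ) (l : List ι) : ℕ :=
  (l.map fun j => if f j ≠ 0 then 1 else 0).sum

variable (P : Precision) (s : ℝ) (f x : ι → ℝ)

/-- Recursive accumulation of `t + s ∑ f j * x j` over a list. -/
noncomputable def accum (l : List ι) (t : ℝ) : ℝ :=
  l.foldl (fun t j => P.fl (t + s * P.fl (f j * x j))) t

/-- A zero coefficient costs nothing: `fl 0 = 0`, and the running value is already a floating-point
number, which is what `fl t = t` provides. So only nonzero coefficients raise the exponent. -/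
theorem accum_err (hs : |s| = 1) (l : List ι) (t : ℝ) (ht : P.fl t = t) :
    |accum P s f x l t - (t + s * (l.map fun j => f j * x j).sum)| ≤
      ((1 + P.u) ^ nnzList f l - 1) * |t| +
        ((1 + P.u) ^ (nnzList f l + 1) - 1) * (l.map fun j => |f j * x j|).sum := by
  induction l generalizing t with
  | nil => simp [accum, nnzList]
  | cons j l ih =>
    have hu := P.u_pos
    by_cases hj : f j = 0
    · have := ih t ht
      simpa [accum, nnzList, hj, P.fl_zero, ht] using this
    · set a := f j * x j with ha
      set t' := P.fl (t + s * P.fl a) with ht'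
      have h1 := ih t' (P.fl_idem _)
      have h2 := P.fl_sub_fl_err t a s hs
      rw [← ht'] at h2
      have hk : nnzList f (j :: l) = nnzList f l + 1 := by simp [nnzList, hj, add_comm]
      have hacc : accum P s f x (j :: l) t = accum P s f x l t' := by
        simp [accum, ht', ha]
      rw [hk, hacc]
      simp only [List.map_cons, List.sum_cons]
      rw [← ha]
      set S := (l.map fun j => f j * x j).sum
      set S' := (l.map fun j => |f j * x j|).sum
      set q := (1 + P.u) ^ nnzList f l with hq
      have hq1 : 1 ≤ q := one_le_pow₀ (by linarith)
      have e1 : (1 + P.u) ^ (nnzList f l + 1) = q * (1 + P.u) := by rw [pow_succ]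
      have e2 : (1 + P.u) ^ (nnzList f l + 1 + 1) = q * (1 + P.u) ^ 2 := by rw [hq]; ring
      rw [e1] at h1
      rw [e1, e2]
      have h3 : |t'| ≤ (1 + P.u) * |t| + (1 + P.u) ^ 2 * |a| := by
        have h4 : |t'| ≤ |t + s * a| + |t' - (t + s * a)| := by
          calc |t'| = |(t + s * a) + (t' - (t + s * a))| := by ring_nf
            _ ≤ _ := abs_add_le _ _
        have h5 : |t + s * a| ≤ |t| + |a| := by
          refine (abs_add_le _ _).trans ?_
          rw [abs_mul, hs, one_mul]
        linarith
      have h6 : |accum P s f x l t' - (t + s * (a + S))| ≤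
          |accum P s f x l t' - (t' + s * S)| + |t' - (t + s * a)| := by
        calc _ = |(accum P s f x l t' - (t' + s * S)) + (t' - (t + s * a))| := by ring_nf
          _ ≤ _ := abs_add_le _ _
      have h7 := mul_le_mul_of_nonneg_left h3 (sub_nonneg.2 hq1)
      have hS' : 0 ≤ S' := by
        apply List.sum_nonneg
        simp only [List.mem_map]
        rintro _ ⟨_, _, rfl⟩
        exact abs_nonneg _
      have h8 : q * (1 + P.u) - 1 ≤ q * (1 + P.u) ^ 2 - 1 := by
        have : 0 ≤ q * (1 + P.u) * P.u := by positivity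
        linarith
      have h9 := mul_le_mul_of_nonneg_right h8 hS'
      nlinarith

/-- Starting from 0 saves one rounding: the first addition `0 + fl a` is exact by idempotence. -/
theorem accum_zero_err (l : List ι) :
    |accum P 1 f x l 0 - (l.map fun j => f j * x j).sum| ≤
      ((1 + P.u) ^ nnzList f l - 1) * (l.map fun j => |f j * x j|).sum := by
  induction l with
  | nil => simp [accum]
  | cons j l ih =>
    have hu := P.u_pos
    by_cases hj : f j = 0
    · simpa [accum, nnzList, hj, P.fl_zero] using ih
    · set a := f j * x j with ha
      have hk : nnzList f (j :: l) = nnzList f l + 1 := by simp [nnzList, hj, add_comm]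
      have hacc : accum P 1 f x (j :: l) 0 = accum P 1 f x l (P.fl a) := by
        simp [accum, ha, P.fl_idem]
      rw [hk, hacc]
      have h1 := accum_err P 1 f x (by simp) l (P.fl a) (P.fl_idem a)
      have h2 := P.fl_err a
      have h3 := P.abs_fl_le a
      simp only [List.map_cons, List.sum_cons]
      rw [← ha]
      set S := (l.map fun j => f j * x j).sum
      set S' := (l.map fun j => |f j * x j|).sum
      set q := (1 + P.u) ^ nnzList f l with hq
      have hq1 : 1 ≤ q := one_le_pow₀ (by linarith)
      have e1 : (1 + P.u) ^ (nnzList f l + 1) = q * (1 + P.u) := by rw [pow_succ]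
      rw [e1] at h1 ⊢
      have h6 : |accum P 1 f x l (P.fl a) - (a + S)| ≤
          |accum P 1 f x l (P.fl a) - (P.fl a + 1 * S)| + |P.fl a - a| := by
        calc _ = |(accum P 1 f x l (P.fl a) - (P.fl a + 1 * S)) + (P.fl a - a)| := by ring_nf
          _ ≤ _ := abs_add_le _ _
      have h7 := mul_le_mul_of_nonneg_left h3 (sub_nonneg.2 hq1)
      nlinarith

theorem nnzList_le_length (l : List ι) : nnzList f l ≤ l.length := by
  induction l with
  | nil => simp [nnzList]
  | cons j l ih =>
    have : nnzList f (j :: l) = (if f j ≠ 0 then 1 else 0) + nnzList f l := by simp [nnzList]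
    rw [this, List.length_cons]
    split_ifs <;> omega

open Classical in
theorem nnzList_finRange {n : ℕ} (f : Fin n → ℝ) :
    nnzList f (List.finRange n) = (Finset.univ.filter fun j => f j ≠ 0).card := by
  rw [nnzList, ← Fin.sum_univ_def, Finset.card_filter]

theorem accum_one_eq_dot (l : List ι) : accum P 1 f x l 0 = P.dot l f x := by
  simp [accum, Precision.dot]

theorem dot_err {n : ℕ} (f x : Fin n → ℝ) :
    |P.dot (List.finRange n) f x - f ⬝ᵥ x| ≤
      ((1 + P.u) ^ nnzList f (List.finRange n) - 1) * ∑ j, |f j * x j| := by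
  have := accum_zero_err P f x (List.finRange n)
  rwa [accum_one_eq_dot, ← Fin.sum_univ_def, ← Fin.sum_univ_def] at this

end Accumulate

theorem one_add_pow_sub_one_le {u : ℝ} (hu : 0 ≤ u) {p : ℕ} (h : p * u ≤ 1) :
    (1 + u) ^ p - 1 ≤ p * u * (1 + p * u) := by
  have h1 : (1 + u) ^ p ≤ Real.exp (p * u) := by
    rw [Real.exp_nat_mul]
    exact pow_le_pow_left₀ (by linarith) (by linarith [Real.add_one_le_exp u]) _
  have h0 : 0 ≤ (p : ℝ) * u := by positivity
  have h2 := Real.abs_exp_sub_one_sub_id_le (x := p * u) (by rwa [abs_of_nonneg h0])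
  have h3 := (abs_le.1 h2).2
  nlinarith

/-! ### The computed residual of the augmented system -/

section Residual
variable {m n : ℕ}

open Classical in
theorem card_nnz_le_maxRowNnz {ι : Type*} [Fintype ι] (M : Matrix ι ι ℝ) (d : ι → ℝ) (a : ι) :
    (Finset.univ.filter fun c => M a c ≠ 0).card ≤ maxRowNnz M d := by
  have := Finset.le_sup (f := fun a => (Finset.univ.filter fun c => M a c ≠ 0).card +
    (if d a ≠ 0 then 1 else 0)) (Finset.mem_univ a)
  exact (Nat.le_add_right _ _).trans this

/-- The extra 1 is the diagonal entry of the identity block; it pays for the rounding of `b i - r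
i`. -/
theorem nnz_row_lt_maxRowNnz (A : Matrix (Fin m) (Fin n) ℝ) (d : Fin m ⊕ Fin n → ℝ) (i : Fin m) :
    nnzList (fun j => A i j) (List.finRange n) + 1 ≤ maxRowNnz (augM A 1) d := by
  classical
  refine le_trans ?_ (card_nnz_le_maxRowNnz (augM A 1) d (Sum.inl i))
  rw [Finset.card_filter, Fintype.sum_sum_type, nnzList_finRange, Finset.card_filter, add_comm]
  refine add_le_add ?_ (le_of_eq ?_)
  · refine le_trans ?_ (Finset.single_le_sum (f := fun c : Fin m =>
      if augM A 1 (Sum.inl i) (Sum.inl c) ≠ 0 then 1 else 0) (fun _ _ => Nat.zero_le _)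
      (Finset.mem_univ i))
    simp [augM]
  · refine Finset.sum_congr rfl fun j _ => ?_
    simp [augM]

theorem nnz_col_le_maxRowNnz (A : Matrix (Fin m) (Fin n) ℝ) (d : Fin m ⊕ Fin n → ℝ) (j : Fin n) :
    nnzList (fun i => A i j) (List.finRange m) ≤ maxRowNnz (augM A 1) d := by
  classical
  refine le_trans ?_ (card_nnz_le_maxRowNnz (augM A 1) d (Sum.inr j))
  rw [Finset.card_filter, Fintype.sum_sum_type, nnzList_finRange, Finset.card_filter]
  refine le_trans (le_of_eq ?_) (Nat.le_add_right _ _)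
  refine Finset.sum_congr rfl fun i _ => ?_
  simp [augM]

/-- A nonzero entry of `A` shares its row with a diagonal 1. The lower bound 2 later lets the two
error sources `u` and `γ √p` be merged into one maximum. -/
theorem two_le_maxRowNnz {A : Matrix (Fin m) (Fin n) ℝ} (hA : A ≠ 0) (d : Fin m ⊕ Fin n → ℝ) :
    2 ≤ maxRowNnz (augM A 1) d := by
  classical
  obtain ⟨i, j, hij⟩ : ∃ i j, A i j ≠ 0 := by
    by_contra! h
    exact hA (by ext i j; simpa using h i j)
  have h1 := nnz_row_lt_maxRowNnz A d i
  have h2 : 1 ≤ nnzList (fun j => A i j) (List.finRange n) := by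
    rw [nnzList_finRange, Nat.succ_le_iff, Finset.card_pos]
    exact ⟨j, by simpa using hij⟩
  omega

theorem augM_mulVec (A : Matrix (Fin m) (Fin n) ℝ) (α : ℝ) (v : Fin m ⊕ Fin n → ℝ) :
    augM A α *ᵥ v = Sum.elim
      (α • (fun i => v (Sum.inl i)) + A *ᵥ (fun j => v (Sum.inr j)))
      (Aᵀ *ᵥ (fun i => v (Sum.inl i))) := by
  rw [augM, Matrix.fromBlocks_mulVec]
  simp [Matrix.smul_mulVec, Function.comp_def]

theorem absM_augM_mulVec (A : Matrix (Fin m) (Fin n) ℝ) {α : ℝ} (hα : 0 ≤ α)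
    (v : Fin m ⊕ Fin n → ℝ) :
    absM (augM A α) *ᵥ v = Sum.elim
      (α • (fun i => v (Sum.inl i)) + absM A *ᵥ (fun j => v (Sum.inr j)))
      ((absM A)ᵀ *ᵥ (fun i => v (Sum.inl i))) := by
  have : absM (augM A α) = Matrix.fromBlocks (α • (1 : Matrix (Fin m) (Fin m) ℝ)) (absM A)
      (absM A)ᵀ 0 := by
    ext a c
    rcases a with a | a <;> rcases c with c | c <;>
      simp [absM, augM, Matrix.one_apply, abs_of_nonneg hα, apply_ite abs]
  rw [this, Matrix.fromBlocks_mulVec]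
  simp [Matrix.smul_mulVec, Function.comp_def]

/-- Componentwise error of the computed residual. -/
theorem computedRes_err (P : Precision) (A : Matrix (Fin m) (Fin n) ℝ) (b : Fin m → ℝ)
    (d e : Fin m ⊕ Fin n → ℝ) (a : Fin m ⊕ Fin n) :
    |computedRes P A b e a - (rhs n b - augM A 1 *ᵥ e) a| ≤
      ((1 + P.u) ^ maxRowNnz (augM A 1) d - 1) *
        (|rhs n b a| + (absM (augM A 1) *ᵥ fun c => |e c|) a) := by
  set p := maxRowNnz (augM A 1) d with hp
  have hu := P.u_pos
  have hmono : ∀ k : ℕ, k ≤ p → (1 + P.u) ^ k - 1 ≤ (1 + P.u) ^ p - 1 := fun k hk =>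
    sub_le_sub_right (pow_le_pow_right₀ (by linarith) hk) _
  rw [absM_augM_mulVec A zero_le_one, augM_mulVec]
  rcases a with i | j
  · simp only [computedRes, rhs, Sum.elim_inl, Pi.sub_apply, Pi.add_apply, one_smul]
    set β := b i - e (Sum.inl i) with hβ
    have hfun : (List.finRange n).foldl
        (fun t j => P.fl (t - P.fl (A i j * e (Sum.inr j)))) (P.fl β) =
        accum P (-1) (fun j => A i j) (fun j => e (Sum.inr j)) (List.finRange n) (P.fl β) := by
      simp [accum, sub_eq_add_neg]
    rw [hfun]
    have h1 := accum_err P (-1) (fun j => A i j) (fun j => e (Sum.inr j)) (by simp)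
      (List.finRange n) (P.fl β) (P.fl_idem _)
    rw [← Fin.sum_univ_def, ← Fin.sum_univ_def] at h1
    have h2 := P.fl_err β
    have h3 := P.abs_fl_le β
    have hk := hmono _ (nnz_row_lt_maxRowNnz A d i)
    set k := nnzList (fun j => A i j) (List.finRange n)
    have e1 : (A *ᵥ fun j => e (Sum.inr j)) i = ∑ j, A i j * e (Sum.inr j) := rfl
    have e2 : (absM A *ᵥ fun j => |e (Sum.inr j)|) i = ∑ j, |A i j * e (Sum.inr j)| := by
      simp [absM, Matrix.mulVec, dotProduct, abs_mul]
    rw [e1, e2]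
    set S := ∑ j, A i j * e (Sum.inr j)
    set S' := ∑ j, |A i j * e (Sum.inr j)|
    have hS' : 0 ≤ S' := Finset.sum_nonneg fun _ _ => abs_nonneg _
    set q := (1 + P.u) ^ k with hq
    have hq1 : 1 ≤ q := one_le_pow₀ (by linarith)
    have e3 : (1 + P.u) ^ (k + 1) = q * (1 + P.u) := by rw [pow_succ]
    rw [e3] at h1 hk
    set Z := accum P (-1) (fun j => A i j) (fun j => e (Sum.inr j)) (List.finRange n) (P.fl β)
    have h6 : |Z - (b i - (e (Sum.inl i) + S))| ≤ |Z - (P.fl β + -1 * S)| + |P.fl β - β| := by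
      calc _ = |(Z - (P.fl β + -1 * S)) + (P.fl β - β)| := by rw [hβ]; ring_nf
        _ ≤ _ := abs_add_le _ _
    have h7 := mul_le_mul_of_nonneg_left h3 (sub_nonneg.2 hq1)
    have h8 : |β| ≤ |b i| + |e (Sum.inl i)| := abs_sub _ _
    -- The initial rounding and the accumulation combine exactly: `(q - 1)(1 + u) + u = q(1 + u) -
    -- 1`.
    have h9 : |Z - (b i - (e (Sum.inl i) + S))| ≤ (q * (1 + P.u) - 1) * (|β| + S') := by nlinarith
    refine h9.trans ?_
    have h10 : |β| + S' ≤ |b i| + (|e (Sum.inl i)| + S') := by linarith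
    exact mul_le_mul hk h10 (by positivity) (by nlinarith [hmono 0 (Nat.zero_le _)])
  · simp only [computedRes, rhs, Sum.elim_inr, Pi.sub_apply, Pi.zero_apply, abs_zero, zero_add]
    have h1 := dot_err P (fun i => A i j) (fun i => e (Sum.inl i))
    have hk := hmono _ (nnz_col_le_maxRowNnz A d j)
    have e1 : (Aᵀ *ᵥ fun i => e (Sum.inl i)) j = (fun i => A i j) ⬝ᵥ (fun i => e (Sum.inl i)) := rfl
    have e2 : ((absM A)ᵀ *ᵥ fun i => |e (Sum.inl i)|) j = ∑ i, |A i j * e (Sum.inl i)| := by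
      simp [absM, Matrix.mulVec, dotProduct, abs_mul]
    rw [e1, e2, zero_sub, neg_sub_neg, abs_sub_comm]
    exact h1.trans (mul_le_mul_of_nonneg_right hk (Finset.sum_nonneg fun _ _ => abs_nonneg _))

end Residual

/-! ### Calculus of relative errors -/

section RelativeError

/-- `a` approximates `b` with relative error at most `e`. -/
def RelErr (e a b : ℝ) : Prop := |a - b| ≤ e * |b|

theorem RelErr.mono {e e' a b : ℝ} (h : RelErr e a b) (he : e ≤ e') : RelErr e' a b :=
  le_trans h (mul_le_mul_of_nonneg_right he (abs_nonneg b))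

theorem RelErr.abs_le {e a b : ℝ} (h : RelErr e a b) : |a| ≤ (1 + e) * |b| := by
  have h1 : |a| ≤ |b| + |a - b| := by
    calc |a| = |b + (a - b)| := by ring_nf
      _ ≤ _ := abs_add_le _ _
  unfold RelErr at h
  linarith

theorem RelErr.fl {e a b : ℝ} (h : RelErr e a b) (P : Precision) :
    RelErr (e + P.u * (1 + e)) (P.fl a) b := by
  have h1 := P.fl_err a
  have h2 := mul_le_mul_of_nonneg_left h.abs_le P.u_pos.le
  have h3 : |P.fl a - b| ≤ |P.fl a - a| + |a - b| := abs_sub_le _ _ _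
  unfold RelErr at h ⊢
  linarith

theorem RelErr.mul {e e' a a' b b' : ℝ} (h : RelErr e a b) (h' : RelErr e' a' b') :
    RelErr (e + e' + e * e') (a * a') (b * b') := by
  unfold RelErr
  have h1 : |a * a' - b * b'| ≤ |a - b| * |a'| + |b| * |a' - b'| := by
    calc _ = |(a - b) * a' + b * (a' - b')| := by ring_nf
      _ ≤ _ := (abs_add_le _ _).trans (by rw [abs_mul, abs_mul])
  have h2 : |a - b| * |a'| ≤ (e * |b|) * ((1 + e') * |b'|) :=
    mul_le_mul h h'.abs_le (abs_nonneg _) (le_trans (abs_nonneg _) h)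
  have h3 : |b| * |a' - b'| ≤ |b| * (e' * |b'|) := mul_le_mul_of_nonneg_left h' (abs_nonneg _)
  rw [abs_mul b b']
  nlinarith

/-- If `b = 0` then `a = 0` as well and both inverses are 0, so zero columns need no separate
treatment in the QR analysis. -/
theorem RelErr.inv {e a b : ℝ} (he : e < 1) (h : RelErr e a b) : RelErr (e / (1 - e)) a⁻¹ b⁻¹ := by
  unfold RelErr at *
  by_cases hb : b = 0
  · subst hb
    have : a = 0 := by simpa using h
    simp [this]
  have hb' : 0 < |b| := abs_pos.2 hb
  have h1 : |b| ≤ |a| + |a - b| := by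
    calc |b| = |a - (a - b)| := by ring_nf
      _ ≤ _ := abs_sub _ _
  have h2 : (1 - e) * |b| ≤ |a| := by linarith
  have h3 : 0 < 1 - e := by linarith
  have ha' : 0 < |a| := lt_of_lt_of_le (by positivity) h2
  have ha : a ≠ 0 := abs_pos.1 ha'
  have e1 : a⁻¹ - b⁻¹ = (b - a) / (a * b) := by field_simp
  rw [e1, abs_div, abs_mul, abs_inv, abs_sub_comm b a, div_le_iff₀ (by positivity)]
  calc |a - b| ≤ e * |b| := h
    _ = e / (1 - e) * ((1 - e) * |b|) := by field_simp
    _ ≤ e / (1 - e) * |a| := by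
        refine mul_le_mul_of_nonneg_left h2 (div_nonneg ?_ h3.le)
        by_contra hneg
        have : e * |b| < 0 := mul_neg_of_neg_of_pos (not_le.1 hneg) hb'
        linarith [abs_nonneg (a - b)]
    _ = e / (1 - e) * |b|⁻¹ * (|a| * |b|) := by field_simp

theorem RelErr.sqrt {e a b : ℝ} (hb : 0 ≤ b) (he : e ≤ 1) (he0 : 0 ≤ e) (h : RelErr e a b) :
    RelErr e (Real.sqrt a) (Real.sqrt b) := by
  unfold RelErr at *
  rw [abs_of_nonneg hb] at h
  have h' := _root_.abs_le.1 h
  have ha : 0 ≤ a := by nlinarith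
  rw [abs_of_nonneg (Real.sqrt_nonneg b), _root_.abs_le]
  constructor
  · have : (1 - e) * √b ≤ √a := by
      apply Real.le_sqrt_of_sq_le
      rw [mul_pow, Real.sq_sqrt hb]
      have : (1 - e) ^ 2 ≤ 1 - e := by nlinarith
      nlinarith [mul_le_mul_of_nonneg_right this hb]
    linarith
  · have : √a ≤ (1 + e) * √b := by
      apply Real.sqrt_le_iff.2 ⟨by positivity, ?_⟩
      rw [mul_pow, Real.sq_sqrt hb]
      nlinarith [mul_nonneg he0 hb, mul_nonneg (mul_nonneg he0 he0) hb]
    linarith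

end RelativeError

/-! ### Exact Householder reflectors -/

section Reflector
variable {s : ℕ}

/-- The diagonal entry `σ = sign(z κ) ‖z‖` of the exact Householder reflector. -/
noncomputable def hhSigma (z : Fin s → ℝ) (κ : Fin s) : ℝ :=
  if 0 ≤ z κ then vnorm z else -vnorm z

/-- The exact Householder vector. -/
noncomputable def hhVec (z : Fin s → ℝ) (κ : Fin s) : Fin s → ℝ :=
  Function.update z κ (z κ + hhSigma z κ)

/-- The exact Householder scaling `1 / (σ v₀)`. -/
noncomputable def hhEta (z : Fin s → ℝ) (κ : Fin s) : ℝ :=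
  (hhSigma z κ * (z κ + hhSigma z κ))⁻¹

/-- The exact Householder reflector. -/
noncomputable def hhMat (z : Fin s → ℝ) (κ : Fin s) : Matrix (Fin s) (Fin s) ℝ :=
  1 - hhEta z κ • Matrix.vecMulVec (hhVec z κ) (hhVec z κ)

variable (z : Fin s → ℝ) (κ : Fin s)

theorem hhMat_mulVec (x : Fin s → ℝ) :
    hhMat z κ *ᵥ x = x - (hhEta z κ * (hhVec z κ ⬝ᵥ x)) • hhVec z κ := by
  rw [hhMat, Matrix.sub_mulVec, Matrix.one_mulVec, Matrix.smul_mulVec, Matrix.vecMulVec_mulVec]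
  ext i
  simp [mul_assoc]

theorem abs_hhSigma : |hhSigma z κ| = vnorm z := by
  rw [hhSigma]; split_ifs <;> simp [abs_of_nonneg, vnorm_nonneg]

theorem hhSigma_sq : hhSigma z κ ^ 2 = vnorm z ^ 2 := by
  rw [← sq_abs, abs_hhSigma]

theorem hhSigma_mul_nonneg : 0 ≤ hhSigma z κ * z κ := by
  rw [hhSigma]
  split_ifs with h
  · exact mul_nonneg (vnorm_nonneg _) h
  · nlinarith [vnorm_nonneg z, not_le.1 h]

theorem hhEta_nonneg : 0 ≤ hhEta z κ := by
  rw [hhEta]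
  apply inv_nonneg.2
  nlinarith [hhSigma_mul_nonneg z κ, sq_nonneg (hhSigma z κ)]

theorem vnorm_update_sq (t : ℝ) :
    vnorm (Function.update z κ t) ^ 2 = vnorm z ^ 2 - z κ ^ 2 + t ^ 2 := by
  rw [vnorm_sq, vnorm_sq, ← Finset.add_sum_erase _ _ (Finset.mem_univ κ),
    ← Finset.add_sum_erase _ (fun a => z a ^ 2) (Finset.mem_univ κ)]
  have : ∑ x ∈ Finset.univ.erase κ, Function.update z κ t x ^ 2 =
      ∑ x ∈ Finset.univ.erase κ, z x ^ 2 :=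
    Finset.sum_congr rfl fun x hx => by rw [Function.update_of_ne (Finset.ne_of_mem_erase hx)]
  rw [this, Function.update_self]
  ring

theorem vnorm_hhVec_sq :
    vnorm (hhVec z κ) ^ 2 = 2 * (hhSigma z κ * (z κ + hhSigma z κ)) := by
  rw [hhVec, vnorm_update_sq, ← hhSigma_sq z κ]; ring

/-- The value is exactly 2 unless the denominator of the scaling vanishes; then `0⁻¹ = 0` makes the
reflector the identity. -/
theorem hhEta_mul_vnorm_sq_le : hhEta z κ * vnorm (hhVec z κ) ^ 2 ≤ 2 := by
  rw [vnorm_hhVec_sq, hhEta]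
  by_cases h : hhSigma z κ * (z κ + hhSigma z κ) = 0
  · simp [h]
  · rw [mul_left_comm, inv_mul_cancel₀ h, mul_one]

/-- This identity makes `1 - η v vᵀ` an isometry: in `‖x - η (vᵀx) v‖²` the quadratic term cancels
the cross term. -/
theorem hhEta_sq_mul : hhEta z κ ^ 2 * vnorm (hhVec z κ) ^ 2 = 2 * hhEta z κ := by
  rw [vnorm_hhVec_sq, hhEta]
  by_cases h : hhSigma z κ * (z κ + hhSigma z κ) = 0
  · simp [h]
  · field_simp

theorem vnorm_hhMat_mulVec (x : Fin s → ℝ) : vnorm (hhMat z κ *ᵥ x) = vnorm x := by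
  have : vnorm (hhMat z κ *ᵥ x) ^ 2 = vnorm x ^ 2 := by
    rw [hhMat_mulVec, ← dotProduct_self_eq, ← dotProduct_self_eq x]
    set v := hhVec z κ
    have h := hhEta_sq_mul z κ
    rw [← dotProduct_self_eq] at h
    simp only [sub_dotProduct, dotProduct_sub, smul_dotProduct, dotProduct_smul, smul_eq_mul]
    rw [dotProduct_comm x v]
    linear_combination (v ⬝ᵥ x) ^ 2 * h
  exact (sq_eq_sq₀ (vnorm_nonneg _) (vnorm_nonneg _)).1 this

theorem hhVec_dotProduct (x : Fin s → ℝ) :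
    hhVec z κ ⬝ᵥ x = z ⬝ᵥ x + hhSigma z κ * x κ := by
  have : hhVec z κ = z + Pi.single κ (hhSigma z κ) := by
    ext i
    by_cases h : i = κ
    · subst h; simp [hhVec]
    · simp [hhVec, h]
  rw [this, add_dotProduct, single_dotProduct]

/-- The sign of `σ` is that of `z κ`, so there is no cancellation in the leading entry of the
Householder vector. -/
theorem abs_add_hhSigma : |z κ + hhSigma z κ| = |z κ| + vnorm z := by
  rw [hhSigma]
  split_ifs with h
  · rw [abs_of_nonneg h, abs_of_nonneg (add_nonneg h (vnorm_nonneg z))]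
  · have := vnorm_nonneg z
    rw [abs_of_neg (not_le.1 h), abs_of_nonpos (by linarith [not_le.1 h])]; ring

theorem hhMat_mulVec_self : hhMat z κ *ᵥ z = Pi.single κ (-hhSigma z κ) := by
  by_cases hz : z = 0
  · subst hz
    have : hhSigma (0 : Fin s → ℝ) κ = 0 := by simp [hhSigma, vnorm_zero]
    simp [this]
  have h1 : hhEta z κ * (hhVec z κ ⬝ᵥ z) = 1 := by
    rw [hhVec_dotProduct, dotProduct_self_eq, ← hhSigma_sq z κ, hhEta]
    have h2 : hhSigma z κ ≠ 0 := by
      intro h; have := abs_hhSigma z κ; rw [h] at this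
      simp at this; exact (vnorm_pos hz).ne this
    have h3 : z κ + hhSigma z κ ≠ 0 := by
      intro h; have := abs_add_hhSigma z κ; rw [h] at this
      simp at this; linarith [vnorm_pos hz, abs_nonneg (z κ)]
    field_simp
    ring
  rw [hhMat_mulVec, h1, one_smul]
  ext i
  by_cases h : i = κ
  · subst h; simp [hhVec]
  · simp [hhVec, h]

theorem hhMat_mulVec_of_disjoint (x : Fin s → ℝ) (hx : ∀ i, hhVec z κ i = 0 ∨ x i = 0) :
    hhMat z κ *ᵥ x = x := by
  have : hhVec z κ ⬝ᵥ x = 0 := Finset.sum_eq_zero fun i _ => by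
    rcases hx i with h | h <;> simp [h]
  rw [hhMat_mulVec, this]; simp

end Reflector

/-! ### Householder reflectors in floating-point arithmetic -/

section FloatingReflector
variable {s : ℕ} (P : Precision)

theorem dot_err_vnorm {δ : ℝ} (hδ : s * P.u ≤ δ) (hδ1 : δ ≤ 1 / 1000) (v x : Fin s → ℝ) :
    |P.dot (List.finRange s) v x - v ⬝ᵥ x| ≤ 2 * δ * ∑ j, |v j * x j| := by
  refine (dot_err P v x).trans
    (mul_le_mul_of_nonneg_right ?_ (Finset.sum_nonneg fun _ _ => abs_nonneg _))
  have hu := P.u_pos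
  have h1 : nnzList v (List.finRange s) ≤ s := by
    simpa using nnzList_le_length v (List.finRange s)
  have h2 : (1 + P.u) ^ nnzList v (List.finRange s) ≤ (1 + P.u) ^ s :=
    pow_le_pow_right₀ (by linarith) h1
  have h3 := one_add_pow_sub_one_le hu.le (p := s) (by linarith)
  have h0 : 0 ≤ s * P.u := by positivity
  nlinarith

/-- The computed value of `σ`. -/
noncomputable def flSigma (z : Fin s → ℝ) (κ : Fin s) : ℝ :=
  if 0 ≤ z κ then P.nrm (List.finRange s) z else -P.nrm (List.finRange s) z

/-- The computed entry `v₀` of the Householder vector. -/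
noncomputable def flLead (z : Fin s → ℝ) (κ : Fin s) : ℝ := P.fl (z κ + flSigma P z κ)

/-- The computed Householder vector. -/
noncomputable def flVec (z : Fin s → ℝ) (κ : Fin s) : Fin s → ℝ :=
  Function.update z κ (flLead P z κ)

/-- The computed Householder scaling. -/
noncomputable def flEta (z : Fin s → ℝ) (κ : Fin s) : ℝ :=
  P.fl (1 / P.fl (flSigma P z κ * flLead P z κ))

variable (z : Fin s → ℝ) (κ : Fin s) {δ : ℝ} (hδ : s * P.u ≤ δ) (hδ1 : δ ≤ 1 / 1000)
include κ hδ

theorem unit_roundoff_le : P.u ≤ δ := by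
  have h1 : (1 : ℝ) ≤ s := by
    exact_mod_cast (Nat.zero_le _).trans_lt κ.2
  nlinarith [P.u_pos]

include hδ1

/-- All terms of `zᵀz` are nonnegative, so the summation error is relative to the result; the square
root does not enlarge it. -/
theorem flSigma_err : RelErr (4 * δ) (flSigma P z κ) (hhSigma z κ) := by
  have hu := unit_roundoff_le P κ hδ
  have hu0 := P.u_pos
  have h1 : RelErr (2 * δ) (P.dot (List.finRange s) z z) (vnorm z ^ 2) := by
    have := dot_err_vnorm P hδ hδ1 z z
    rw [dotProduct_self_eq] at this
    have e : ∑ j, |z j * z j| = vnorm z ^ 2 := by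
      rw [vnorm_sq]
      exact Finset.sum_congr rfl fun j _ => by rw [abs_mul_self]; ring
    rw [e] at this
    rwa [RelErr, abs_of_nonneg (sq_nonneg (vnorm z))]
  have h2 := (h1.sqrt (sq_nonneg _) (by linarith) (by linarith)).fl P
  rw [Real.sqrt_sq (vnorm_nonneg z)] at h2
  have h3 : RelErr (4 * δ) (P.nrm (List.finRange s) z) (vnorm z) :=
    RelErr.mono h2 (by nlinarith)
  rw [flSigma, hhSigma]
  split_ifs
  · exact h3
  · unfold RelErr at *
    rwa [neg_sub_neg, abs_sub_comm, abs_neg]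

/-- Since `|σ| ≤ |z κ + σ|`, the error of `σ` stays small relative to the sum. -/
theorem flLead_err : RelErr (6 * δ) (flLead P z κ) (z κ + hhSigma z κ) := by
  have hu := unit_roundoff_le P κ hδ
  have hu0 := P.u_pos
  have h1 : RelErr (4 * δ) (z κ + flSigma P z κ) (z κ + hhSigma z κ) := by
    have h := flSigma_err P z κ hδ hδ1
    unfold RelErr at *
    rw [add_sub_add_left_eq_sub]
    refine h.trans (mul_le_mul_of_nonneg_left ?_ (by linarith))
    rw [abs_hhSigma, abs_add_hhSigma]
    linarith [abs_nonneg (z κ)]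
  exact (h1.fl P).mono (by nlinarith)

/-- The budget: the factors `4δ` and `6δ` with one rounding give `12δ`, inversion gives `13δ`, and
the last rounding `16δ`. -/
theorem flEta_err : RelErr (16 * δ) (flEta P z κ) (hhEta z κ) := by
  have hu := unit_roundoff_le P κ hδ
  have hu0 := P.u_pos
  have h1 := ((flSigma_err P z κ hδ hδ1).mul (flLead_err P z κ hδ hδ1)).fl P
  have h2 := h1.mono (e' := 12 * δ) (by
    have hδ0 : 0 ≤ δ := hu0.le.trans hu
    have : P.u * (1 + (4 * δ + 6 * δ + 4 * δ * (6 * δ))) ≤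
        δ * (1 + (4 * δ + 6 * δ + 4 * δ * (6 * δ))) := mul_le_mul_of_nonneg_right hu (by positivity)
    nlinarith [mul_nonneg hδ0 hδ0, mul_nonneg hδ0 (mul_nonneg hδ0 hδ0),
      mul_le_mul_of_nonneg_left hδ1 hδ0,
      mul_le_mul_of_nonneg_left (mul_le_mul_of_nonneg_left hδ1 hδ0) hδ0])
  have h3 := (h2.inv (by linarith)).mono (e' := 13 * δ) (by
    rw [div_le_iff₀ (by linarith)]; nlinarith)
  have h4 := (h3.fl P).mono (e' := 16 * δ) (by nlinarith)
  rw [flEta, one_div]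
  exact h4

theorem flVec_err (i : Fin s) : RelErr (6 * δ) (flVec P z κ i) (hhVec z κ i) := by
  have hu := unit_roundoff_le P κ hδ
  have hu0 := P.u_pos
  by_cases h : i = κ
  · subst h
    simpa [flVec, hhVec] using flLead_err P z i hδ hδ1
  · have : 0 ≤ 6 * δ * |z i| := mul_nonneg (by linarith) (abs_nonneg _)
    simpa [flVec, hhVec, h, RelErr] using this

/-- Error of the multiple of the Householder vector that is subtracted from a column. -/
theorem flCoeff_err (x : Fin s → ℝ) :
    |P.fl (flEta P z κ * P.dot (List.finRange s) (flVec P z κ) x) -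
      hhEta z κ * (hhVec z κ ⬝ᵥ x)| ≤ 28 * δ * (hhEta z κ * vnorm (hhVec z κ) * vnorm x) := by
  have hu := unit_roundoff_le P κ hδ
  have hu0 := P.u_pos
  set η := flEta P z κ
  set η' := hhEta z κ
  set v := flVec P z κ
  set v' := hhVec z κ
  set D := P.dot (List.finRange s) v x
  set G := ∑ j, |v' j * x j| with hG
  have hη' : 0 ≤ η' := hhEta_nonneg z κ
  have hG0 : 0 ≤ G := Finset.sum_nonneg fun _ _ => abs_nonneg _
  have hGle : G ≤ vnorm v' * vnorm x := sum_abs_mul_le v' x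
  have hvx : |v' ⬝ᵥ x| ≤ G := Finset.abs_sum_le_sum_abs _ _
  have h1 : |D - v ⬝ᵥ x| ≤ 2 * δ * ((1 + 6 * δ) * G) := by
    refine (dot_err_vnorm P hδ hδ1 v x).trans (mul_le_mul_of_nonneg_left ?_ (by linarith))
    rw [hG, Finset.mul_sum]
    refine Finset.sum_le_sum fun j _ => ?_
    rw [abs_mul, abs_mul, ← mul_assoc]
    exact mul_le_mul_of_nonneg_right (flVec_err P z κ hδ hδ1 j).abs_le (abs_nonneg _)
  have h2 : |v ⬝ᵥ x - v' ⬝ᵥ x| ≤ 6 * δ * G := by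
    rw [← sub_dotProduct, hG, Finset.mul_sum]
    refine (Finset.abs_sum_le_sum_abs _ _).trans (Finset.sum_le_sum fun j _ => ?_)
    rw [abs_mul, abs_mul, ← mul_assoc]
    exact mul_le_mul_of_nonneg_right (flVec_err P z κ hδ hδ1 j) (abs_nonneg _)
  have h3 : |D - v' ⬝ᵥ x| ≤ 9 * δ * G := by
    refine (abs_sub_le D (v ⬝ᵥ x) _).trans ?_
    nlinarith [mul_nonneg (hu0.le.trans hu) hG0]
  have h4 : |η - η'| ≤ 16 * δ * η' := by
    have := flEta_err P z κ hδ hδ1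
    rwa [RelErr, abs_of_nonneg hη'] at this
  have h5 : |D| ≤ (1 + 9 * δ) * G := by
    have : |D| ≤ |v' ⬝ᵥ x| + |D - v' ⬝ᵥ x| := by
      calc |D| = |v' ⬝ᵥ x + (D - v' ⬝ᵥ x)| := by ring_nf
        _ ≤ _ := abs_add_le _ _
    linarith
  have h6 : |η * D - η' * (v' ⬝ᵥ x)| ≤ 26 * δ * (η' * G) := by
    have e : |η * D - η' * (v' ⬝ᵥ x)| ≤ |η - η'| * |D| + η' * |D - v' ⬝ᵥ x| := by
      calc _ = |(η - η') * D + η' * (D - v' ⬝ᵥ x)| := by ring_nf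
        _ ≤ _ := (abs_add_le _ _).trans (by rw [abs_mul, abs_mul, abs_of_nonneg hη'])
    have e1 : |η - η'| * |D| ≤ (16 * δ * η') * ((1 + 9 * δ) * G) :=
      mul_le_mul h4 h5 (abs_nonneg _) ((abs_nonneg _).trans h4)
    have e2 := mul_le_mul_of_nonneg_left h3 hη'
    have e3 : 0 ≤ δ * (η' * G) := mul_nonneg (hu0.le.trans hu) (mul_nonneg hη' hG0)
    nlinarith
  have h7 : |η' * (v' ⬝ᵥ x)| ≤ η' * G := by
    rw [abs_mul, abs_of_nonneg hη']; exact mul_le_mul_of_nonneg_left hvx hη'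
  have h8 : |η * D| ≤ (1 + 26 * δ) * (η' * G) := by
    have : |η * D| ≤ |η' * (v' ⬝ᵥ x)| + |η * D - η' * (v' ⬝ᵥ x)| := by
      calc |η * D| = |η' * (v' ⬝ᵥ x) + (η * D - η' * (v' ⬝ᵥ x))| := by ring_nf
        _ ≤ _ := abs_add_le _ _
    linarith
  have h9 := P.fl_err (η * D)
  have h10 : |P.fl (η * D) - η' * (v' ⬝ᵥ x)| ≤ 28 * δ * (η' * G) := by
    refine (abs_sub_le _ (η * D) _).trans ?_
    have e1 : P.u * |η * D| ≤ δ * ((1 + 26 * δ) * (η' * G)) :=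
      mul_le_mul hu h8 (abs_nonneg _) (by linarith)
    have e3 : 0 ≤ δ * (η' * G) := mul_nonneg (hu0.le.trans hu) (mul_nonneg hη' hG0)
    nlinarith
  refine h10.trans (mul_le_mul_of_nonneg_left ?_ (by linarith))
  rw [mul_assoc]
  exact mul_le_mul_of_nonneg_left hGle hη'

/-- Error of the computed reflector applied to a column, where rows in which the Householder vector
vanishes may be left untouched. -/
theorem flReflect_err (x y : Fin s → ℝ)
    (hy : ∀ i, (hhVec z κ i = 0 ∧ y i = x i) ∨ y i = P.fl (x i - P.fl (P.fl (flEta P z κ *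
      P.dot (List.finRange s) (flVec P z κ) x) * flVec P z κ i))) :
    vnorm (y - hhMat z κ *ᵥ x) ≤ 79 * δ * vnorm x := by
  have hu := unit_roundoff_le P κ hδ
  have hu0 := P.u_pos
  have hδ0 : 0 ≤ δ := hu0.le.trans hu
  have hμ := flCoeff_err P z κ hδ hδ1 x
  set μ := P.fl (flEta P z κ * P.dot (List.finRange s) (flVec P z κ) x)
  have hη' : 0 ≤ hhEta z κ := hhEta_nonneg z κ
  have hsq := hhEta_mul_vnorm_sq_le z κ
  rw [hhMat_mulVec]
  set η' := hhEta z κ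
  set v' := hhVec z κ with hv'
  set μ' := η' * (v' ⬝ᵥ x) with hμ'
  set m := η' * vnorm v' * vnorm x with hm
  have hm0 : 0 ≤ m := mul_nonneg (mul_nonneg hη' (vnorm_nonneg _)) (vnorm_nonneg _)
  have hμ'le : |μ'| ≤ m := by
    rw [hμ', abs_mul, abs_of_nonneg hη', hm, mul_assoc]
    exact mul_le_mul_of_nonneg_left (abs_dotProduct_le _ _) hη'
  -- The multiple of the Householder vector has error `37 δ m |v' i|`; rounding the subtraction adds
  -- `δ |x i|` and less than `2 δ m |v' i|`. Since `η' ‖v'‖² ≤ 2`, the norm of the sum is at most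
  -- `(1 + 2 · 39) δ ‖x‖`.
  have key : ∀ i, |(y - (x - μ' • v')) i| ≤ |(δ • (fun a => |x a|) +
      (39 * δ * m) • (fun a => |v' a|)) i| := by
    intro i
    have hr : 0 ≤ δ * |x i| + 39 * δ * m * |v' i| := by positivity
    simp only [Pi.sub_apply, Pi.add_apply, Pi.smul_apply, smul_eq_mul]
    rw [abs_of_nonneg hr]
    rcases hy i with ⟨h1, h2⟩ | h1
    · rw [h2, h1]; simpa [h1] using mul_nonneg hδ0 (abs_nonneg (x i))
    · rw [h1]
      have hv := flVec_err P z κ hδ hδ1 i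
      rw [← hv'] at hv
      have hvl := hv.abs_le
      unfold RelErr at hv
      set w := flVec P z κ i
      set V := |v' i|
      have hV : 0 ≤ V := abs_nonneg _
      have hmV : 0 ≤ m * V := mul_nonneg hm0 hV
      have e1 : |μ * w - μ' * v' i| ≤ 35 * δ * (m * V) := by
        have t1 : |μ * w - μ' * v' i| ≤ |μ - μ'| * |w| + |μ'| * |w - v' i| := by
          calc _ = |(μ - μ') * w + μ' * (w - v' i)| := by ring_nf
            _ ≤ _ := (abs_add_le _ _).trans (by rw [abs_mul, abs_mul])
        have t2 : |μ - μ'| * |w| ≤ (28 * δ * m) * ((1 + 6 * δ) * V) :=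
          mul_le_mul hμ hvl (abs_nonneg _) (by positivity)
        have t3 : |μ'| * |w - v' i| ≤ m * (6 * δ * V) :=
          mul_le_mul hμ'le hv (abs_nonneg _) hm0
        nlinarith [mul_nonneg hδ0 hmV]
      have e2 : |μ' * v' i| ≤ m * V := by
        rw [abs_mul]; exact mul_le_mul_of_nonneg_right hμ'le hV
      have e3 : |μ * w| ≤ (1 + 35 * δ) * (m * V) := by
        have : |μ * w| ≤ |μ' * v' i| + |μ * w - μ' * v' i| := by
          calc |μ * w| = |μ' * v' i + (μ * w - μ' * v' i)| := by ring_nf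
            _ ≤ _ := abs_add_le _ _
        linarith
      have e4 : |P.fl (μ * w) - μ' * v' i| ≤ 37 * δ * (m * V) := by
        refine (abs_sub_le _ (μ * w) _).trans ?_
        have t1 := P.fl_err (μ * w)
        have t2 : P.u * |μ * w| ≤ δ * ((1 + 35 * δ) * (m * V)) :=
          mul_le_mul hu e3 (abs_nonneg _) hδ0
        nlinarith [mul_nonneg hδ0 hmV]
      have e5 : |x i - P.fl (μ * w)| ≤ |x i| + (1 + 37 * δ) * (m * V) := by
        have t1 : |x i - P.fl (μ * w)| ≤ |x i| + |P.fl (μ * w)| := abs_sub _ _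
        have t2 : |P.fl (μ * w)| ≤ |μ' * v' i| + |P.fl (μ * w) - μ' * v' i| := by
          calc |P.fl (μ * w)| = |μ' * v' i + (P.fl (μ * w) - μ' * v' i)| := by ring_nf
            _ ≤ _ := abs_add_le _ _
        linarith
      set f := P.fl (μ * w)
      have e6 := P.fl_err (x i - f)
      have e7 : P.u * |x i - f| ≤ δ * (|x i| + (1 + 37 * δ) * (m * V)) :=
        mul_le_mul hu e5 (abs_nonneg _) hδ0
      have e8 : |P.fl (x i - f) - (x i - μ' * v' i)| ≤
          |P.fl (x i - f) - (x i - f)| + |f - μ' * v' i| := by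
        calc _ = |(P.fl (x i - f) - (x i - f)) - (f - μ' * v' i)| := by ring_nf
          _ ≤ _ := abs_sub _ _
      nlinarith [mul_nonneg hδ0 hmV]
  refine (vnorm_mono key).trans ((vnorm_add_le _ _).trans ?_)
  rw [vnorm_smul, vnorm_smul, vnorm_abs, vnorm_abs, abs_of_nonneg hδ0,
    abs_of_nonneg (by positivity : 0 ≤ 39 * δ * m)]
  have hx := vnorm_nonneg x
  have e : 39 * δ * m * vnorm v' = 39 * δ * vnorm x * (η' * vnorm v' ^ 2) := by rw [hm]; ring
  rw [e]
  have := mul_le_mul_of_nonneg_left hsq (by positivity : 0 ≤ 39 * δ * vnorm x)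
  linarith

end FloatingReflector

/-! ### Backward stability of Householder QR -/

section Stage
variable {s n : ℕ} (P : Precision)

/-- The part of column `k` in the rows from `k` on. -/
noncomputable def tailCol (M : Matrix (Fin s) (Fin n) ℝ) (k : Fin n) : Fin s → ℝ :=
  fun i => if k.val ≤ i.val then M i k else 0

theorem householderStage_apply (M : Matrix (Fin s) (Fin n) ℝ) (k : Fin n) (hk : k.val < s)
    (i : Fin s) (j : Fin n) :
    householderStage P M k i j =
      if i.val < k.val ∨ j < k then M i j
      else if j = k then (if i.val = k.val then -flSigma P (tailCol M k) ⟨k.val, hk⟩ else 0)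
      else P.fl (M i j - P.fl (P.fl (flEta P (tailCol M k) ⟨k.val, hk⟩ *
        P.dot (List.finRange s) (flVec P (tailCol M k) ⟨k.val, hk⟩) (fun a => M a j)) *
          flVec P (tailCol M k) ⟨k.val, hk⟩ i)) := by
  have hpiv : tailCol M k ⟨k.val, hk⟩ = M ⟨k.val, hk⟩ k := by simp [tailCol]
  have hvec : flVec P (tailCol M k) ⟨k.val, hk⟩ = fun i : Fin s => if i.val = k.val then
      P.fl (M ⟨k.val, hk⟩ k + flSigma P (tailCol M k) ⟨k.val, hk⟩) else tailCol M k i := by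
    ext a
    simp only [flVec, flLead, Function.update_apply, hpiv, Fin.ext_iff]
  have hσ : flSigma P (tailCol M k) ⟨k.val, hk⟩ = if 0 ≤ M ⟨k.val, hk⟩ k then
      P.nrm (List.finRange s) (tailCol M k) else -P.nrm (List.finRange s) (tailCol M k) := by
    rw [flSigma, hpiv]
  rw [hvec, flEta, flLead, hpiv, hσ]
  simp only [householderStage, hk, dif_pos]
  rfl

/-- Columns before `k` have support disjoint from the reflector and are fixed by it. Column `k` is
overwritten by its known image, so only `σ` errs. Later columns fall under `flReflect_err`. -/
theorem householderStage_err (M : Matrix (Fin s) (Fin n) ℝ) (k : Fin n) (hk : k.val < s)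
    (hM : ∀ (i : Fin s) (j : Fin n), j < k → j.val < i.val → M i j = 0)
    {δ : ℝ} (hδ : s * P.u ≤ δ) (hδ1 : δ ≤ 1 / 1000) (j : Fin n) :
    vnorm ((fun i => householderStage P M k i j) -
      hhMat (tailCol M k) ⟨k.val, hk⟩ *ᵥ (fun i => M i j)) ≤
        79 * δ * vnorm (fun i => M i j) := by
  set κ : Fin s := ⟨k.val, hk⟩ with hκ
  set z := tailCol M k with hz
  have hu := unit_roundoff_le P κ hδ
  have hδ0 : 0 ≤ δ := P.u_pos.le.trans hu
  have hlow : ∀ i : Fin s, i.val < k.val → hhVec z κ i = 0 := by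
    intro i hi
    have : i ≠ κ := by rw [Ne, Fin.ext_iff]; simp [hκ]; omega
    simp [hhVec, this, hz, tailCol, not_le.2 hi]
  have hnn : 0 ≤ 79 * δ * vnorm (fun i => M i j) := mul_nonneg (by linarith) (vnorm_nonneg _)
  rcases lt_trichotomy j k with hj | hj | hj
  · have h1 : (fun i => householderStage P M k i j) = fun i => M i j := by
      ext i; rw [householderStage_apply P M k hk, if_pos (Or.inr hj)]
    rw [h1, hhMat_mulVec_of_disjoint, sub_self, vnorm_zero]
    · exact hnn
    · intro i
      by_cases hi : i.val < k.val
      · exact Or.inl (hlow i hi)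
      · exact Or.inr (hM i j hj (by rw [Fin.lt_def] at hj; omega))
  · subst hj
    have hx : (fun i => M i j) = (fun i => M i j - z i) + z := by ext i; simp
    have h2 : hhMat z κ *ᵥ (fun i => M i j) = (fun i => M i j - z i) + Pi.single κ (-hhSigma z κ) := by
      conv_lhs => rw [hx]
      rw [Matrix.mulVec_add, hhMat_mulVec_self, hhMat_mulVec_of_disjoint]
      intro i
      by_cases hi : i.val < j.val
      · exact Or.inl (hlow i hi)
      · right; simp [hz, tailCol, not_lt.1 hi]
    have hσ := flSigma_err P z κ hδ hδ1
    have h3 : (fun i => householderStage P M j i j) - hhMat z κ *ᵥ (fun i => M i j) =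
        Pi.single κ (hhSigma z κ - flSigma P z κ) := by
      rw [h2]
      ext i
      simp only [Pi.sub_apply, Pi.add_apply]
      rw [householderStage_apply P M j hk]
      rcases lt_trichotomy i.val j.val with hi | hi | hi
      · have : i ≠ κ := by rw [Ne, Fin.ext_iff]; simp [hκ]; omega
        simp [hi, this, hz, tailCol, not_le.2 hi]
      · have : i = κ := by rw [Fin.ext_iff]; simpa [hκ] using hi
        subst this
        simp [hz, tailCol, hi]
        show -flSigma P (tailCol M j) κ + _ = _
        ring
      · have : i ≠ κ := by rw [Ne, Fin.ext_iff]; simp [hκ]; omega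
        simp [this, hz, tailCol, hi.le, not_lt.2 hi.le, hi.ne']
    rw [h3]
    have h4 : vnorm (Pi.single κ (hhSigma z κ - flSigma P z κ) : Fin s → ℝ) ≤
        |hhSigma z κ - flSigma P z κ| := by
      refine le_of_sq_le (abs_nonneg _) (le_of_eq ?_)
      rw [vnorm_sq, sq_abs, Finset.sum_eq_single κ]
      · simp
      · intro b _ hb; simp [hb]
      · simp
    refine h4.trans ?_
    rw [abs_sub_comm]
    refine hσ.trans ?_
    rw [abs_hhSigma]
    have h5 : vnorm z ≤ vnorm (fun i => M i j) := vnorm_mono fun i => by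
      simp only [hz, tailCol]; split_ifs <;> simp
    have := mul_le_mul_of_nonneg_left h5 hδ0
    nlinarith [vnorm_nonneg z, mul_nonneg hδ0 (vnorm_nonneg (fun i => M i j))]
  · refine flReflect_err P z κ hδ hδ1 _ _ fun i => ?_
    rw [householderStage_apply P M k hk]
    by_cases hi : i.val < k.val
    · exact Or.inl ⟨hlow i hi, by rw [if_pos (Or.inl hi)]⟩
    · right
      rw [if_neg (by rintro (h | h); exacts [hi h, absurd h hj.not_gt]), if_neg hj.ne']

theorem householderStage_zero (M : Matrix (Fin s) (Fin n) ℝ) (k : Fin n) (hk : k.val < s)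
    (hM : ∀ (i : Fin s) (j : Fin n), j < k → j.val < i.val → M i j = 0)
    (i : Fin s) (j : Fin n) (hj : j ≤ k) (hij : j.val < i.val) :
    householderStage P M k i j = 0 := by
  rw [householderStage_apply P M k hk]
  rcases hj.lt_or_eq with h | h
  · rw [if_pos (Or.inr h)]; exact hM i j h hij
  · subst h
    rw [if_neg (by rintro (h | h) <;> [omega; exact lt_irrefl _ h]), if_pos rfl, if_neg hij.ne']

/-- `U` is the product of the exact reflectors built from the computed columns. Each stage perturbs
an isometric image by a relative `79δ`, so the errors compound geometrically. The zero pattern is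
carried along because `householderStage_err` needs it. -/
theorem householder_fold (hns : n ≤ s) (Y : Matrix (Fin s) (Fin n) ℝ) {δ : ℝ}
    (hδ : s * P.u ≤ δ) (hδ1 : δ ≤ 1 / 1000) (k : ℕ) (hk : k ≤ n) :
    (∀ (i : Fin s) (j : Fin n), j.val < k → j.val < i.val →
      ((List.finRange n).take k).foldl (householderStage P) Y i j = 0) ∧
    ∃ U : Matrix (Fin s) (Fin s) ℝ, (∀ x, vnorm (U *ᵥ x) = vnorm x) ∧ ∀ j,
      vnorm ((fun i => ((List.finRange n).take k).foldl (householderStage P) Y i j) -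
        U *ᵥ (fun i => Y i j)) ≤ ((1 + 79 * δ) ^ k - 1) * vnorm (fun i => Y i j) := by
  induction k with
  | zero => exact ⟨fun i j h => absurd h (Nat.not_lt_zero _), 1, by simp, by simp [vnorm_zero]⟩
  | succ k ih =>
    obtain ⟨h0, U, hU, hUe⟩ := ih (by omega)
    have hkn : k < n := hk
    have hks : k < s := by omega
    have hδ0 : 0 ≤ δ := P.u_pos.le.trans (unit_roundoff_le P ⟨k, hks⟩ hδ)
    have hstep : ((List.finRange n).take (k + 1)).foldl (householderStage P) Y =
        householderStage P (((List.finRange n).take k).foldl (householderStage P) Y) ⟨k, hkn⟩ := by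
      rw [List.take_succ_eq_append_getElem (by simpa using hkn), List.foldl_append]
      simp
    rw [hstep]
    set G := ((List.finRange n).take k).foldl (householderStage P) Y
    have hM : ∀ (i : Fin s) (j : Fin n), j < ⟨k, hkn⟩ → j.val < i.val → G i j = 0 :=
      fun i j hj hij => h0 i j hj hij
    refine ⟨fun i j hj hij => householderStage_zero P G ⟨k, hkn⟩ hks hM i j
      (by rw [Fin.le_def]; simp; omega) hij,
      hhMat (tailCol G ⟨k, hkn⟩) ⟨k, hks⟩ * U, fun x => ?_, fun j => ?_⟩
    · rw [← Matrix.mulVec_mulVec, vnorm_hhMat_mulVec, hU]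
    · have h1 := householderStage_err P G ⟨k, hkn⟩ hks hM hδ hδ1 j
      have h2 := hUe j
      set H := hhMat (tailCol G ⟨k, hkn⟩) ⟨k, hks⟩
      set g : Fin s → ℝ := fun i => G i j
      set y : Fin s → ℝ := fun i => Y i j
      have h3 : vnorm (H *ᵥ g - (H * U) *ᵥ y) = vnorm (g - U *ᵥ y) := by
        rw [← Matrix.mulVec_mulVec, ← Matrix.mulVec_sub, vnorm_hhMat_mulVec]
      have h4 : vnorm g ≤ (1 + 79 * δ) ^ k * vnorm y := by
        have := vnorm_le_add_sub g (U *ᵥ y)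
        rw [hU] at this
        linarith
      have h5 := vnorm_add_le ((fun i => householderStage P G ⟨k, hkn⟩ i j) - H *ᵥ g)
        (H *ᵥ g - (H * U) *ᵥ y)
      rw [sub_add_sub_cancel, h3] at h5
      have h6 := mul_le_mul_of_nonneg_left h4 (by linarith : 0 ≤ 79 * δ)
      rw [pow_succ]
      linarith

/-- Normwise backward stability of Householder QR: the computed R-factor is, up to the stated
perturbation, an isometric image of the factorized matrix. -/
theorem householderR_backward (hns : n ≤ s) (hn : 0 < n) (Y : Matrix (Fin s) (Fin n) ℝ)
    (hu : 1000 * (s * n : ℕ) * P.u < 1) (w : Fin n → ℝ) :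
    |vnorm (householderR P Y *ᵥ w) - vnorm (Y *ᵥ w)| ≤
      gammaTilde 1000 (s * n) P.u * Real.sqrt n * norm2 Y * vnorm w := by
  have hu0 := P.u_pos
  set δ := s * P.u with hδ
  have hδ0 : 0 ≤ δ := by positivity
  have hn1 : (1 : ℝ) ≤ n := by exact_mod_cast hn
  have hnδ : n * δ ≤ 1 / 1000 := by
    have : 1000 * (s * n : ℕ) * P.u = 1000 * (n * δ) := by push_cast; rw [hδ]; ring
    linarith
  have hδ1 : δ ≤ 1 / 1000 := by nlinarith
  obtain ⟨h0, U, hU, hUe⟩ := householder_fold P hns Y hδ.symm.le hδ1 n le_rfl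
  have htake : (List.finRange n).take n = List.finRange n := by
    rw [List.take_of_length_le]; simp
  rw [htake] at h0 hUe
  set M := (List.finRange n).foldl (householderStage P) Y with hM
  -- The entries below the diagonal are set to exact zeros, so dropping the rows from `n` on does
  -- not change the norm.
  have hR : vnorm (householderR P Y *ᵥ w) = vnorm (M *ᵥ w) := by
    have hRi : ∀ i : Fin n, (householderR P Y *ᵥ w) i = (M *ᵥ w) (Fin.castLE hns i) := by
      intro i
      simp only [Matrix.mulVec, dotProduct]
      refine Finset.sum_congr rfl fun j _ => ?_
      congr 1
      have his : i.val < s := by omega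
      simp only [householderR, his, dif_pos, ← hM]
      split_ifs with hij
      · rfl
      · exact (h0 (Fin.castLE hns i) j j.2 (by
          rw [not_le, Fin.lt_def] at hij; simpa using hij)).symm
    have hzero : ∀ i : Fin s, i ∉ Set.range (Fin.castLE hns) → (M *ᵥ w) i = 0 := by
      intro i hi
      simp only [Matrix.mulVec, dotProduct]
      refine Finset.sum_eq_zero fun j _ => ?_
      have : n ≤ i.val := by
        by_contra h
        exact hi ⟨⟨i.val, not_le.1 h⟩, rfl⟩
      rw [h0 i j j.2 (by omega), zero_mul]
    have : vnorm (householderR P Y *ᵥ w) ^ 2 = vnorm (M *ᵥ w) ^ 2 := by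
      rw [vnorm_sq, vnorm_sq]
      simp_rw [hRi]
      refine Fintype.sum_of_injective (Fin.castLE hns) (Fin.castLE_injective hns) _ _ ?_ ?_
      · intro i hi; rw [hzero i hi]; simp
      · intro i; rfl
    exact (sq_eq_sq₀ (vnorm_nonneg _) (vnorm_nonneg _)).1 this
  have hYw : vnorm (Y *ᵥ w) = vnorm (U *ᵥ (Y *ᵥ w)) := (hU _).symm
  rw [hR, hYw]
  have hcol : ∀ j, vnorm (fun i => Y i j) ≤ norm2 Y := by
    intro j
    have h1 := vnorm_mulVec_le Y (Pi.single j 1)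
    have h2 : Y *ᵥ Pi.single j 1 = fun i => Y i j := by ext i; simp
    have h3 : vnorm (Pi.single j 1 : Fin n → ℝ) = 1 := by simp [vnorm]
    rwa [h2, h3, mul_one] at h1
  -- As `n δ ≤ 1/1000`, the left side is at most `79 n δ (1 + 79 n δ)`; the constant 1000 leaves
  -- ample room.
  have hg : (1 + 79 * δ) ^ n - 1 ≤ 1000 * (n * δ) := by
    have := one_add_pow_sub_one_le (u := 79 * δ) (by positivity) (p := n) (by linarith)
    nlinarith [mul_nonneg (by linarith : (0 : ℝ) ≤ n) hδ0]
  have hgam : 1000 * (n * δ) ≤ gammaTilde 1000 (s * n) P.u := by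
    have e : 1000 * ((s * n : ℕ) : ℝ) * P.u = 1000 * (n * δ) := by push_cast; rw [hδ]; ring
    rw [gammaTilde, e, le_div_iff₀ (by linarith)]
    nlinarith [mul_nonneg (by linarith : (0 : ℝ) ≤ n) hδ0]
  set g := gammaTilde 1000 (s * n) P.u
  -- The error is known column by column; Cauchy–Schwarz on the weights `|w j|` then produces the
  -- factor `√n`.
  have hdiff : vnorm (M *ᵥ w - U *ᵥ (Y *ᵥ w)) ≤ ∑ j, |w j| * (g * norm2 Y) := by
    have e : M *ᵥ w - U *ᵥ (Y *ᵥ w) =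
        ∑ j, w j • ((fun i => M i j) - U *ᵥ (fun i => Y i j)) := by
      ext i
      simp only [Pi.sub_apply, Finset.sum_apply, Pi.smul_apply, smul_eq_mul, mul_sub,
        Finset.sum_sub_distrib]
      congr 1
      · simp [Matrix.mulVec, dotProduct, mul_comm]
      · rw [Matrix.mulVec_mulVec]
        simp only [Matrix.mulVec, dotProduct, Matrix.mul_apply]
        exact Finset.sum_congr rfl fun j _ => mul_comm _ _
    have htri : ∀ (S : Finset (Fin n)) (f : Fin n → Fin s → ℝ),
        vnorm (∑ j ∈ S, f j) ≤ ∑ j ∈ S, vnorm (f j) := by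
      intro S f
      induction S using Finset.induction_on with
      | empty => simp [vnorm_zero]
      | insert a S ha ih =>
        rw [Finset.sum_insert ha, Finset.sum_insert ha]
        linarith [vnorm_add_le (f a) (∑ j ∈ S, f j)]
    rw [e]
    refine (htri _ _).trans (Finset.sum_le_sum fun j _ => ?_)
    rw [vnorm_smul]
    refine mul_le_mul_of_nonneg_left ((hUe j).trans ?_) (abs_nonneg _)
    refine mul_le_mul (hg.trans hgam) (hcol j) (vnorm_nonneg _) ?_
    exact le_trans (by positivity) hgam
  have hcs : ∑ j, |w j| ≤ Real.sqrt n * vnorm w := by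
    have h1 := sum_abs_mul_le (fun _ : Fin n => (1 : ℝ)) w
    have h2 : vnorm (fun _ : Fin n => (1 : ℝ)) = Real.sqrt n := by
      rw [vnorm, EuclideanSpace.norm_eq]; simp
    rw [h2] at h1
    simpa using h1
  have habs : |vnorm (M *ᵥ w) - vnorm (U *ᵥ (Y *ᵥ w))| ≤ vnorm (M *ᵥ w - U *ᵥ (Y *ᵥ w)) := by
    rw [abs_le]
    constructor
    · have := vnorm_le_add_sub (U *ᵥ (Y *ᵥ w)) (M *ᵥ w)
      rw [vnorm_sub_comm] at this; linarith
    · linarith [vnorm_le_add_sub (M *ᵥ w) (U *ᵥ (Y *ᵥ w))]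
  refine habs.trans (hdiff.trans ?_)
  rw [← Finset.sum_mul]
  have hgn : 0 ≤ g * norm2 Y := mul_nonneg (le_trans (by positivity) hgam) (norm2_nonneg _)
  calc _ ≤ (Real.sqrt n * vnorm w) * (g * norm2 Y) := mul_le_mul_of_nonneg_right hcs hgn
    _ = _ := by ring

end Stage

/-! ### From the sketch to a spectrally equivalent R-factor -/

theorem four_le_logFactor {n : ℕ} (hn : 0 < n) : 4 ≤ logFactor n := by
  have : 0 ≤ Real.logb 2 n :=
    Real.logb_nonneg (by norm_num) (by exact_mod_cast hn)
  unfold logFactor; linarith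

section Sketch
variable {s n : ℕ} (P : Precision) {S Y : Matrix (Fin s) (Fin n) ℝ}

theorem gammaTilde_nonneg {c : ℝ} (hc : 0 ≤ c) {N : ℕ} {u : ℝ} (hu : 0 ≤ u) (h : c * N * u < 1) :
    0 ≤ gammaTilde c N u := div_nonneg (by positivity) (by linarith)

theorem one_le_beta {c : ℝ} (hc : 0 ≤ c) (hn : 0 < n) (h : SketchOK c P.u S Y) :
    1 ≤ beta c P.u S Y := by
  have h1 := gammaTilde_nonneg hc P.u_pos.le h.1
  have h2 := four_le_logFactor hn
  have h3 : 0 ≤ cond2 S := mul_nonneg (norm2_nonneg _) (norm2_nonneg _)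
  have h4 := norm2_nonneg (pinv S)
  have h5 := norm2_nonneg (Y - S)
  have h6 : 0 ≤ logFactor n := by linarith
  unfold beta
  refine one_le_mul_of_one_le_of_one_le ?_ ?_
  · have : 0 ≤ 18 * logFactor n * Real.sqrt n * gammaTilde c (s * n) P.u * cond2 S := by positivity
    linarith
  · have : 0 ≤ 2 * logFactor n * Real.sqrt n * norm2 (pinv S) * norm2 (Y - S) := by positivity
    linarith

/-- The computed R-factor of the computed sketch is spectrally equivalent to the exact sketch. -/
theorem householderR_equiv (hns : n ≤ s) (hn : 0 < n) (hS : ∀ v, S *ᵥ v = 0 → v = 0)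
    (h : SketchOK 1000 P.u S Y) (w : Fin n → ℝ) :
    vnorm (S *ᵥ w) ≤ 2 * vnorm (householderR P Y *ᵥ w) ∧
      vnorm (householderR P Y *ᵥ w) ≤ 2 * vnorm (S *ᵥ w) := by
  obtain ⟨h1, h2, h3⟩ := h
  have hL := four_le_logFactor hn
  have hs1 : 1 ≤ Real.sqrt n := Real.one_le_sqrt.2 (by exact_mod_cast hn)
  have hγ := gammaTilde_nonneg (by norm_num) P.u_pos.le h1
  -- `logFactor n * √n ≥ 4` turns the smallness assumption into a relative perturbation of at most
  -- 1/4; the QR error is treated in the same way below.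
  have hq : norm2 (pinv S) * norm2 (Y - S) ≤ 1 / 4 := by
    have h0 : 0 ≤ norm2 (pinv S) * norm2 (Y - S) := mul_nonneg (norm2_nonneg _) (norm2_nonneg _)
    have : 4 * 1 * (norm2 (pinv S) * norm2 (Y - S)) ≤
        logFactor n * Real.sqrt n * (norm2 (pinv S) * norm2 (Y - S)) :=
      mul_le_mul_of_nonneg_right (mul_le_mul hL hs1 (by norm_num) (by linarith)) h0
    linarith
  have hYS : ∀ v, vnorm (Y *ᵥ v - S *ᵥ v) ≤ 1 / 4 * vnorm (S *ᵥ v) := by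
    intro v
    rw [← Matrix.sub_mulVec]
    refine (vnorm_mulVec_le _ _).trans ?_
    have e1 := mul_le_mul_of_nonneg_left (vnorm_le_pinv hS v) (norm2_nonneg (Y - S))
    have e2 := mul_le_mul_of_nonneg_right hq (vnorm_nonneg (S *ᵥ v))
    linarith
  have hY : ∀ v, Y *ᵥ v = 0 → v = 0 := by
    intro v hv
    have := hYS v
    rw [hv, zero_sub, vnorm_neg] at this
    have h0 : vnorm (S *ᵥ v) = 0 := le_antisymm (by linarith [vnorm_nonneg (S *ᵥ v)])
      (vnorm_nonneg _)
    exact hS v (vnorm_eq_zero.1 h0)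
  have hR : |vnorm (householderR P Y *ᵥ w) - vnorm (Y *ᵥ w)| ≤ 1 / 4 * vnorm (Y *ᵥ w) := by
    refine (householderR_backward P hns hn Y h1 w).trans ?_
    set g := gammaTilde 1000 (s * n) P.u
    have hgn : 0 ≤ g * Real.sqrt n * norm2 Y := by
      have := norm2_nonneg Y; positivity
    have e1 := mul_le_mul_of_nonneg_left (vnorm_le_pinv hY w) hgn
    have e2 : 4 * (g * Real.sqrt n * cond2 Y) ≤ logFactor n * (g * Real.sqrt n * cond2 Y) :=
      mul_le_mul_of_nonneg_right hL
        (mul_nonneg (by positivity) (mul_nonneg (norm2_nonneg _) (norm2_nonneg _)))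
    have e3 : g * Real.sqrt n * cond2 Y ≤ 1 / 4 := by linarith
    have e4 := mul_le_mul_of_nonneg_right e3 (vnorm_nonneg (Y *ᵥ w))
    rw [cond2] at e4
    linarith
  have a1 := abs_le.1 hR
  have a2 := hYS w
  have a3 := vnorm_le_add_sub (Y *ᵥ w) (S *ᵥ w)
  have a4 := vnorm_le_add_sub (S *ᵥ w) (Y *ᵥ w)
  rw [vnorm_sub_comm] at a4
  have a5 := vnorm_nonneg (S *ᵥ w)
  -- Two relative perturbations of 1/4 compose to factors between `(3/4)² ≥ 1/2` and `(5/4)² ≤ 2`.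
  constructor <;> linarith [a1.1, a1.2]

theorem vnorm_mulVec_of_orthonormal {Q : Matrix (Fin s) (Fin n) ℝ} (hQ : Qᵀ * Q = 1)
    (v : Fin n → ℝ) : vnorm (Q *ᵥ v) = vnorm v := by
  have : vnorm (Q *ᵥ v) ^ 2 = vnorm v ^ 2 := by
    rw [← dotProduct_self_eq, ← dotProduct_self_eq, Matrix.dotProduct_mulVec,
      ← Matrix.mulVec_transpose, Matrix.mulVec_mulVec, hQ, Matrix.one_mulVec]
  exact (sq_eq_sq₀ (vnorm_nonneg _) (vnorm_nonneg _)).1 this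

end Sketch

/-! ### Consequences of spectral equivalence -/

section Equivalent
variable {m s n : ℕ} {S : Matrix (Fin s) (Fin n) ℝ} {R T : Matrix (Fin n) (Fin n) ℝ}
  {A : Matrix (Fin m) (Fin n) ℝ}

theorem isUnit_det_of_equiv (hS : ∀ v, S *ᵥ v = 0 → v = 0)
    (hT : ∀ w, vnorm (S *ᵥ w) ≤ 2 * vnorm (T *ᵥ w)) : IsUnit T.det := by
  refine isUnit_det_of_ker fun v hv => hS v (vnorm_eq_zero.1 (le_antisymm ?_ (vnorm_nonneg _)))
  have := hT v
  rwa [hv, vnorm_zero, mul_zero] at this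

theorem norm2_le_of_equiv (hT : ∀ w, vnorm (T *ᵥ w) ≤ 2 * vnorm (S *ᵥ w)) :
    norm2 T ≤ 2 * norm2 S :=
  norm2_le (mul_nonneg zero_le_two (norm2_nonneg _)) fun v => by
    linarith [hT v, vnorm_mulVec_le S v]

theorem norm2_inv_le_of_equiv (hS : ∀ v, S *ᵥ v = 0 → v = 0)
    (hT : ∀ w, vnorm (S *ᵥ w) ≤ 2 * vnorm (T *ᵥ w)) : norm2 T⁻¹ ≤ 2 * norm2 (pinv S) := by
  have hu := isUnit_det_of_equiv hS hT
  refine norm2_le (mul_nonneg zero_le_two (norm2_nonneg _)) fun v => ?_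
  have h1 := vnorm_le_pinv hS (T⁻¹ *ᵥ v)
  have h2 := hT (T⁻¹ *ᵥ v)
  rw [Matrix.mulVec_mulVec v T, Matrix.mul_nonsing_inv _ hu, Matrix.one_mulVec] at h2
  have h3 := mul_le_mul_of_nonneg_left h2 (norm2_nonneg (pinv S))
  linarith

/-- With `w = T⁻¹ v` one has `A T⁻¹ v = A R⁻¹ (R w)` and `‖R w‖ ≤ 2 ‖T w‖ = 2 ‖v‖`. -/
theorem norm2_mul_inv_le_of_equiv (hR : IsUnit R.det) (hTu : IsUnit T.det)
    (hT : ∀ w, vnorm (R *ᵥ w) ≤ 2 * vnorm (T *ᵥ w)) :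
    norm2 (A * T⁻¹) ≤ 2 * norm2 (A * R⁻¹) := by
  refine norm2_le (mul_nonneg zero_le_two (norm2_nonneg _)) fun v => ?_
  have h2 := hT (T⁻¹ *ᵥ v)
  rw [Matrix.mulVec_mulVec v T, Matrix.mul_nonsing_inv _ hTu, Matrix.one_mulVec] at h2
  have h1 := vnorm_mulVec_le (A * R⁻¹) (R *ᵥ (T⁻¹ *ᵥ v))
  rw [Matrix.mulVec_mulVec _ (A * R⁻¹), Matrix.mul_assoc, Matrix.nonsing_inv_mul _ hR,
    Matrix.mul_one, Matrix.mulVec_mulVec] at h1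
  have h3 := mul_le_mul_of_nonneg_left h2 (norm2_nonneg (A * R⁻¹))
  linarith

theorem mul_inv_ker (hA : ∀ v, A *ᵥ v = 0 → v = 0) (hTu : IsUnit T.det) (v : Fin n → ℝ)
    (hv : (A * T⁻¹) *ᵥ v = 0) : v = 0 := by
  rw [← Matrix.mulVec_mulVec] at hv
  have h1 := hA _ hv
  have h2 : T *ᵥ (T⁻¹ *ᵥ v) = v := by
    rw [Matrix.mulVec_mulVec, Matrix.mul_nonsing_inv _ hTu, Matrix.one_mulVec]
  rw [← h2, h1, Matrix.mulVec_zero]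

theorem vnorm_le_mul_inv_of_equiv (hA : ∀ v, A *ᵥ v = 0 → v = 0) (hR : IsUnit R.det)
    (hTu : IsUnit T.det) (hT : ∀ w, vnorm (T *ᵥ w) ≤ 2 * vnorm (R *ᵥ w)) (v : Fin n → ℝ) :
    vnorm v ≤ 2 * norm2 (pinv (A * R⁻¹)) * vnorm ((A * T⁻¹) *ᵥ v) := by
  have h2 := hT (T⁻¹ *ᵥ v)
  rw [Matrix.mulVec_mulVec v T, Matrix.mul_nonsing_inv _ hTu, Matrix.one_mulVec] at h2
  have h1 := vnorm_le_pinv (mul_inv_ker hA hR) (R *ᵥ (T⁻¹ *ᵥ v))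
  rw [Matrix.mulVec_mulVec _ (A * R⁻¹), Matrix.mul_assoc, Matrix.nonsing_inv_mul _ hR,
    Matrix.mul_one, Matrix.mulVec_mulVec _ A] at h1
  linarith

end Equivalent

/-! ### Conditioning of augmented and block diagonal matrices -/

section Block
variable {m n : ℕ}

theorem augM_vnorm_le (N : Matrix (Fin m) (Fin n) ℝ) {α : ℝ} (hα : 0 ≤ α)
    (v : Fin m ⊕ Fin n → ℝ) : vnorm (augM N α *ᵥ v) ≤ (α + 2 * norm2 N) * vnorm v := by
  rw [augM_mulVec]
  refine (vnorm_le_inl_add_inr _).trans ?_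
  simp only [Sum.elim_inl, Sum.elim_inr]
  set p : Fin m → ℝ := fun i => v (Sum.inl i)
  set q : Fin n → ℝ := fun j => v (Sum.inr j)
  have hp : vnorm p ≤ vnorm v := vnorm_inl_le v
  have hq : vnorm q ≤ vnorm v := vnorm_inr_le v
  have h1 : vnorm (α • p + N *ᵥ q) ≤ α * vnorm p + norm2 N * vnorm q := by
    refine (vnorm_add_le _ _).trans ?_
    rw [vnorm_smul, abs_of_nonneg hα]
    linarith [vnorm_mulVec_le N q]
  have h2 : vnorm (Nᵀ *ᵥ p) ≤ norm2 N * vnorm p := by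
    simpa [norm2_transpose] using vnorm_mulVec_le Nᵀ p
  have hN := norm2_nonneg N
  have e1 := mul_le_mul_of_nonneg_left hp hα
  have e2 := mul_le_mul_of_nonneg_left hp hN
  have e3 := mul_le_mul_of_nonneg_left hq hN
  have e4 : vnorm (fun i => (α • p + N *ᵥ q) i) = vnorm (α • p + N *ᵥ q) := rfl
  have e5 : vnorm (fun i => (Nᵀ *ᵥ p) i) = vnorm (Nᵀ *ᵥ p) := rfl
  rw [e4, e5]
  linarith

/-- Energy estimate for the augmented system. -/
theorem augM_energy (N : Matrix (Fin m) (Fin n) ℝ) {α a : ℝ} (hα : 0 < α) (ha : 0 ≤ a)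
    (hN : ∀ q, vnorm q ≤ a * vnorm (N *ᵥ q)) (v : Fin m ⊕ Fin n → ℝ) :
    vnorm (fun i => v (Sum.inl i)) ≤ 2 * (α⁻¹ + a) * vnorm (augM N α *ᵥ v) ∧
    vnorm (fun j => v (Sum.inr j)) ≤
      a * (vnorm (augM N α *ᵥ v) + α * vnorm (fun i => v (Sum.inl i))) := by
  set t := vnorm (augM N α *ᵥ v) with ht
  have ht0 : 0 ≤ t := vnorm_nonneg _
  set p : Fin m → ℝ := fun i => v (Sum.inl i)
  set q : Fin n → ℝ := fun j => v (Sum.inr j)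
  set f := α • p + N *ᵥ q with hf
  set g := Nᵀ *ᵥ p with hg
  have hfg : augM N α *ᵥ v = Sum.elim f g := augM_mulVec N α v
  have hft : vnorm f ≤ t := by
    rw [ht, hfg]; exact vnorm_inl_le (Sum.elim f g)
  have hgt : vnorm g ≤ t := by
    rw [ht, hfg]; exact vnorm_inr_le (Sum.elim f g)
  have hP := vnorm_nonneg p
  have h1 : vnorm (N *ᵥ q) ≤ t + α * vnorm p := by
    have : N *ᵥ q = f - α • p := by rw [hf]; abel
    rw [this]
    refine (vnorm_sub_le _ _).trans ?_
    rw [vnorm_smul, abs_of_pos hα]; linarith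
  have h2 : vnorm q ≤ a * (t + α * vnorm p) :=
    (hN q).trans (mul_le_mul_of_nonneg_left h1 ha)
  refine ⟨?_, h2⟩
  -- Testing the first block equation with `p` and the second with `q` cancels the coupling term `p
  -- ⬝ᵥ N q`.
  have h3 : α * vnorm p ^ 2 = p ⬝ᵥ f - q ⬝ᵥ g := by
    have : p ⬝ᵥ (N *ᵥ q) = q ⬝ᵥ g := by
      rw [hg, Matrix.mulVec_transpose, Matrix.dotProduct_mulVec, dotProduct_comm]
    rw [hf, dotProduct_add, dotProduct_smul, dotProduct_self_eq, this, smul_eq_mul]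
    ring
  have h4 : α * vnorm p ^ 2 ≤ vnorm p * t + (a * (t + α * vnorm p)) * t := by
    have e1 := (abs_le.1 (abs_dotProduct_le p f)).2
    have e2 := (abs_le.1 (abs_dotProduct_le q g)).1
    have e3 := mul_le_mul_of_nonneg_left hft hP
    have e4 := mul_le_mul h2 hgt (vnorm_nonneg _)
      (mul_nonneg ha (add_nonneg ht0 (mul_nonneg hα.le hP)))
    linarith
  by_contra hcon
  rw [not_le] at hcon
  set P := vnorm p
  have hαa : α * α⁻¹ = 1 := mul_inv_cancel₀ hα.ne'
  have hi : 0 < α⁻¹ := inv_pos.2 hα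
  set X := (α⁻¹ + a) * t with hX
  have hX0 : 0 ≤ X := mul_nonneg (by positivity) ht0
  have hP2 : 2 * X < P := by rw [hX]; linarith
  -- This quadratic inequality bounds `P` by the golden ratio times `X`, contradicting `2 X < P`.
  have h5 : P ^ 2 ≤ X * P + X ^ 2 := by
    have e : P ^ 2 ≤ α⁻¹ * (P * t + (a * (t + α * P)) * t) := by
      calc P ^ 2 = α⁻¹ * (α * P ^ 2) := by rw [← mul_assoc, inv_mul_cancel₀ hα.ne', one_mul]
        _ ≤ _ := mul_le_mul_of_nonneg_left h4 hi.le
    have e2 : α⁻¹ * (P * t + (a * (t + α * P)) * t) = X * P + α⁻¹ * a * t ^ 2 := by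
      rw [hX]; field_simp; ring
    have e3 : α⁻¹ * a * t ^ 2 ≤ X ^ 2 := by
      rw [hX, mul_pow]
      refine mul_le_mul_of_nonneg_right ?_ (sq_nonneg _)
      nlinarith [mul_nonneg hi.le ha, sq_nonneg a, sq_nonneg α⁻¹]
    linarith
  nlinarith

theorem isUnit_det_augM {A : Matrix (Fin m) (Fin n) ℝ} (hA : ∀ v, A *ᵥ v = 0 → v = 0) {α : ℝ}
    (hα : 0 < α) : IsUnit (augM A α).det := by
  refine isUnit_det_of_ker fun v hv => ?_
  obtain ⟨h1, h2⟩ := augM_energy A hα (norm2_nonneg (pinv A)) (vnorm_le_pinv hA) v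
  rw [hv, vnorm_zero, mul_zero] at h1
  have h3 := le_antisymm h1 (vnorm_nonneg _)
  rw [hv, vnorm_zero, h3, mul_zero, add_zero, mul_zero] at h2
  have h4 := vnorm_le_inl_add_inr v
  exact vnorm_eq_zero.1 (le_antisymm (by linarith) (vnorm_nonneg v))

/-- The energy estimate sums to `2 + 5a + 2a²`. The quadratic growth in `a` comes from substituting
the bound on the first block into that on the second. -/
theorem augM_one_lower (N : Matrix (Fin m) (Fin n) ℝ) {a : ℝ} (ha : 0 ≤ a)
    (hN : ∀ q, vnorm q ≤ a * vnorm (N *ᵥ q)) (v : Fin m ⊕ Fin n → ℝ) :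
    vnorm v ≤ 9 * max 1 (a ^ 2) * vnorm (augM N 1 *ᵥ v) := by
  obtain ⟨h1, h2⟩ := augM_energy N one_pos ha hN v
  have h3 := vnorm_le_inl_add_inr v
  set t := vnorm (augM N 1 *ᵥ v)
  have ht : 0 ≤ t := vnorm_nonneg _
  have h4 : vnorm v ≤ (2 + 5 * a + 2 * a ^ 2) * t := by
    have := mul_le_mul_of_nonneg_left h1 ha
    rw [inv_one] at *
    nlinarith
  refine h4.trans (mul_le_mul_of_nonneg_right ?_ ht)
  have e1 := le_max_left 1 (a ^ 2)
  have e2 := le_max_right 1 (a ^ 2)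
  nlinarith [sq_nonneg (a - 1)]

/-- With `α = σ/√2` the terms `α⁻¹` and `a = σ⁻¹` of the energy estimate balance, and `a α` is a
constant, so the growth is linear in `σ⁻¹` instead of quadratic. -/
theorem augM_scaled_lower (N : Matrix (Fin m) (Fin n) ℝ) {σ : ℝ} (hσ : 0 < σ)
    (hN : ∀ q, σ * vnorm q ≤ vnorm (N *ᵥ q)) (v : Fin m ⊕ Fin n → ℝ) :
    vnorm v ≤ 10 * σ⁻¹ * vnorm (augM N ((Real.sqrt 2)⁻¹ * σ) *ᵥ v) := by
  have hs : 0 < Real.sqrt 2 := by positivity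
  have hα : 0 < (Real.sqrt 2)⁻¹ * σ := by positivity
  have ha : 0 < σ⁻¹ := inv_pos.2 hσ
  obtain ⟨h1, h2⟩ := augM_energy N hα ha.le (fun q => by
    rw [inv_mul_eq_div, le_div_iff₀ hσ]; linarith [hN q]) v
  have h3 := vnorm_le_inl_add_inr v
  set t := vnorm (augM N ((Real.sqrt 2)⁻¹ * σ) *ᵥ v)
  have ht : 0 ≤ t := vnorm_nonneg _
  set P := vnorm (fun i => v (Sum.inl i))
  have hP : 0 ≤ P := vnorm_nonneg _
  have hs2 : Real.sqrt 2 ≤ 3 / 2 := Real.sqrt_le_iff.2 ⟨by norm_num, by norm_num⟩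
  have hs1 : (Real.sqrt 2)⁻¹ ≤ 4 / 5 := by
    rw [inv_le_comm₀ hs (by norm_num)]
    exact Real.le_sqrt_of_sq_le (by norm_num)
  have hat : 0 ≤ σ⁻¹ * t := mul_nonneg ha.le ht
  rw [mul_inv, inv_inv] at h1
  have h5 : P ≤ 5 * (σ⁻¹ * t) := by nlinarith
  have h6 : σ⁻¹ * (t + (Real.sqrt 2)⁻¹ * σ * P) = σ⁻¹ * t + (Real.sqrt 2)⁻¹ * P := by
    field_simp
  rw [h6] at h2
  have h7 : (Real.sqrt 2)⁻¹ * P ≤ 4 / 5 * (5 * (σ⁻¹ * t)) :=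
    mul_le_mul hs1 h5 hP (by norm_num)
  linarith

/-- The block diagonal matrix `diag(I, T)`. -/
noncomputable def bdiag (m : ℕ) (T : Matrix (Fin n) (Fin n) ℝ) :
    Matrix (Fin m ⊕ Fin n) (Fin m ⊕ Fin n) ℝ := Matrix.fromBlocks 1 0 0 T

theorem vnorm_bdiag_le (T : Matrix (Fin n) (Fin n) ℝ) (v : Fin m ⊕ Fin n → ℝ) :
    vnorm (bdiag m T *ᵥ v) ≤ max 1 (norm2 T) * vnorm v := by
  set μ := max 1 (norm2 T)
  have h1 : 1 ≤ μ := le_max_left _ _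
  have hμ : 0 ≤ μ := by linarith
  refine le_of_sq_le (mul_nonneg hμ (vnorm_nonneg _)) ?_
  set p : Fin m → ℝ := fun i => v (Sum.inl i)
  set q : Fin n → ℝ := fun j => v (Sum.inr j)
  have e1 : bdiag m T *ᵥ v = Sum.elim p (T *ᵥ q) := by
    rw [bdiag, Matrix.fromBlocks_mulVec]; simp [Function.comp_def, p, q]
  have e2 : vnorm v ^ 2 = vnorm p ^ 2 + vnorm q ^ 2 := by
    rw [vnorm_sq, Fintype.sum_sum_type, vnorm_sq, vnorm_sq]
  rw [e1, vnorm_elim_sq, mul_pow, e2]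
  have h2 : vnorm (T *ᵥ q) ≤ μ * vnorm q :=
    (vnorm_mulVec_le T q).trans (mul_le_mul_of_nonneg_right (le_max_right _ _) (vnorm_nonneg _))
  have h3 : vnorm (T *ᵥ q) ^ 2 ≤ (μ * vnorm q) ^ 2 := pow_le_pow_left₀ (vnorm_nonneg _) h2 2
  have h4 : 1 * vnorm p ^ 2 ≤ μ ^ 2 * vnorm p ^ 2 :=
    mul_le_mul_of_nonneg_right (by nlinarith) (sq_nonneg _)
  nlinarith

theorem bdiag_inv_mul {T : Matrix (Fin n) (Fin n) ℝ} (hT : IsUnit T.det) :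
    bdiag m T⁻¹ * bdiag m T = 1 := by
  rw [bdiag, bdiag, Matrix.fromBlocks_multiply]
  simp [Matrix.nonsing_inv_mul _ hT]

theorem vnorm_le_bdiag {T : Matrix (Fin n) (Fin n) ℝ} (hT : IsUnit T.det)
    (v : Fin m ⊕ Fin n → ℝ) : vnorm v ≤ max 1 (norm2 T⁻¹) * vnorm (bdiag m T *ᵥ v) := by
  have h := vnorm_bdiag_le (m := m) T⁻¹ (bdiag m T *ᵥ v)
  rwa [Matrix.mulVec_mulVec, bdiag_inv_mul hT, Matrix.one_mulVec] at h

/-- The left preconditioner acts on one off-diagonal block only; pulling `diag(I, T)` out on the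
right restores a symmetric augmented matrix, to which the energy estimate applies. -/
theorem MLinv_mul_augM {A : Matrix (Fin m) (Fin n) ℝ} {T : Matrix (Fin n) (Fin n) ℝ}
    (hT : IsUnit T.det) (α : ℝ) :
    MLinv m T * augM A α = augM (A * T⁻¹) α * bdiag m T := by
  rw [MLinv, augM, augM, bdiag, Matrix.fromBlocks_multiply, Matrix.fromBlocks_multiply]
  simp [Matrix.mul_assoc, Matrix.nonsing_inv_mul _ hT]

theorem MLinv_eq (T : Matrix (Fin n) (Fin n) ℝ) : MLinv m T = bdiag m (Tᵀ)⁻¹ := by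
  rw [MLinv, bdiag, Matrix.transpose_nonsing_inv]

theorem split_norm2_le {A : Matrix (Fin m) (Fin n) ℝ} {T : Matrix (Fin n) (Fin n) ℝ}
    (hT : IsUnit T.det) {α : ℝ} (hα : 0 ≤ α) :
    norm2 (MLinv m T * augM A α) ≤ (α + 2 * norm2 (A * T⁻¹)) * max 1 (norm2 T) := by
  have hN := norm2_nonneg (A * T⁻¹)
  refine norm2_le (by positivity) fun v => ?_
  rw [MLinv_mul_augM hT, ← Matrix.mulVec_mulVec, mul_assoc]
  exact (augM_vnorm_le _ hα _).trans
    (mul_le_mul_of_nonneg_left (vnorm_bdiag_le T v) (by positivity))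

theorem split_lower {A : Matrix (Fin m) (Fin n) ℝ} {T : Matrix (Fin n) (Fin n) ℝ}
    (hT : IsUnit T.det) {α l : ℝ}
    (hl : ∀ v, vnorm v ≤ l * vnorm (augM (A * T⁻¹) α *ᵥ v)) (v : Fin m ⊕ Fin n → ℝ) :
    vnorm v ≤ (max 1 (norm2 T⁻¹) * l) * vnorm ((MLinv m T * augM A α) *ᵥ v) := by
  rw [MLinv_mul_augM hT, ← Matrix.mulVec_mulVec, mul_assoc]
  exact (vnorm_le_bdiag hT v).trans
    (mul_le_mul_of_nonneg_left (hl _) (le_trans zero_le_one (le_max_left _ _)))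

/-- Expanding the maxima leaves the products `1`, `‖S‖`, `‖S†‖` and `κ(S)`, each at most `ψ`. The
factor 4 comes from the two factors 2 of the equivalence. -/
theorem max_mul_max_le_psi {s : ℕ} {S : Matrix (Fin s) (Fin n) ℝ} {β : ℝ} (hβ : 1 ≤ β)
    (hS : 1 ≤ cond2 S) {a b : ℝ} (ha : a ≤ 2 * norm2 S) (hb : b ≤ 2 * norm2 (pinv S)) :
    max 1 a * max 1 b ≤ 4 * psi β S := by
  set A := norm2 S with hA
  set B := norm2 (pinv S) with hB
  have hA0 : 0 ≤ A := norm2_nonneg _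
  have hB0 : 0 ≤ B := norm2_nonneg _
  have hAB : cond2 S = A * B := rfl
  have hψ1 : A ≤ psi β S := by
    have := le_max_left A (max B (β * cond2 S))
    unfold psi; nlinarith
  have hψ2 : B ≤ psi β S := by
    have := (le_max_left B (β * cond2 S)).trans (le_max_right A (max B (β * cond2 S)))
    unfold psi; nlinarith
  have hψ3 : A * B ≤ psi β S := by
    have := (le_max_right B (β * cond2 S)).trans (le_max_right A (max B (β * cond2 S)))
    rw [← hAB]
    have h1 : cond2 S ≤ max A (max B (β * cond2 S)) := by nlinarith
    exact h1.trans (le_mul_of_one_le_left (by linarith) hβ)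
  have hψ4 : 1 ≤ psi β S := by linarith
  have h1 : max 1 a ≤ 2 * max 1 A := by
    rcases max_cases 1 a with h | h <;> rcases max_cases 1 A with h' | h' <;> linarith
  have h2 : max 1 b ≤ 2 * max 1 B := by
    rcases max_cases 1 b with h | h <;> rcases max_cases 1 B with h' | h' <;> linarith
  have h3 : max 1 A * max 1 B ≤ psi β S := by
    rcases max_cases 1 A with h | h <;> rcases max_cases 1 B with h' | h' <;>
      rw [h.1, h'.1] <;> linarith
  have h4 : max 1 a * max 1 b ≤ (2 * max 1 A) * (2 * max 1 B) :=
    mul_le_mul h1 h2 (by positivity) (by positivity)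
  linarith

theorem one_le_psi {s : ℕ} {S : Matrix (Fin s) (Fin n) ℝ} {β : ℝ} (hβ : 1 ≤ β)
    (hS : 1 ≤ cond2 S) : 1 ≤ psi β S := by
  have := (le_max_right (norm2 (pinv S)) (β * cond2 S)).trans
    (le_max_right (norm2 S) (max (norm2 (pinv S)) (β * cond2 S)))
  have h2 : 1 ≤ β * cond2 S := one_le_mul_of_one_le_of_one_le hβ hS
  exact one_le_mul_of_one_le_of_one_le hβ (h2.trans this)

end Block

/-! ### Diagonal scaling of unknowns and right-hand sides -/

section Scaling
variable {m n : ℕ}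

theorem augM_mulVec_scl (A : Matrix (Fin m) (Fin n) ℝ) {α : ℝ} (hα : α ≠ 0)
    (v : Fin m ⊕ Fin n → ℝ) : augM A α *ᵥ scl α v = sclRhs α (augM A 1 *ᵥ v) := by
  rw [augM_mulVec, augM_mulVec]
  ext a
  rcases a with i | j
  · simp [scl, sclRhs, mul_inv_cancel_left₀ hα]
  · simp only [scl, sclRhs, Sum.elim_inl, Sum.elim_inr]
    have : (fun i => α⁻¹ * v (Sum.inl i)) = α⁻¹ • fun i => v (Sum.inl i) := rfl
    rw [this, Matrix.mulVec_smul]; rfl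

/-- Positive diagonal scaling commutes with entrywise absolute values, so componentwise residual
bounds pass to the scaled system without loss. -/
theorem absM_augM_mulVec_scl (A : Matrix (Fin m) (Fin n) ℝ) {α : ℝ} (hα : 0 < α)
    (v : Fin m ⊕ Fin n → ℝ) :
    (absM (augM A α) *ᵥ fun a => |scl α v a|) = sclRhs α (absM (augM A 1) *ᵥ fun a => |v a|) := by
  rw [absM_augM_mulVec A hα.le, absM_augM_mulVec A zero_le_one]
  ext a
  rcases a with i | j
  · simp [scl, sclRhs, abs_mul, abs_of_pos hα, mul_inv_cancel_left₀ hα.ne']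
  · simp only [scl, sclRhs, Sum.elim_inl, Sum.elim_inr, abs_mul, abs_inv, abs_of_pos hα]
    have : (fun i => α⁻¹ * |v (Sum.inl i)|) = α⁻¹ • fun i => |v (Sum.inl i)| := rfl
    rw [this, Matrix.mulVec_smul]; rfl

theorem scl_one (v : Fin m ⊕ Fin n → ℝ) : scl 1 v = v := by
  ext a; rcases a with i | j <;> simp [scl]

theorem sclRhs_one (v : Fin m ⊕ Fin n → ℝ) : sclRhs 1 v = v := by
  ext a; rcases a with i | j <;> simp [sclRhs]

theorem scl_sub (α : ℝ) (v w : Fin m ⊕ Fin n → ℝ) : scl α (v - w) = scl α v - scl α w := by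
  ext a; rcases a with i | j <;> simp [scl, mul_sub]

/-- The inverse of the scaling `scl α`. -/
noncomputable def unscl (α : ℝ) (y : Fin m ⊕ Fin n → ℝ) : Fin m ⊕ Fin n → ℝ :=
  Sum.elim (fun i => α * y (Sum.inl i)) (fun j => y (Sum.inr j))

theorem scl_unscl {α : ℝ} (hα : α ≠ 0) (y : Fin m ⊕ Fin n → ℝ) : scl α (unscl α y) = y := by
  ext a; rcases a with i | j <;> simp [scl, unscl, hα]

theorem unscl_scl {α : ℝ} (hα : α ≠ 0) (y : Fin m ⊕ Fin n → ℝ) : unscl α (scl α y) = y := by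
  ext a; rcases a with i | j <;> simp [scl, unscl, hα]

theorem unscl_sub (α : ℝ) (v w : Fin m ⊕ Fin n → ℝ) : unscl α (v - w) = unscl α v - unscl α w := by
  ext a; rcases a with i | j <;> simp [unscl, mul_sub]

theorem vnorm_scl_le {α c : ℝ} (hα : 0 < α) (hc : 1 ≤ c) (hαc : α⁻¹ ≤ c)
    (v : Fin m ⊕ Fin n → ℝ) : vnorm (scl α v) ≤ c * vnorm v := by
  have h : vnorm (scl α v) ≤ vnorm (c • v) := vnorm_mono fun a => by
    have h0 := abs_nonneg (v a)
    have hi : 0 ≤ α⁻¹ := (inv_pos.2 hα).le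
    rw [Pi.smul_apply, smul_eq_mul, abs_mul, abs_of_nonneg (by linarith : 0 ≤ c)]
    rcases a with i | j
    · simp only [scl, Sum.elim_inl, abs_mul, abs_of_nonneg hi]
      exact mul_le_mul_of_nonneg_right hαc h0
    · simp only [scl, Sum.elim_inr]; nlinarith
  rwa [vnorm_smul, abs_of_nonneg (by linarith : 0 ≤ c)] at h

theorem vnorm_unscl_le {α c : ℝ} (hα : 0 < α) (hc : 1 ≤ c) (hαc : α ≤ c)
    (v : Fin m ⊕ Fin n → ℝ) : vnorm (unscl α v) ≤ c * vnorm v := by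
  have h : vnorm (unscl α v) ≤ vnorm (c • v) := vnorm_mono fun a => by
    have h0 := abs_nonneg (v a)
    rw [Pi.smul_apply, smul_eq_mul, abs_mul, abs_of_nonneg (by linarith : 0 ≤ c)]
    rcases a with i | j
    · simp only [unscl, Sum.elim_inl, abs_mul, abs_of_pos hα]
      exact mul_le_mul_of_nonneg_right hαc h0
    · simp only [unscl, Sum.elim_inr]; nlinarith
  rwa [vnorm_smul, abs_of_nonneg (by linarith : 0 ≤ c)] at h

end Scaling

/-! ### The least-squares solution solves the augmented system -/

section LeastSquares
variable {m n : ℕ}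

theorem normal_equations {A : Matrix (Fin m) (Fin n) ℝ} {b : Fin m → ℝ} {x : Fin n → ℝ}
    (hx : ∀ y, vnorm (b - A *ᵥ x) ≤ vnorm (b - A *ᵥ y)) : Aᵀ *ᵥ (b - A *ᵥ x) = 0 := by
  set r := b - A *ᵥ x with hr
  set g := Aᵀ *ᵥ r with hg
  set G := vnorm g ^ 2 with hG
  set H := vnorm (A *ᵥ g) ^ 2 with hH
  have hrg : r ⬝ᵥ (A *ᵥ g) = G := by
    rw [hG, ← dotProduct_self_eq, Matrix.dotProduct_mulVec, ← Matrix.mulVec_transpose]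
  have key : ∀ t : ℝ, 2 * t * G ≤ t ^ 2 * H := by
    intro t
    have h1 := pow_le_pow_left₀ (vnorm_nonneg _) (hx (x + t • g)) 2
    have e : b - A *ᵥ (x + t • g) = r - t • (A *ᵥ g) := by
      rw [Matrix.mulVec_add, Matrix.mulVec_smul, hr]; abel
    rw [e, ← dotProduct_self_eq (r - _), ← dotProduct_self_eq r] at h1
    simp only [sub_dotProduct, dotProduct_sub, smul_dotProduct, dotProduct_smul, smul_eq_mul] at h1
    rw [dotProduct_comm (A *ᵥ g) r, hrg, dotProduct_self_eq (A *ᵥ g), ← hH] at h1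
    nlinarith
  have hH0 : 0 ≤ H := sq_nonneg _
  have hG0 : 0 ≤ G := sq_nonneg _
  have h0 : G = 0 := by
    by_contra hne
    have hpos : 0 < G := lt_of_le_of_ne hG0 (Ne.symm hne)
    -- Any small enough positive step along the gradient would do; the `+ 1` covers `H = 0`.
    have h1 := key (G / (H + 1))
    have h2 : 0 < G / (H + 1) := by positivity
    have h3 : G / (H + 1) * (H + 1) = G := by field_simp
    have h4 : 2 * G ≤ G / (H + 1) * H := by
      by_contra hlt
      nlinarith [mul_lt_mul_of_pos_left (not_le.1 hlt) h2]
    nlinarith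
  exact vnorm_eq_zero.1 (pow_eq_zero_iff two_ne_zero |>.1 h0)

theorem augM_mulVec_solution {A : Matrix (Fin m) (Fin n) ℝ} {b : Fin m → ℝ} {x : Fin n → ℝ}
    (hx : ∀ y, vnorm (b - A *ᵥ x) ≤ vnorm (b - A *ᵥ y)) :
    augM A 1 *ᵥ Sum.elim (b - A *ᵥ x) x = rhs n b := by
  rw [augM_mulVec]
  simp only [Sum.elim_inl, Sum.elim_inr, one_smul, rhs]
  have h1 : Aᵀ *ᵥ (fun i => (b - A *ᵥ x) i) = 0 := normal_equations hx
  rw [h1]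
  congr 1
  ext i; simp

end LeastSquares

/-- The sequence lies below its fixed point `B / (1 - q)` plus a geometric term; the strict gap to
`T` absorbs that term after finitely many steps. -/
theorem eventually_le_of_contraction {a : ℕ → ℝ} {q B T : ℝ} (hq0 : 0 ≤ q) (hq : q < 1)
    (h : ∀ i, a (i + 1) ≤ q * a i + B) (hT : B < (1 - q) * T) : ∃ N, ∀ i ≥ N, a i ≤ T := by
  have h1q : 0 < 1 - q := by linarith
  set L := B / (1 - q) with hL
  have hLe : q * L + B = L := by rw [hL]; field_simp; ring
  have hLT : L < T := by rw [hL, div_lt_iff₀ h1q]; linarith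
  have hind : ∀ i, a i ≤ L + q ^ i * |a 0 - L| := by
    intro i
    induction i with
    | zero => linarith [le_abs_self (a 0 - L)]
    | succ i ih =>
      have := mul_le_mul_of_nonneg_left ih hq0
      have := h i
      rw [pow_succ]
      linarith
  have hlim : Filter.Tendsto (fun i : ℕ => L + q ^ i * |a 0 - L|) Filter.atTop (nhds L) := by
    simpa using ((tendsto_pow_atTop_nhds_zero_of_lt_one hq0 hq).mul_const |a 0 - L|).const_add L
  obtain ⟨N, hN⟩ := Filter.eventually_atTop.1 (hlim.eventually (gt_mem_nhds hLT))
  exact ⟨N, fun i hi => (hind i).trans (hN i hi).le⟩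

/-! ### Limiting accuracy of abstract iterative refinement -/

section Refinement
variable {ι : Type*} [Fintype ι] [DecidableEq ι]

/-- Clears the quotient. If the denominator vanishes, then `t` and `B y` vanish too, so the
convention for division by zero does no harm. -/
theorem backwardErr_le_iff {B : Matrix ι ι ℝ} {t y : ι → ℝ} {κ : ℝ} (h : backwardErr B t y ≤ κ) :
    vnorm (t - B *ᵥ y) ≤ κ * (norm2 B * vnorm y + vnorm t) := by
  have h1 : 0 ≤ norm2 B * vnorm y := mul_nonneg (norm2_nonneg _) (vnorm_nonneg _)
  have h2 := vnorm_nonneg t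
  rcases (add_nonneg h1 h2).lt_or_eq with h0 | h0
  · rwa [backwardErr, div_le_iff₀ h0] at h
  · rw [← h0, mul_zero]
    have := vnorm_sub_le t (B *ᵥ y)
    linarith [vnorm_mulVec_le B y]

/-- Forward error of a solver with a small backward error. -/
theorem forward_of_backwardErr {B : Matrix ι ι ℝ} {y y' : ι → ℝ} {κ l θ : ℝ} (hκ : 0 ≤ κ)
    (hl0 : 0 ≤ l) (hl : ∀ v, vnorm v ≤ l * vnorm (B *ᵥ v))
    (h : backwardErr B (B *ᵥ y') y ≤ κ) (hθ : κ * (norm2 B * l) ≤ θ) (hθ1 : θ ≤ 1 / 2) :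
    vnorm (y - y') ≤ 4 * θ * vnorm y' := by
  have h1 := backwardErr_le_iff h
  rw [← Matrix.mulVec_sub, vnorm_sub_comm] at *
  have h2 := hl (y' - y)
  have h3 : vnorm (B *ᵥ (y' - y)) ≤ κ * (norm2 B * (vnorm y + vnorm y')) := by
    refine h1.trans (mul_le_mul_of_nonneg_left ?_ hκ)
    linarith [vnorm_mulVec_le B y']
  have h4 := mul_le_mul_of_nonneg_left h3 hl0
  have h5 : vnorm y ≤ vnorm y' + vnorm (y' - y) := by
    rw [vnorm_sub_comm]; exact vnorm_le_add_sub y y'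
  have h6 := mul_le_mul_of_nonneg_right hθ (add_nonneg (vnorm_nonneg y) (vnorm_nonneg y'))
  have h7 := vnorm_nonneg (y' - y)
  have h8 := vnorm_nonneg y'
  have hθ0 : 0 ≤ θ := le_trans (mul_nonneg hκ (mul_nonneg (norm2_nonneg _) hl0)) hθ
  -- As `θ ≤ 1/2`, the error on the right is absorbed on the left, at the price of doubling `2θ` to
  -- `4θ`.
  have h9 : vnorm (y' - y) ≤ θ * (2 * vnorm y' + vnorm (y' - y)) := by
    have := mul_le_mul_of_nonneg_left h5 hθ0
    linarith
  have h10 := mul_le_mul_of_nonneg_right hθ1 h7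
  linarith

theorem abs_le_absM_inv_mul {T : Matrix ι ι ℝ} (hT : IsUnit T.det) (v : ι → ℝ) (a : ι) :
    |v a| ≤ ((absM T⁻¹ * absM T) *ᵥ fun c => |v c|) a := by
  have h1 : v = T⁻¹ *ᵥ (T *ᵥ v) := by
    rw [Matrix.mulVec_mulVec, Matrix.nonsing_inv_mul _ hT, Matrix.one_mulVec]
  rw [← Matrix.mulVec_mulVec]
  conv_lhs => rw [h1]
  exact abs_mulVec_le _ (abs_mulVec_le _ fun _ => le_rfl) a

theorem one_le_condSkeel [Nonempty ι] {T : Matrix ι ι ℝ} (hT : IsUnit T.det) :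
    1 ≤ condSkeel T := by
  refine one_le_of_vnorm_le (κ := ι) fun v => ?_
  have h1 := vnorm_mulVec_le (absM T⁻¹ * absM T) (fun c => |v c|)
  rw [vnorm_abs] at h1
  exact (vnorm_mono fun a => (abs_le_absM_inv_mul hT v a).trans (le_abs_self _)).trans h1

theorem condAt_nonneg (T : Matrix ι ι ℝ) (d : ι → ℝ) : 0 ≤ condAt T d :=
  div_nonneg (vnorm_nonneg _) (vnorm_nonneg _)

/-- Limiting forward accuracy of iterative refinement. -/
theorem forward_refinement {T : Matrix ι ι ℝ} (hT : IsUnit T.det) {d : ι → ℝ} (hd : d ≠ 0)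
    {D W y : ℕ → ι → ℝ} {γ u ρ η ε g : ℝ} (hγ : 0 ≤ γ) (hρ0 : 0 ≤ ρ) (hu0 : 0 < u)
    (hρ : ρ ≤ η) (hu : u ≤ η) (hη : η ≤ 1 / 100) (hε : 0 < ε) (hηε : 100 * η ≤ ε)
    (hcond : γ * condSkeel T ≤ η) (hg : 2 * γ ≤ g)
    (h1 : ∀ i a, |W i a - (T *ᵥ (d - D i)) a| ≤
      γ * ((absM T *ᵥ fun c => |d c|) a + (absM T *ᵥ fun c => |D i c|) a))
    (h2 : ∀ i, vnorm (y i - T⁻¹ *ᵥ W i) ≤ ρ * vnorm (T⁻¹ *ᵥ W i))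
    (h3 : ∀ i a, |D (i + 1) a - (D i a + y i a)| ≤ u * |D i a + y i a| + 2 * u * |y i a|) :
    ∃ N, ∀ i ≥ N, vnorm (d - D i) / vnorm d ≤ (1 + ε) * (g * condAt T d + u) := by
  have hdpos := vnorm_pos hd
  set X := g * condAt T d * vnorm d with hX
  have hc0 := condAt_nonneg T d
  have hg0 : 0 ≤ g := by linarith
  have hX0 : 0 ≤ X := mul_nonneg (mul_nonneg hg0 hc0) hdpos.le
  have hη0 : 0 < η := by linarith
  -- Splitting `|D i| ≤ |d| + |e|` separates a persistent part, governed by `condAt T d`, from a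
  -- part proportional to the error, governed by `condSkeel T` and hence at most `η ‖e‖`.
  have hz : ∀ i, vnorm (T⁻¹ *ᵥ W i - (d - D i)) ≤ X + η * vnorm (d - D i) := by
    intro i
    set e := d - D i with he
    have e1 : T⁻¹ *ᵥ W i - e = T⁻¹ *ᵥ (W i - T *ᵥ e) := by
      rw [Matrix.mulVec_sub, Matrix.mulVec_mulVec, Matrix.nonsing_inv_mul _ hT, Matrix.one_mulVec]
    set Z := (absM T⁻¹ * absM T) *ᵥ fun c => |d c| with hZ
    set Z' := (absM T⁻¹ * absM T) *ᵥ fun c => |e c| with hZ'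
    have hmono : ∀ a, (absM T *ᵥ fun c => |D i c|) a ≤
        (absM T *ᵥ fun c => |d c|) a + (absM T *ᵥ fun c => |e c|) a := by
      intro a
      rw [← Pi.add_apply, ← Matrix.mulVec_add]
      refine Finset.sum_le_sum fun c _ => mul_le_mul_of_nonneg_left ?_ (abs_nonneg _)
      have : D i c = d c - e c := by simp [he]
      simp only [Pi.add_apply]; rw [this]; exact abs_sub _ _
    have e2 : ∀ a, |(W i - T *ᵥ e) a| ≤ (γ • ((2 : ℝ) • (absM T *ᵥ fun c => |d c|) +
        (absM T *ᵥ fun c => |e c|))) a := by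
      intro a
      refine (h1 i a).trans ?_
      simp only [Pi.smul_apply, Pi.add_apply, smul_eq_mul]
      exact mul_le_mul_of_nonneg_left (by linarith [hmono a]) hγ
    have e3 : ∀ a, |(T⁻¹ *ᵥ (W i - T *ᵥ e)) a| ≤ |(γ • ((2 : ℝ) • Z + Z')) a| := by
      intro a
      refine ((abs_mulVec_le T⁻¹ e2 a).trans (le_of_eq ?_)).trans (le_abs_self _)
      rw [Matrix.mulVec_smul, Matrix.mulVec_add, Matrix.mulVec_smul, hZ, hZ',
        Matrix.mulVec_mulVec, Matrix.mulVec_mulVec]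
    rw [e1]
    refine (vnorm_mono e3).trans ?_
    rw [vnorm_smul, abs_of_nonneg hγ]
    have e4 : vnorm ((2 : ℝ) • Z + Z') ≤ 2 * vnorm Z + vnorm Z' := by
      refine (vnorm_add_le _ _).trans ?_
      rw [vnorm_smul]; simp
    have e5 : vnorm Z = condAt T d * vnorm d := by
      rw [condAt, div_mul_cancel₀ _ hdpos.ne']
    have e6 : vnorm Z' ≤ condSkeel T * vnorm e := by
      have := vnorm_mulVec_le (absM T⁻¹ * absM T) (fun c => |e c|)
      rwa [vnorm_abs] at this
    have e7 := mul_le_mul_of_nonneg_left e4 hγ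
    have e8 := mul_le_mul_of_nonneg_left e6 hγ
    have e9 := mul_le_mul_of_nonneg_right hcond (vnorm_nonneg e)
    have e10 := mul_le_mul_of_nonneg_right hg (mul_nonneg hc0 hdpos.le)
    rw [e5] at e7
    rw [hX]
    linarith
  -- The inner solve error contributes `η`, the two update roundings `2η` and `4η`, all relative to
  -- `‖e‖ + ‖z‖`. Inserting `‖z‖ ≤ X + η ‖e‖` gives `8η + 7η² ≤ 14η`.
  have hstep : ∀ i, vnorm (d - D (i + 1)) ≤
      14 * η * vnorm (d - D i) + (1 + 7 * η) * (X + u * vnorm d) := by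
    intro i
    have hzi := hz i
    set e := d - D i with he
    set δ := T⁻¹ *ᵥ W i with hδ
    set z := δ - e with hz'
    set q := y i - δ with hq
    set Δ := D (i + 1) - (D i + y i) with hΔ
    have hE := vnorm_nonneg e
    have hZ := vnorm_nonneg z
    have f1 : vnorm δ ≤ vnorm e + vnorm z := vnorm_le_add_sub δ e
    have f2 : vnorm q ≤ ρ * (vnorm e + vnorm z) :=
      (h2 i).trans (mul_le_mul_of_nonneg_left f1 hρ0)
    have f3 : vnorm (y i) ≤ vnorm δ + vnorm q := vnorm_le_add_sub (y i) δ
    have f4 : D i + y i = d + (z + q) := by rw [hz', hq, he]; abel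
    have f5 : d - D (i + 1) = -(z + q) - Δ := by rw [hΔ, f4]; abel
    have f6 : vnorm Δ ≤ u * vnorm (D i + y i) + 2 * u * vnorm (y i) := by
      have h4 : vnorm Δ ≤ vnorm (u • (fun a => |(D i + y i) a|) + (2 * u) • fun a => |y i a|) :=
        vnorm_mono fun a => (h3 i a).trans (le_abs_self _)
      refine h4.trans ((vnorm_add_le _ _).trans ?_)
      rw [vnorm_smul, vnorm_smul, vnorm_abs, vnorm_abs, abs_of_pos hu0,
        abs_of_pos (by linarith : 0 < 2 * u)]
    have f7 : vnorm (z + q) ≤ vnorm z + vnorm q := vnorm_add_le _ _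
    have f8 : vnorm (D i + y i) ≤ vnorm d + vnorm (z + q) := by
      rw [f4]; exact vnorm_add_le _ _
    have f9 : vnorm (d - D (i + 1)) ≤ vnorm (z + q) + vnorm Δ := by
      rw [f5]
      refine (vnorm_sub_le _ _).trans ?_
      rw [vnorm_neg]
    have g1 : vnorm q ≤ η * (vnorm e + vnorm z) :=
      f2.trans (mul_le_mul_of_nonneg_right hρ (by linarith))
    have g2 : vnorm (y i) ≤ 2 * (vnorm e + vnorm z) := by nlinarith
    have g3 : vnorm (z + q) ≤ 2 * (vnorm e + vnorm z) := by nlinarith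
    have g4 : u * vnorm (D i + y i) ≤ u * vnorm d + η * (2 * (vnorm e + vnorm z)) := by
      have t1 := mul_le_mul_of_nonneg_left f8 hu0.le
      have t2 : u * vnorm (z + q) ≤ η * (2 * (vnorm e + vnorm z)) :=
        mul_le_mul hu g3 (vnorm_nonneg _) hη0.le
      linarith
    have g5 : 2 * u * vnorm (y i) ≤ 2 * (η * (2 * (vnorm e + vnorm z))) := by
      have t2 : u * vnorm (y i) ≤ η * (2 * (vnorm e + vnorm z)) :=
        mul_le_mul hu g2 (vnorm_nonneg _) hη0.le
      linarith
    have g6 : vnorm (d - D (i + 1)) ≤ (1 + 7 * η) * vnorm z + 7 * η * vnorm e + u * vnorm d := by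
      linarith
    have g7 := mul_le_mul_of_nonneg_left hzi (by linarith : 0 ≤ 1 + 7 * η)
    have g8 : η * (7 * η) * vnorm e - η * (6 * vnorm e) ≤ 0 := by
      have : 0 ≤ η * vnorm e := mul_nonneg hη0.le hE
      nlinarith
    have g9 : 0 ≤ 7 * η * (u * vnorm d) := by positivity
    nlinarith
  have hpos : 0 < X + u * vnorm d := add_pos_of_nonneg_of_pos hX0 (mul_pos hu0 hdpos)
  obtain ⟨N, hN⟩ := eventually_le_of_contraction (a := fun i => vnorm (d - D i))
    (T := (1 + ε) * (X + u * vnorm d)) (by linarith) (by linarith) hstep (by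
      rw [← mul_assoc]
      refine mul_lt_mul_of_pos_right ?_ hpos
      nlinarith)
  refine ⟨N, fun i hi => ?_⟩
  rw [div_le_iff₀ hdpos]
  refine (hN i hi).trans (le_of_eq ?_)
  rw [hX]; ring

/-- Limiting backward error of iterative refinement. -/
theorem backward_refinement {T : Matrix ι ι ℝ} (hT : IsUnit T.det) {d bt : ι → ℝ}
    (hbt : T *ᵥ d = bt) (hb : bt ≠ 0)
    {D W y : ℕ → ι → ℝ} {g u ρ η : ℝ} (hg : 0 ≤ g) (hρ0 : 0 ≤ ρ) (hu0 : 0 < u)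
    (hρ : ρ ≤ η) (hη : η ≤ 1 / 100)
    (hgκ : g * (norm2 T * norm2 T⁻¹) ≤ η) (huκ : u * (norm2 T * norm2 T⁻¹) ≤ η)
    (h1 : ∀ i, vnorm (W i - T *ᵥ (d - D i)) ≤ g * (vnorm bt + norm2 T * vnorm (D i)))
    (h2 : ∀ i, vnorm (W i - T *ᵥ y i) ≤ ρ * vnorm (W i))
    (h2' : ∀ i, vnorm (y i - T⁻¹ *ᵥ W i) ≤ ρ * vnorm (T⁻¹ *ᵥ W i))
    (h3 : ∀ i a, |D (i + 1) a - (D i a + y i a)| ≤ u * |D i a + y i a| + 2 * u * |y i a|) :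
    ∃ N, ∀ i ≥ N, backwardErr T bt (D i) ≤ (1 + 60 * η) * (u + g) := by
  set L := norm2 T with hL
  set M := norm2 T⁻¹ with hM
  have hL0 : 0 ≤ L := norm2_nonneg _
  have hM0 : 0 ≤ M := norm2_nonneg _
  have hη0 : 0 ≤ η := hρ0.trans hρ
  set S := vnorm bt + L * vnorm d with hS
  have hS0 : 0 < S := add_pos_of_pos_of_nonneg (vnorm_pos hb) (mul_nonneg hL0 (vnorm_nonneg _))
  have hinv : ∀ v, vnorm v ≤ M * vnorm (T *ᵥ v) := by
    intro v
    have := vnorm_mulVec_le T⁻¹ (T *ᵥ v)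
    rwa [Matrix.mulVec_mulVec, Matrix.nonsing_inv_mul _ hT, Matrix.one_mulVec] at this
  -- The residual, not the error, is tracked: an error is turned into a residual by `κ(T)`, always
  -- paired with `u` or `g`, so each conversion costs at most `η`.
  have hstep : ∀ i, vnorm (T *ᵥ (d - D (i + 1))) ≤
      16 * η * vnorm (T *ᵥ (d - D i)) + (1 + 7 * η) * ((u + g) * S) := by
    intro i
    set r := T *ᵥ (d - D i) with hr
    set R := vnorm r with hR
    have hR0 : 0 ≤ R := vnorm_nonneg _
    set w := vnorm (W i) with hw
    have hw0 : 0 ≤ w := vnorm_nonneg _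
    set Δ := D (i + 1) - (D i + y i) with hΔ
    have f1 : vnorm (D i) ≤ vnorm d + M * R := by
      have t1 := hinv (d - D i)
      have t2 := vnorm_le_add_sub (D i) d
      rw [vnorm_sub_comm] at t2
      linarith
    have f2 : vnorm (W i - r) ≤ g * S + η * R := by
      refine (h1 i).trans ?_
      have t1 := mul_le_mul_of_nonneg_left (mul_le_mul_of_nonneg_left f1 hL0) hg
      have t2 := mul_le_mul_of_nonneg_right hgκ hR0
      rw [hS]; linarith
    have f3 : w ≤ R + (g * S + η * R) := (vnorm_le_add_sub (W i) r).trans (by linarith)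
    have f4 : vnorm (y i) ≤ 2 * (M * w) := by
      have t1 := vnorm_le_add_sub (y i) (T⁻¹ *ᵥ W i)
      have t2 := h2' i
      have t3 := vnorm_mulVec_le T⁻¹ (W i)
      have t4 := mul_le_mul_of_nonneg_right (by linarith : ρ ≤ 1) (vnorm_nonneg (T⁻¹ *ᵥ W i))
      linarith
    have f5 : vnorm Δ ≤ u * vnorm (D i + y i) + 2 * u * vnorm (y i) := by
      have h4 : vnorm Δ ≤ vnorm (u • (fun a => |(D i + y i) a|) + (2 * u) • fun a => |y i a|) :=
        vnorm_mono fun a => (h3 i a).trans (le_abs_self _)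
      refine h4.trans ((vnorm_add_le _ _).trans ?_)
      rw [vnorm_smul, vnorm_smul, vnorm_abs, vnorm_abs, abs_of_pos hu0,
        abs_of_pos (by linarith : 0 < 2 * u)]
    have f6 : vnorm Δ ≤ u * (vnorm d + M * R + 6 * (M * w)) := by
      have t1 := mul_le_mul_of_nonneg_left (vnorm_add_le (D i) (y i)) hu0.le
      have t2 := mul_le_mul_of_nonneg_left f1 hu0.le
      have t3 := mul_le_mul_of_nonneg_left f4 hu0.le
      linarith
    have f7 : vnorm (T *ᵥ Δ) ≤ u * (L * vnorm d) + η * R + 6 * (η * w) := by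
      have t1 := vnorm_mulVec_le T Δ
      have t2 := mul_le_mul_of_nonneg_left f6 hL0
      have t3 := mul_le_mul_of_nonneg_right huκ hR0
      have t4 := mul_le_mul_of_nonneg_right huκ hw0
      linarith
    have f8 : T *ᵥ (d - D (i + 1)) = (W i - T *ᵥ y i) - (W i - r) - T *ᵥ Δ := by
      rw [hΔ, hr]; simp only [Matrix.mulVec_sub, Matrix.mulVec_add]; abel
    have f9 : vnorm (T *ᵥ (d - D (i + 1))) ≤
        η * w + (g * S + η * R) + (u * (L * vnorm d) + η * R + 6 * (η * w)) := by
      rw [f8]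
      have t1 := vnorm_sub_le ((W i - T *ᵥ y i) - (W i - r)) (T *ᵥ Δ)
      have t2 := vnorm_sub_le (W i - T *ᵥ y i) (W i - r)
      have t3 := h2 i
      have t4 := mul_le_mul_of_nonneg_right hρ hw0
      linarith
    have f10 : u * (L * vnorm d) ≤ u * S :=
      mul_le_mul_of_nonneg_left (by rw [hS]; linarith [vnorm_nonneg bt]) hu0.le
    have f11 := mul_le_mul_of_nonneg_left f3 hη0
    have f12 : η * (η * R) ≤ 1 / 100 * (η * R) :=
      mul_le_mul_of_nonneg_right hη (mul_nonneg hη0 hR0)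
    have f13 : 0 ≤ η * (u * S) := by positivity
    have f14 : 0 ≤ η * R := by positivity
    linarith
  -- `η = 0` is impossible since `u κ(T) > 0`; positivity is needed for the strict gap in the
  -- contraction lemma.
  rcases hη0.lt_or_eq with hηp | hηz
  swap
  · exfalso
    rw [← hηz] at huκ
    have hLM : 0 < L * M := by
      obtain ⟨v, hv⟩ : ∃ v : ι → ℝ, 0 < vnorm v := ⟨bt, vnorm_pos hb⟩
      have t1 := hinv v
      have t2 := mul_le_mul_of_nonneg_left (vnorm_mulVec_le T v) hM0
      by_contra hneg
      have : L * M * vnorm v ≤ 0 := mul_nonpos_of_nonpos_of_nonneg (not_lt.1 hneg) hv.le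
      linarith
    linarith [mul_pos hu0 hLM]
  have hpos : 0 < (u + g) * S := mul_pos (by linarith) hS0
  obtain ⟨N, hN⟩ := eventually_le_of_contraction (a := fun i => vnorm (T *ᵥ (d - D i)))
    (T := (1 + 50 * η) * ((u + g) * S)) (by linarith) (by linarith) hstep (by
      rw [← mul_assoc (1 - 16 * η)]
      refine mul_lt_mul_of_pos_right ?_ hpos
      nlinarith)
  refine ⟨N, fun i hi => ?_⟩
  have hRi := hN i hi
  have hres : bt - T *ᵥ D i = T *ᵥ (d - D i) := by rw [Matrix.mulVec_sub, hbt]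
  have hden : 0 < L * vnorm (D i) + vnorm bt :=
    add_pos_of_nonneg_of_pos (mul_nonneg hL0 (vnorm_nonneg _)) (vnorm_pos hb)
  rw [backwardErr, hres, div_le_iff₀ hden]
  set R := vnorm (T *ᵥ (d - D i))
  set E := L * vnorm (D i) + vnorm bt
  -- The recursion is normalised by `‖d‖`, the backward error by `‖D i‖`. Since `κ(T) (u + g) ≤ 2η`,
  -- exchanging them costs only a factor `1 - 4η`.
  have k1 : S ≤ E + L * M * R := by
    have t1 := hinv (d - D i)
    have t2 := vnorm_le_add_sub d (D i)
    have t3 := mul_le_mul_of_nonneg_left (t2.trans (add_le_add_right t1 _)) hL0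
    simp only [hS, E]; linarith
  have hLM0 : 0 ≤ L * M := mul_nonneg hL0 hM0
  have k2 : L * M * R ≤ 4 * η * S := by
    have t1 := mul_le_mul_of_nonneg_left hRi hLM0
    have t2 : L * M * ((1 + 50 * η) * ((u + g) * S)) =
        (1 + 50 * η) * ((u * (L * M) + g * (L * M)) * S) := by ring
    have t3 : (u * (L * M) + g * (L * M)) * S ≤ 2 * η * S :=
      mul_le_mul_of_nonneg_right (by linarith) hS0.le
    have t4 := mul_le_mul_of_nonneg_left t3 (by linarith : 0 ≤ 1 + 50 * η)
    have t5 : 0 ≤ η * S := mul_nonneg hη0 hS0.le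
    nlinarith
  have k3 : (1 - 4 * η) * S ≤ E := by linarith
  have k4 : (1 + 50 * η) * S ≤ (1 + 60 * η) * E := by
    have t1 := mul_le_mul_of_nonneg_left k3 (by linarith : 0 ≤ 1 + 60 * η)
    have t2 : (1 + 50 * η) * S ≤ (1 + 60 * η) * ((1 - 4 * η) * S) := by
      rw [← mul_assoc]
      exact mul_le_mul_of_nonneg_right (by nlinarith) hS0.le
    linarith
  have k5 := mul_le_mul_of_nonneg_left k4 (by linarith : 0 ≤ u + g)
  linarith

open Classical in
/-- Norm of the entrywise absolute value of a matrix with at most `p` nonzeros per row. -/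
theorem vnorm_absM_mulVec_le (T : Matrix ι ι ℝ) {p : ℕ}
    (hp : ∀ a, (Finset.univ.filter fun c => T a c ≠ 0).card ≤ p) (v : ι → ℝ) :
    vnorm (absM T *ᵥ fun c => |v c|) ≤ Real.sqrt p * (norm2 T * vnorm v) := by
  have hcol : ∀ c, ∑ a, T a c ^ 2 ≤ norm2 T ^ 2 := by
    intro c
    have h1 := vnorm_mulVec_le T (Pi.single c 1)
    have h2 : T *ᵥ Pi.single c 1 = fun a => T a c := by ext i; simp
    have h3 : vnorm (Pi.single c 1 : ι → ℝ) = 1 := by simp [vnorm]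
    rw [h2, h3, mul_one] at h1
    have := pow_le_pow_left₀ (vnorm_nonneg _) h1 2
    rwa [vnorm_sq] at this
  refine le_of_sq_le (mul_nonneg (Real.sqrt_nonneg _)
    (mul_nonneg (norm2_nonneg _) (vnorm_nonneg _))) ?_
  rw [mul_pow, Real.sq_sqrt (Nat.cast_nonneg _), mul_pow, vnorm_sq]
  -- Cauchy–Schwarz over the at most `p` nonzeros of a row; summing over rows then meets column
  -- norms, which are at most `norm2 T`.
  have hrow : ∀ a, (absM T *ᵥ fun c => |v c|) a ^ 2 ≤ p * ∑ c, T a c ^ 2 * v c ^ 2 := by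
    intro a
    set F := Finset.univ.filter fun c => T a c ≠ 0
    have e1 : (absM T *ᵥ fun c => |v c|) a = ∑ c ∈ F, |T a c * v c| := by
      simp only [Matrix.mulVec, dotProduct, absM, Matrix.map_apply, ← abs_mul]
      refine (Finset.sum_subset (Finset.subset_univ F) fun c _ hc => ?_).symm
      have : T a c = 0 := by simpa [F] using hc
      simp [this]
    rw [e1]
    refine (sq_sum_le_card_mul_sum_sq (s := F) (f := fun c => |T a c * v c|)).trans ?_
    refine mul_le_mul (by exact_mod_cast hp a) ?_ (Finset.sum_nonneg fun _ _ => sq_nonneg _)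
      (Nat.cast_nonneg _)
    refine (Finset.sum_le_univ_sum_of_nonneg fun _ => sq_nonneg _).trans (le_of_eq ?_)
    exact Finset.sum_congr rfl fun c _ => by rw [sq_abs, mul_pow]
  refine (Finset.sum_le_sum fun a _ => hrow a).trans ?_
  rw [← Finset.mul_sum, Finset.sum_comm]
  refine mul_le_mul_of_nonneg_left ?_ (Nat.cast_nonneg _)
  rw [vnorm_sq, Finset.mul_sum]
  refine Finset.sum_le_sum fun c _ => ?_
  rw [← Finset.sum_mul]
  exact mul_le_mul_of_nonneg_right (hcol c) (sq_nonneg _)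

end Refinement

/-! ### Refinement for the augmented system -/

section Iteration
variable {m n : ℕ} (F : Precisions) {A : Matrix (Fin m) (Fin n) ℝ} {b : Fin m → ℝ}

/-- The correction `α y` is rounded before it is added. The second-order term `u² |v|` is absorbed
into `2u |v|` by `u < 1`. -/
theorem fl_update_err (P : Precision) (t v : ℝ) :
    |P.fl (t + P.fl v) - (t + v)| ≤ P.u * |t + v| + 2 * P.u * |v| := by
  have hu := P.u_pos
  have hu1 := P.u_lt_one
  have h1 := P.fl_err (t + P.fl v)
  have h2 := P.fl_err v
  have h3 : |t + P.fl v| ≤ |t + v| + |P.fl v - v| := by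
    calc _ = |(t + v) + (P.fl v - v)| := by ring_nf
      _ ≤ _ := abs_add_le _ _
  have h4 : |P.fl (t + P.fl v) - (t + v)| ≤
      |P.fl (t + P.fl v) - (t + P.fl v)| + |P.fl v - v| := by
    calc _ = |(P.fl (t + P.fl v) - (t + P.fl v)) + (P.fl v - v)| := by ring_nf
      _ ≤ _ := abs_add_le _ _
  have h5 := mul_le_mul_of_nonneg_left h3 hu.le
  have h6 : P.u * |P.fl v - v| ≤ 1 * (P.u * |v|) :=
    mul_le_mul hu1.le h2 (abs_nonneg _) zero_le_one
  linarith

/-- Rounding error of the update of the iterate. -/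
theorem lsirStep_err (R : Matrix (Fin n) (Fin n) ℝ) (α : ℝ) (k : ℕ) (e : Fin m ⊕ Fin n → ℝ)
    (a : Fin m ⊕ Fin n) :
    |lsirStep F A b R α k e a - (e a + unscl α (innerSolve F A b R α k e) a)| ≤
      F.work.u * |e a + unscl α (innerSolve F A b R α k e) a| +
        2 * F.work.u * |unscl α (innerSolve F A b R α k e) a| := by
  rcases a with i | j
  · simp only [lsirStep, unscl, Sum.elim_inl]
    exact fl_update_err F.work _ _
  · simp only [lsirStep, unscl, Sum.elim_inr]
    have h := F.work.fl_err (e (Sum.inr j) + innerSolve F A b R α k e (Sum.inr j))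
    have := mul_nonneg (mul_nonneg zero_le_two F.work.u_pos.le)
      (abs_nonneg (innerSolve F A b R α k e (Sum.inr j)))
    linarith

theorem scl_step_err {α u : ℝ} (hα : 0 < α) {e' e v : Fin m ⊕ Fin n → ℝ}
    (h : ∀ a, |e' a - (e a + v a)| ≤ u * |e a + v a| + 2 * u * |v a|) (a : Fin m ⊕ Fin n) :
    |scl α e' a - (scl α e a + scl α v a)| ≤
      u * |scl α e a + scl α v a| + 2 * u * |scl α v a| := by
  rcases a with i | j
  · simp only [scl, Sum.elim_inl]
    have hi : 0 < α⁻¹ := inv_pos.2 hα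
    rw [← mul_add, ← mul_sub, abs_mul, abs_mul, abs_mul, abs_of_pos hi]
    have := mul_le_mul_of_nonneg_left (h (Sum.inl i)) hi.le
    linarith
  · exact h (Sum.inr j)

theorem abs_sclRhs_le {α : ℝ} (hα : 0 < α) {v w : Fin m ⊕ Fin n → ℝ} (h : ∀ a, |v a| ≤ w a)
    (a : Fin m ⊕ Fin n) : |sclRhs α v a| ≤ sclRhs α w a := by
  rcases a with i | j
  · exact h (Sum.inl i)
  · simp only [sclRhs, Sum.elim_inr]
    rw [abs_mul, abs_of_pos (inv_pos.2 hα)]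
    exact mul_le_mul_of_nonneg_left (h _) (inv_pos.2 hα).le

/-- Componentwise error of the computed residual in the scaled augmented system. -/
theorem scaled_residual_err (P : Precision) {d : Fin m ⊕ Fin n → ℝ}
    (hd : augM A 1 *ᵥ d = rhs n b) {α : ℝ} (hα : 0 < α) (e : Fin m ⊕ Fin n → ℝ)
    (a : Fin m ⊕ Fin n) :
    |sclRhs α (computedRes P A b e) a - (augM A α *ᵥ (scl α d - scl α e)) a| ≤
      ((1 + P.u) ^ maxRowNnz (augM A 1) d - 1) *
        ((absM (augM A α) *ᵥ fun c => |scl α d c|) a +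
          (absM (augM A α) *ᵥ fun c => |scl α e c|) a) := by
  set γ := (1 + P.u) ^ maxRowNnz (augM A 1) d - 1 with hγ
  have hγ0 : 0 ≤ γ := sub_nonneg.2 (one_le_pow₀ (by linarith [P.u_pos]))
  rw [← scl_sub, augM_mulVec_scl A hα.ne', absM_augM_mulVec_scl A hα, absM_augM_mulVec_scl A hα]
  have h1 : ∀ c, |(computedRes P A b e - augM A 1 *ᵥ (d - e)) c| ≤
      (γ • ((absM (augM A 1) *ᵥ fun c => |d c|) + (absM (augM A 1) *ᵥ fun c => |e c|))) c := by
    intro c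
    have := computedRes_err P A b d e c
    rw [Matrix.mulVec_sub, hd]
    refine this.trans ?_
    simp only [Pi.smul_apply, Pi.add_apply, smul_eq_mul]
    refine mul_le_mul_of_nonneg_left (add_le_add_left ?_ _) hγ0
    rw [← hd]
    exact abs_mulVec_le _ (fun _ => le_rfl) c
  have h2 := abs_sclRhs_le hα h1 a
  rcases a with i | j
  · simpa [sclRhs] using h2
  · simp only [sclRhs, Sum.elim_inr, Pi.sub_apply, Pi.smul_apply, Pi.add_apply, smul_eq_mul] at h2 ⊢
    rw [← mul_sub]
    linarith

variable {d : Fin m ⊕ Fin n → ℝ} {R : Matrix (Fin n) (Fin n) ℝ} {k : ℕ → ℕ}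
  {d₀ : Fin m ⊕ Fin n → ℝ} {α η ε K : ℝ}

/-- Relative error of the inner solver. -/
theorem innerSolve_err (hA : ∀ v, A *ᵥ v = 0 → v = 0) (hα : 0 < α) (hK : 0 ≤ K) {l θ : ℝ}
    (hl0 : 0 ≤ l) (hl : ∀ v, vnorm v ≤ l * vnorm ((MLinv m R * augM A α) *ᵥ v))
    (hθ : K * F.work.u * (norm2 (MLinv m R * augM A α) * l) ≤ θ) (hθ1 : θ ≤ 1 / 2)
    {k : ℕ} {e : Fin m ⊕ Fin n → ℝ} (h : innerBackwardErr F A b R α k e ≤ K * F.work.u) :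
    vnorm (innerSolve F A b R α k e - (augM A α)⁻¹ *ᵥ sclRhs α (computedRes F.res A b e)) ≤
      4 * θ * vnorm ((augM A α)⁻¹ *ᵥ sclRhs α (computedRes F.res A b e)) := by
  refine forward_of_backwardErr (mul_nonneg hK F.work.u_pos.le) hl0 hl ?_ hθ hθ1
  rw [Matrix.mulVec_mulVec, Matrix.mul_assoc, Matrix.mul_nonsing_inv _ (isUnit_det_augM hA hα),
    Matrix.mul_one]
  exact h

/-- Because `c ≥ 1`, smallness of `p u c` also makes `p u` small, so the second-order part of `(1 +
u)^p - 1` is dominated by the first. -/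
theorem gamma_le {u c : ℝ} (hu : 0 < u) {p : ℕ} (hc : 1 ≤ c) (h : 2 * (p * u * c) ≤ η)
    (hη : η ≤ 1 / 100) :
    (1 + u) ^ p - 1 ≤ 2 * (p * u) ∧ ((1 + u) ^ p - 1) * c ≤ η := by
  have h0 : 0 ≤ (p : ℝ) * u := by positivity
  have h1 : (p : ℝ) * u ≤ p * u * c := le_mul_of_one_le_right h0 hc
  have h2 := one_add_pow_sub_one_le hu.le (p := p) (by linarith)
  have h3 : (1 + u) ^ p - 1 ≤ 2 * (p * u) := by nlinarith
  exact ⟨h3, by nlinarith⟩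

theorem gamma_nonneg (P : Precision) (p : ℕ) : 0 ≤ (1 + P.u) ^ p - 1 :=
  sub_nonneg.2 (one_le_pow₀ (by linarith [P.u_pos]))

/-- Refinement viewed in the unknowns `(α⁻¹ r, x)`: residual and update errors are componentwise,
hence invariant under the scaling. The residual itself is computed for the unscaled system, so its
nonzero count is that of `augM A 1`. -/
theorem forward_scaled (hA : ∀ v, A *ᵥ v = 0 → v = 0) (hd : augM A 1 *ᵥ d = rhs n b)
    (hb : b ≠ 0) (hα : 0 < α) (hK : 0 ≤ K) {l : ℝ} (hl0 : 0 ≤ l)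
    (hl : ∀ v, vnorm v ≤ l * vnorm ((MLinv m R * augM A α) *ᵥ v))
    (hθ : 4 * (K * F.work.u * (norm2 (MLinv m R * augM A α) * l)) ≤ η)
    (hu : F.work.u ≤ η) (hη : η ≤ 1 / 100) (hε : 0 < ε) (hηε : 100 * η ≤ ε)
    (hcond : 2 * (maxRowNnz (augM A 1) d * F.res.u * condSkeel (augM A α)) ≤ η)
    (h : ∀ i, innerBackwardErr F A b R α (k i) (lsir F A b R α k d₀ i) ≤ K * F.work.u) :
    ∃ N, ∀ i ≥ N, vnorm (scl α (d - lsir F A b R α k d₀ i)) / vnorm (scl α d) ≤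
      (1 + ε) * (4 * maxRowNnz (augM A 1) d * F.res.u * condAt (augM A α) (scl α d) +
        F.work.u) := by
  have hT := isUnit_det_augM hA hα
  have hd0 : d ≠ 0 := by
    rintro rfl
    rw [Matrix.mulVec_zero] at hd
    exact hb (funext fun i => (congrFun hd (Sum.inl i)).symm)
  have hsd : scl α d ≠ 0 := fun h0 => hd0 (by
    rw [← unscl_scl hα.ne' d, h0]; ext a; rcases a with i | j <;> simp [unscl])
  obtain ⟨i0, hi0⟩ : ∃ i, b i ≠ 0 := by
    by_contra! hcon; exact hb (funext hcon)
  have : Nonempty (Fin m ⊕ Fin n) := ⟨Sum.inl i0⟩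
  obtain ⟨hg1, hg2⟩ := gamma_le F.res.u_pos (one_le_condSkeel hT) hcond hη
  set θ := K * F.work.u * (norm2 (MLinv m R * augM A α) * l) with hθd
  have hθ0 : 0 ≤ θ :=
    mul_nonneg (mul_nonneg hK F.work.u_pos.le) (mul_nonneg (norm2_nonneg _) hl0)
  simp_rw [scl_sub]
  refine forward_refinement hT hsd (D := fun i => scl α (lsir F A b R α k d₀ i))
    (W := fun i => sclRhs α (computedRes F.res A b (lsir F A b R α k d₀ i)))
    (y := fun i => innerSolve F A b R α (k i) (lsir F A b R α k d₀ i))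
    (gamma_nonneg F.res _) (by linarith : 0 ≤ 4 * θ) F.work.u_pos hθ hu hη hε hηε hg2 (by linarith)
    (fun i a => scaled_residual_err F.res hd hα _ a)
    (fun i => innerSolve_err F hA hα hK hl0 hl hθd.symm.le (by linarith) (h i)) fun i a => ?_
  have := scl_step_err hα (lsirStep_err F (A := A) (b := b) R α (k i)
    (lsir F A b R α k d₀ i)) a
  rwa [scl_unscl hα.ne'] at this

/-- The inner solver is accurate in the scaled unknowns; going to them and back costs a factor `t`
each way, hence `t ^ 2`. -/
theorem forward_unscaled (hA : ∀ v, A *ᵥ v = 0 → v = 0) (hd : augM A 1 *ᵥ d = rhs n b)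
    (hb : b ≠ 0) (hα : 0 < α) (hK : 0 ≤ K) {l t : ℝ} (hl0 : 0 ≤ l)
    (hl : ∀ v, vnorm v ≤ l * vnorm ((MLinv m R * augM A α) *ᵥ v))
    (ht : 1 ≤ t) (hαt : α ≤ t) (hαt' : α⁻¹ ≤ t)
    (hθ : 4 * t ^ 2 * (K * F.work.u * (norm2 (MLinv m R * augM A α) * l)) ≤ η)
    (hu : F.work.u ≤ η) (hη : η ≤ 1 / 100) (hε : 0 < ε) (hηε : 100 * η ≤ ε)
    (hcond : 2 * (maxRowNnz (augM A 1) d * F.res.u * condSkeel (augM A 1)) ≤ η)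
    (h : ∀ i, innerBackwardErr F A b R α (k i) (lsir F A b R α k d₀ i) ≤ K * F.work.u) :
    ∃ N, ∀ i ≥ N, vnorm (d - lsir F A b R α k d₀ i) / vnorm d ≤
      (1 + ε) * (4 * maxRowNnz (augM A 1) d * F.res.u * condAt (augM A 1) d + F.work.u) := by
  have hT := isUnit_det_augM hA one_pos
  have hd0 : d ≠ 0 := by
    rintro rfl
    rw [Matrix.mulVec_zero] at hd
    exact hb (funext fun i => (congrFun hd (Sum.inl i)).symm)
  obtain ⟨i0, hi0⟩ : ∃ i, b i ≠ 0 := by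
    by_contra! hcon; exact hb (funext hcon)
  have : Nonempty (Fin m ⊕ Fin n) := ⟨Sum.inl i0⟩
  obtain ⟨hg1, hg2⟩ := gamma_le F.res.u_pos (one_le_condSkeel hT) hcond hη
  set θ := K * F.work.u * (norm2 (MLinv m R * augM A α) * l) with hθd
  have hθ0 : 0 ≤ θ :=
    mul_nonneg (mul_nonneg hK F.work.u_pos.le) (mul_nonneg (norm2_nonneg _) hl0)
  have ht2 : 1 ≤ t ^ 2 := one_le_pow₀ ht
  refine forward_refinement hT hd0 (D := fun i => lsir F A b R α k d₀ i)
    (W := fun i => computedRes F.res A b (lsir F A b R α k d₀ i))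
    (y := fun i => unscl α (innerSolve F A b R α (k i) (lsir F A b R α k d₀ i)))
    (gamma_nonneg F.res _) (by positivity : 0 ≤ 4 * t ^ 2 * θ) F.work.u_pos hθ hu hη hε hηε hg2
    (by linarith) (fun i a => ?_) (fun i => ?_) fun i a => lsirStep_err F R α (k i) _ a
  · have := scaled_residual_err F.res hd one_pos (lsir F A b R α k d₀ i) a
    rwa [sclRhs_one, scl_one, scl_one] at this
  · have h1 := innerSolve_err F hA hα hK hl0 hl hθd.symm.le (by nlinarith) (h i)
    set w := computedRes F.res A b (lsir F A b R α k d₀ i)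
    set y := innerSolve F A b R α (k i) (lsir F A b R α k d₀ i)
    set v := (augM A 1)⁻¹ *ᵥ w with hv
    have h2 : (augM A α)⁻¹ *ᵥ sclRhs α w = scl α v := by
      have e : sclRhs α w = augM A α *ᵥ scl α v := by
        rw [augM_mulVec_scl A hα.ne', hv, Matrix.mulVec_mulVec, Matrix.mul_nonsing_inv _ hT,
          Matrix.one_mulVec]
      rw [e, Matrix.mulVec_mulVec, Matrix.nonsing_inv_mul _ (isUnit_det_augM hA hα),
        Matrix.one_mulVec]
    rw [h2] at h1
    have h3 : unscl α y - v = unscl α (y - scl α v) := by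
      rw [unscl_sub, unscl_scl hα.ne']
    rw [h3]
    calc vnorm (unscl α (y - scl α v)) ≤ t * vnorm (y - scl α v) := vnorm_unscl_le hα ht hαt _
      _ ≤ t * (4 * θ * (t * vnorm v)) := by
        refine mul_le_mul_of_nonneg_left (h1.trans ?_) (by linarith)
        exact mul_le_mul_of_nonneg_left (vnorm_scl_le hα ht hαt' v) (by linarith)
      _ = 4 * t ^ 2 * θ * vnorm v := by ring

/-- Here the preconditioner is simply undone: `max 1 ‖R‖` and `max 1 ‖R⁻¹‖` convert a small
preconditioned residual into a small residual of the augmented system itself. -/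
theorem backward_unscaled (hA : ∀ v, A *ᵥ v = 0 → v = 0) (hA0 : A ≠ 0)
    (hd : augM A 1 *ᵥ d = rhs n b) (hb : b ≠ 0) (hR : IsUnit R.det) (hK : 0 ≤ K)
    (hθ : 12 * (K * F.work.u * (max 1 (norm2 R) * max 1 (norm2 R⁻¹) * cond2 (augM A 1))) ≤ η)
    (hη : η ≤ 1 / 100) (hur : F.res.u ≤ F.work.u)
    (hp : 2 * (maxRowNnz (augM A 1) d : ℝ) ^ 2 * (F.work.u * cond2 (augM A 1)) ≤ η)
    (h : ∀ i, innerBackwardErr F A b R 1 (k i) (lsir F A b R 1 k d₀ i) ≤ K * F.work.u) :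
    ∃ N, ∀ i ≥ N, backwardErr (augM A 1) (rhs n b) (lsir F A b R 1 k d₀ i) ≤
      (1 + 60 * η) * (1 + η) * (maxRowNnz (augM A 1) d *
        max F.work.u (2 * Real.sqrt (maxRowNnz (augM A 1) d) * F.res.u)) := by
  classical
  have hT := isUnit_det_augM hA one_pos
  set T := augM A 1 with hTd
  set p := maxRowNnz T d with hpd
  set u := F.work.u with hud
  set ur := F.res.u with hurd
  have hu0 : 0 < u := F.work.u_pos
  have hur0 : 0 < ur := F.res.u_pos
  obtain ⟨i0, hi0⟩ : ∃ i, b i ≠ 0 := by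
    by_contra! hcon; exact hb (funext hcon)
  have : Nonempty (Fin m ⊕ Fin n) := ⟨Sum.inl i0⟩
  have hrhs : rhs n b ≠ 0 := fun h0 => hb (funext fun i => congrFun h0 (Sum.inl i))
  have hκ1 : 1 ≤ cond2 T := one_le_cond2 fun v hv => by
    have e : v = T⁻¹ *ᵥ (T *ᵥ v) := by
      rw [Matrix.mulVec_mulVec, Matrix.nonsing_inv_mul _ hT, Matrix.one_mulVec]
    rw [e, hv, Matrix.mulVec_zero]
  have hκ : cond2 T = norm2 T * norm2 T⁻¹ := by rw [cond2, pinv_eq_inv hT]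
  rw [hκ] at hθ hp hκ1
  set κ := norm2 T * norm2 T⁻¹ with hκd
  have hp2 : (2 : ℝ) ≤ p := by exact_mod_cast two_le_maxRowNnz hA0 d
  set q := Real.sqrt p with hq
  have hq0 : 0 ≤ q := Real.sqrt_nonneg _
  have hqq : q ^ 2 = p := Real.sq_sqrt (by linarith)
  have hq1 : 1 ≤ q := Real.one_le_sqrt.2 (by linarith)
  have hqp : q ≤ p := by nlinarith
  have huκ0 : 0 < u * κ := by positivity
  have huκ : u * κ ≤ η := by
    have := mul_le_mul_of_nonneg_right (by nlinarith : (1 : ℝ) ≤ 2 * (p : ℝ) ^ 2) huκ0.le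
    linarith
  have huu : u ≤ u * κ := le_mul_of_one_le_right hu0.le hκ1
  have hpur : p * ur ≤ η := by
    have : p * ur ≤ p * (u * κ) := mul_le_mul_of_nonneg_left (hur.trans huu) (by linarith)
    nlinarith
  set γ := (1 + ur) ^ p - 1 with hγ
  have hγ0 : 0 ≤ γ := gamma_nonneg F.res p
  have hγ1 : γ ≤ p * ur * (1 + η) := by
    refine (one_add_pow_sub_one_le hur0.le (by linarith)).trans ?_
    exact mul_le_mul_of_nonneg_left (by linarith) (by positivity)
  set μ₁ := max 1 (norm2 R) with hμ₁
  set μ₂ := max 1 (norm2 R⁻¹) with hμ₂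
  have hμ₁1 : 1 ≤ μ₁ := le_max_left _ _
  have hμ₂1 : 1 ≤ μ₂ := le_max_left _ _
  have hRt : IsUnit (Rᵀ).det := by rwa [Matrix.det_transpose]
  have hRt' : IsUnit ((Rᵀ)⁻¹).det := Matrix.isUnit_nonsing_inv_det _ hRt
  have hLn : ∀ v : Fin m ⊕ Fin n → ℝ, vnorm (MLinv m R *ᵥ v) ≤ μ₂ * vnorm v := by
    intro v
    have h1 := vnorm_bdiag_le (m := m) (Rᵀ)⁻¹ v
    rwa [← MLinv_eq, ← Matrix.transpose_nonsing_inv, norm2_transpose] at h1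
  have hLi : ∀ v : Fin m ⊕ Fin n → ℝ, vnorm v ≤ μ₁ * vnorm (MLinv m R *ᵥ v) := by
    intro v
    have h1 := vnorm_le_bdiag (m := m) hRt' v
    rwa [← MLinv_eq, Matrix.nonsing_inv_nonsing_inv _ hRt, norm2_transpose] at h1
  have hTi : ∀ v, vnorm v ≤ norm2 T⁻¹ * vnorm (T *ᵥ v) := by
    intro v
    have := vnorm_mulVec_le T⁻¹ (T *ᵥ v)
    rwa [Matrix.mulVec_mulVec, Matrix.nonsing_inv_mul _ hT, Matrix.one_mulVec] at this
  have hB : norm2 (MLinv m R * T) ≤ μ₂ * norm2 T := by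
    refine norm2_le (mul_nonneg (by linarith) (norm2_nonneg _)) fun v => ?_
    rw [← Matrix.mulVec_mulVec, mul_assoc]
    exact (hLn _).trans (mul_le_mul_of_nonneg_left (vnorm_mulVec_le _ _) (by linarith))
  have hTi0 : 0 ≤ norm2 T⁻¹ := norm2_nonneg _
  have hl : ∀ v, vnorm v ≤ norm2 T⁻¹ * μ₁ * vnorm ((MLinv m R * T) *ᵥ v) := by
    intro v
    rw [← Matrix.mulVec_mulVec, mul_assoc]
    exact (hTi v).trans (mul_le_mul_of_nonneg_left (hLi _) hTi0)
  have hl0 : 0 ≤ norm2 T⁻¹ * μ₁ := mul_nonneg hTi0 (by linarith)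
  have hKu : 0 ≤ K * u := mul_nonneg hK hu0.le
  set θ := K * u * (μ₁ * μ₂ * κ) with hθd
  have hθ0 : 0 ≤ θ := by positivity
  have hθ' : K * u * (norm2 (MLinv m R * T) * (norm2 T⁻¹ * μ₁)) ≤ θ := by
    refine mul_le_mul_of_nonneg_left ?_ hKu
    calc _ ≤ μ₂ * norm2 T * (norm2 T⁻¹ * μ₁) := mul_le_mul_of_nonneg_right hB hl0
      _ = _ := by rw [hκd]; ring
  have hinner := fun i => innerSolve_err F hA one_pos hK hl0 hl hθ' (by linarith) (h i)
  simp only [sclRhs_one] at hinner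
  -- `γ ≤ 2 p u` and `√p ≤ p` explain the factor `2 p²` in `hp`.
  have hgκ : γ * q * κ ≤ η := by
    have h1 : γ ≤ 2 * (p * u) := by
      have : p * ur * (1 + η) ≤ p * u * 2 :=
        mul_le_mul (mul_le_mul_of_nonneg_left hur (by linarith)) (by linarith) (by linarith)
          (by positivity)
      linarith
    have h2 : γ * q ≤ 2 * (p * u) * p := mul_le_mul h1 hqp hq0 (by positivity)
    have h3 := mul_le_mul_of_nonneg_right h2 (by linarith : 0 ≤ κ)
    linarith
  -- The choice `ρ = 12 θ` covers both inner errors: `3 θ` for the residual and `4 θ` for the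
  -- solution.
  obtain ⟨N, hN⟩ := backward_refinement hT hd hrhs
    (D := fun i => lsir F A b R 1 k d₀ i)
    (W := fun i => computedRes F.res A b (lsir F A b R 1 k d₀ i))
    (y := fun i => innerSolve F A b R 1 (k i) (lsir F A b R 1 k d₀ i))
    (g := γ * q) (u := u) (ρ := 12 * θ) (η := η) (mul_nonneg hγ0 hq0) (by linarith) hu0 hθ hη hgκ
    huκ (fun i => by
      set e := lsir F A b R 1 k d₀ i
      have h1 : vnorm (computedRes F.res A b e - T *ᵥ (d - e)) ≤
          vnorm (γ • ((fun a => |rhs n b a|) + absM T *ᵥ fun c => |e c|)) := by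
        refine vnorm_mono fun a => ?_
        refine le_trans ?_ (le_abs_self _)
        rw [Matrix.mulVec_sub, hd]
        exact computedRes_err F.res A b d e a
      refine h1.trans ?_
      rw [vnorm_smul, abs_of_nonneg hγ0, mul_assoc]
      refine mul_le_mul_of_nonneg_left ((vnorm_add_le _ _).trans ?_) hγ0
      rw [vnorm_abs]
      have h2 := vnorm_absM_mulVec_le T (fun a => card_nnz_le_maxRowNnz T d a) e
      have h3 : 1 * vnorm (rhs n b) ≤ q * vnorm (rhs n b) :=
        mul_le_mul_of_nonneg_right hq1 (vnorm_nonneg _)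
      rw [mul_add]
      linarith) (fun i => by
      have hy := hinner i
      have hbe := backwardErr_le_iff (h i)
      set w := computedRes F.res A b (lsir F A b R 1 k d₀ i)
      set y := innerSolve F A b R 1 (k i) (lsir F A b R 1 k d₀ i)
      set y' := T⁻¹ *ᵥ w with hy'
      have hw : T *ᵥ y' = w := by
        rw [hy', Matrix.mulVec_mulVec, Matrix.mul_nonsing_inv _ hT, Matrix.one_mulVec]
      have h1 : vnorm y ≤ 2 * vnorm y' := by
        have := vnorm_le_add_sub y y'
        nlinarith [vnorm_nonneg y']
      have h2 : vnorm (MLinv m R *ᵥ w) ≤ norm2 (MLinv m R * T) * vnorm y' := by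
        rw [← hw, Matrix.mulVec_mulVec]; exact vnorm_mulVec_le _ _
      have h3 : vnorm (MLinv m R *ᵥ (w - T *ᵥ y)) ≤
          K * u * (3 * (norm2 (MLinv m R * T) * vnorm y')) := by
        rw [Matrix.mulVec_sub, Matrix.mulVec_mulVec]
        rw [sclRhs_one] at hbe
        refine hbe.trans (mul_le_mul_of_nonneg_left ?_ hKu)
        have := mul_le_mul_of_nonneg_left h1 (norm2_nonneg (MLinv m R * T))
        linarith
      have h4 : vnorm y' ≤ norm2 T⁻¹ * vnorm w := vnorm_mulVec_le _ _
      have h5 : norm2 (MLinv m R * T) * vnorm y' ≤ (μ₂ * norm2 T) * (norm2 T⁻¹ * vnorm w) :=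
        mul_le_mul hB h4 (vnorm_nonneg _) (mul_nonneg (by linarith) (norm2_nonneg _))
      have h6 := hLi (w - T *ᵥ y)
      have h7 := mul_le_mul_of_nonneg_left h3 (by linarith : 0 ≤ μ₁)
      have h8 := mul_le_mul_of_nonneg_left h5 (mul_nonneg (by linarith : 0 ≤ μ₁) hKu)
      have h9 : 0 ≤ θ * vnorm w := mul_nonneg hθ0 (vnorm_nonneg _)
      have h10 : μ₁ * (K * u) * (μ₂ * norm2 T * (norm2 T⁻¹ * vnorm w)) = θ * vnorm w := by
        rw [hθd, hκd]; ring
      linarith)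
    (fun i => (hinner i).trans
      (mul_le_mul_of_nonneg_right (by linarith) (vnorm_nonneg _)))
    (fun i a => by
      have := lsirStep_err F (A := A) (b := b) R 1 (k i) (lsir F A b R 1 k d₀ i) a
      have e : ∀ v : Fin m ⊕ Fin n → ℝ, unscl 1 v = v := fun v => by
        ext a; rcases a with i | j <;> simp [unscl]
      rwa [e] at this)
  refine ⟨N, fun i hi => (hN i hi).trans ?_⟩
  rw [mul_assoc]
  refine mul_le_mul_of_nonneg_left ?_ (by linarith)
  -- Each error source takes half of `p M`: `u ≤ M ≤ (p/2) M` because `p ≥ 2`, and `p u_r √p =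
  -- (p/2)(2 √p u_r) ≤ (p/2) M`.
  set M := max u (2 * q * ur) with hM
  have hM1 : u ≤ M := le_max_left _ _
  have hM2 : 2 * q * ur ≤ M := le_max_right _ _
  have hM0 : 0 ≤ M := hu0.le.trans hM1
  have k1 : γ * q ≤ p * ur * (1 + η) * q := mul_le_mul_of_nonneg_right hγ1 hq0
  have hη0 : 0 ≤ η := huκ0.le.trans huκ
  have k2 : p * (2 * q * ur) ≤ p * M := mul_le_mul_of_nonneg_left hM2 (by linarith)
  have k3 : 2 * M ≤ p * M := mul_le_mul_of_nonneg_right hp2 hM0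
  have k4 := mul_le_mul_of_nonneg_right k2 (by linarith : 0 ≤ 1 + η)
  have k5 : M ≤ M * (1 + η) := le_mul_of_one_le_right hM0 (by linarith)
  have k6 := mul_le_mul_of_nonneg_right k3 (by linarith : 0 ≤ 1 + η)
  linarith

end Iteration

/-! ### Bookkeeping of constants -/

section Constants

/-- With `C = D / η`, each convergence condition becomes `D u X ≤ η`; every smallness requirement
then reduces to comparing a numerical constant with `D`. -/
theorem le_of_mul_lt_inv {C D X u η : ℝ} (hη : 0 < η) (hu : 0 < u) (hC : C = D / η)
    (h : C * X < u⁻¹) : D * (u * X) ≤ η := by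
  have h1 : C * X * u < 1 := by
    have := mul_lt_mul_of_pos_right h hu
    rwa [inv_mul_cancel₀ hu.ne'] at this
  have h2 : D = C * η := by rw [hC]; field_simp
  calc D * (u * X) = (C * X * u) * η := by rw [h2]; ring
    _ ≤ 1 * η := mul_le_mul_of_nonneg_right h1.le hη.le
    _ = η := one_mul η

theorem mul_le_of_le {a D X η : ℝ} (hX : 0 ≤ X) (ha : a ≤ D) (h : D * X ≤ η) : a * X ≤ η :=
  (mul_le_mul_of_nonneg_right ha hX).trans h

/-- The constants serve, in order: the residual condition, `u ≤ η` without scaling, the inner solve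
without scaling, and the inner solve with optimal scaling in scaled and in unscaled unknowns. -/
theorem const_bounds {K t : ℝ} (hK : 0 < K) (ht : 0 < t) :
    2 ≤ 10000 * (1 + K) * (1 + t) ^ 3 ∧ t ≤ 10000 * (1 + K) * (1 + t) ^ 3 ∧
      1152 * K * (t + 4) ≤ 10000 * (1 + K) * (1 + t) ^ 3 ∧
      1920 * K ≤ 10000 * (1 + K) * (1 + t) ^ 3 ∧
      1920 * K * t ^ 2 ≤ 10000 * (1 + K) * (1 + t) ^ 3 := by
  have h1 := mul_pos hK ht
  have h2 := mul_pos hK (pow_pos ht 2)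
  have h3 := mul_pos hK (pow_pos ht 3)
  have h4 := pow_pos ht 2
  have h5 := pow_pos ht 3
  refine ⟨?_, ?_, ?_, ?_, ?_⟩ <;> linarith

/-- From `√(1 + y) - 1 ≤ y/2` and `β⁻¹ ≤ 1` the inverse is at least `π²/2`. Thus the stated
condition dominates the growth `π²` of the inverse augmented matrix. -/
theorem sq_le_max_inv_sqrt {π β : ℝ} (hπ : 0 < π) (hβ : 1 ≤ β) :
    π ^ 2 ≤ 2 * max 1 (Real.sqrt (1 + 4 * β⁻¹ * (π ^ 2)⁻¹) - 1)⁻¹ := by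
  have hβi : β⁻¹ ≤ 1 := inv_le_one_of_one_le₀ hβ
  have hβ0 : 0 < β⁻¹ := by positivity
  have hp : 0 < (π ^ 2)⁻¹ := by positivity
  set y := 4 * β⁻¹ * (π ^ 2)⁻¹ with hy
  have hy0 : 0 < y := by positivity
  have h1 : Real.sqrt (1 + y) - 1 ≤ 2 * (π ^ 2)⁻¹ := by
    have e1 : Real.sqrt (1 + y) ≤ 1 + y / 2 :=
      Real.sqrt_le_iff.2 ⟨by positivity, by nlinarith⟩
    have e2 : y ≤ 4 * (π ^ 2)⁻¹ := by rw [hy]; nlinarith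
    linarith
  have h2 : 0 < Real.sqrt (1 + y) - 1 := by
    have : 1 < Real.sqrt (1 + y) := by
      rw [Real.lt_sqrt zero_le_one]; linarith
    linarith
  have h3 : (2 * (π ^ 2)⁻¹)⁻¹ ≤ (Real.sqrt (1 + y) - 1)⁻¹ := inv_anti₀ h2 h1
  rw [mul_inv, inv_inv] at h3
  linarith [le_max_right 1 (Real.sqrt (1 + y) - 1)⁻¹]

end Constants

/-! ### Conditioning of the left-preconditioned matrix -/

section Conditioning
variable {m n s : ℕ} {A : Matrix (Fin m) (Fin n) ℝ} {R T : Matrix (Fin n) (Fin n) ℝ}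

/-- Conditioning of the left-preconditioned augmented matrix without scaling. -/
theorem split_cond_one (hA : ∀ v, A *ᵥ v = 0 → v = 0) (hR : IsUnit R.det) (hT : IsUnit T.det)
    (h1 : ∀ w, vnorm (R *ᵥ w) ≤ 2 * vnorm (T *ᵥ w))
    (h2 : ∀ w, vnorm (T *ᵥ w) ≤ 2 * vnorm (R *ᵥ w)) :
    ∃ l, 0 ≤ l ∧ (∀ v, vnorm v ≤ l * vnorm ((MLinv m T * augM A 1) *ᵥ v)) ∧
      norm2 (MLinv m T * augM A 1) * l ≤
        (1 + 4 * norm2 (A * R⁻¹)) * (max 1 (norm2 T) * max 1 (norm2 T⁻¹)) *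
          (9 * max 1 (4 * norm2 (pinv (A * R⁻¹)) ^ 2)) := by
  set π := norm2 (pinv (A * R⁻¹))
  have hπ : 0 ≤ π := norm2_nonneg _
  have e : (2 * π) ^ 2 = 4 * π ^ 2 := by ring
  have hlow := augM_one_lower (A * T⁻¹) (by linarith : 0 ≤ 2 * π)
    (vnorm_le_mul_inv_of_equiv hA hR hT h2)
  rw [e] at hlow
  have hl0 : 0 ≤ max 1 (norm2 T⁻¹) * (9 * max 1 (4 * π ^ 2)) := by positivity
  refine ⟨_, hl0, split_lower hT hlow, ?_⟩
  have hB : norm2 (MLinv m T * augM A 1) ≤ (1 + 4 * norm2 (A * R⁻¹)) * max 1 (norm2 T) := by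
    refine (split_norm2_le hT zero_le_one).trans (mul_le_mul_of_nonneg_right ?_ (by positivity))
    linarith [norm2_mul_inv_le_of_equiv (A := A) hR hT h1]
  refine (mul_le_mul_of_nonneg_right hB hl0).trans (le_of_eq ?_)
  ring

/-- All three bounds are read off at a vector attaining the smallest singular value. -/
theorem sigmaMin_mul_inv_bounds (hn : 0 < n) (hA : ∀ v, A *ᵥ v = 0 → v = 0) (hR : IsUnit R.det)
    (hT : IsUnit T.det) (h2 : ∀ w, vnorm (T *ᵥ w) ≤ 2 * vnorm (R *ᵥ w)) :
    0 < sigmaMin (A * T⁻¹) ∧ (sigmaMin (A * T⁻¹))⁻¹ ≤ 2 * norm2 (pinv (A * R⁻¹)) ∧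
      sigmaMin (A * T⁻¹) ≤ norm2 (A * T⁻¹) := by
  obtain ⟨v, hv, hve⟩ := exists_vnorm_eq_sigmaMin hn (A * T⁻¹)
  set σ := sigmaMin (A * T⁻¹)
  set π := norm2 (pinv (A * R⁻¹))
  have hσ0 : 0 ≤ σ := sigmaMin_nonneg _
  have hπ : 0 ≤ π := norm2_nonneg _
  have e1 := vnorm_le_mul_inv_of_equiv hA hR hT h2 v
  rw [hve] at e1
  have e2 : 1 ≤ 2 * π * σ := le_of_mul_le_mul_right (by linarith) hv
  have hσ : 0 < σ := by
    rcases hσ0.lt_or_eq with h | h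
    · exact h
    · rw [← h] at e2; linarith
  refine ⟨hσ, ?_, ?_⟩
  · rw [inv_le_iff_one_le_mul₀ hσ]; linarith
  · refine le_of_mul_le_mul_right ?_ hv
    rw [← hve]; exact vnorm_mulVec_le _ _

/-- Conditioning of the left-preconditioned augmented matrix with the optimal scaling. -/
theorem split_cond_optimal (hn : 0 < n) (hA : ∀ v, A *ᵥ v = 0 → v = 0) (hR : IsUnit R.det)
    (hT : IsUnit T.det) (h1 : ∀ w, vnorm (R *ᵥ w) ≤ 2 * vnorm (T *ᵥ w))
    (h2 : ∀ w, vnorm (T *ᵥ w) ≤ 2 * vnorm (R *ᵥ w)) {α : ℝ}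
    (hα : α = (Real.sqrt 2)⁻¹ * sigmaMin (A * T⁻¹)) :
    0 < α ∧ ∃ l, 0 ≤ l ∧ (∀ v, vnorm v ≤ l * vnorm ((MLinv m T * augM A α) *ᵥ v)) ∧
      norm2 (MLinv m T * augM A α) * l ≤
        120 * cond2 (A * R⁻¹) * (max 1 (norm2 T) * max 1 (norm2 T⁻¹)) := by
  obtain ⟨hσ, hσi, hσN⟩ := sigmaMin_mul_inv_bounds hn hA hR hT h2
  have hlow := augM_scaled_lower (A * T⁻¹) hσ (sigmaMin_mul_le hn (A * T⁻¹))
  rw [← hα] at hlow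
  have hN := norm2_mul_inv_le_of_equiv (A := A) hR hT h1
  set σ := sigmaMin (A * T⁻¹)
  set π := norm2 (pinv (A * R⁻¹))
  have hα0 : 0 < α := by rw [hα]; positivity
  have hασ : α ≤ σ := by
    have : (Real.sqrt 2)⁻¹ ≤ 1 := inv_le_one_of_one_le₀ (Real.one_le_sqrt.2 (by norm_num))
    rw [hα]; nlinarith
  have hl0 : 0 ≤ max 1 (norm2 T⁻¹) * (10 * σ⁻¹) := by positivity
  refine ⟨hα0, _, hl0, split_lower hT hlow, ?_⟩
  have hB : norm2 (MLinv m T * augM A α) ≤ 6 * norm2 (A * R⁻¹) * max 1 (norm2 T) := by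
    refine (split_norm2_le hT hα0.le).trans (mul_le_mul_of_nonneg_right ?_ (by positivity))
    linarith
  have hl1 : max 1 (norm2 T⁻¹) * (10 * σ⁻¹) ≤ max 1 (norm2 T⁻¹) * (20 * π) :=
    mul_le_mul_of_nonneg_left (by linarith) (by positivity)
  have hAR := norm2_nonneg (A * R⁻¹)
  refine (mul_le_mul hB hl1 hl0 (by positivity)).trans (le_of_eq ?_)
  rw [cond2]; ring

end Conditioning

end LSIR

/-! ### Assembly of the main theorem -/

set_option maxHeartbeats 1000000 in
theorem theorem4p1 :
    ∃ c : ℝ, 0 < c ∧ ∀ K ε τ : ℝ, 0 < K → 0 < ε → 0 < τ →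
    ∃ C : ℝ, 0 < C ∧ ∃ C' : ℕ → ℝ,
    ∀ (m n s : ℕ) (A : Matrix (Fin m) (Fin n) ℝ) (b : Fin m → ℝ)
      (Ω : Matrix (Fin s) (Fin m) ℝ) (Y Q : Matrix (Fin s) (Fin n) ℝ)
      (R : Matrix (Fin n) (Fin n) ℝ) (PQR : LSIR.Precision) (F : LSIR.Precisions)
      (k : ℕ → ℕ) (d₀ : Fin m ⊕ Fin n → ℝ) (x : Fin n → ℝ),
      0 < n → A.rank = n → (Ω * A).rank = n → b ≠ 0 →
      -- exact economic QR factorization of the sketched matrix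
      Ω * A = Q * R → Q.transpose * Q = 1 → (∀ i j, j < i → R i j = 0) →
      LSIR.SketchOK c PQR.u (Ω * A) Y →
      F.res.u ≤ F.work.u →
      -- `x` is the exact least-squares solution
      (∀ y, LSIR.vnorm (b - A.mulVec x) ≤ LSIR.vnorm (b - A.mulVec y)) →
      let u := F.work.u
      let ur := F.res.u
      let Rhat := LSIR.householderR PQR Y
      let β := LSIR.beta c PQR.u (Ω * A) Y
      let ψ := LSIR.psi β (Ω * A)
      let ARinv := A * R⁻¹
      let d : Fin m ⊕ Fin n → ℝ := Sum.elim (b - A.mulVec x) x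
      let Aug := LSIR.augM A 1
      let p := LSIR.maxRowNnz Aug d
      let α := (Real.sqrt 2)⁻¹ * LSIR.sigmaMin (A * Rhat⁻¹)
      let Augα := LSIR.augM A α
      let dhat := LSIR.lsir F A b Rhat 1 k d₀
      let dhatα := LSIR.lsir F A b Rhat α k d₀
      -- forward error without scaling
      ((∀ i, LSIR.innerBackwardErr F A b Rhat 1 (k i) (dhat i) ≤ K * u) →
        τ ≤ LSIR.norm2 ARinv →
        C * (p * ur * LSIR.condSkeel Aug) < 1 →
        C * (β * max 1 (Real.sqrt (1 + 4 * β⁻¹ * (LSIR.norm2 (LSIR.pinv ARinv) ^ 2)⁻¹) - 1)⁻¹ *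
          LSIR.norm2 ARinv * ψ) < u⁻¹ →
        ∃ N, ∀ i ≥ N, LSIR.vnorm (d - dhat i) / LSIR.vnorm d ≤
          (1 + ε) * (4 * p * ur * LSIR.condAt Aug d + u)) ∧
      -- forward error with the optimal scaling, for the scaled and for the unscaled unknowns
      ((∀ i, LSIR.innerBackwardErr F A b Rhat α (k i) (dhatα i) ≤ K * u) →
        C * (β ^ 2 * LSIR.cond2 ARinv * ψ) < u⁻¹ →
        (C * (p * ur * LSIR.condSkeel Augα) < 1 →
          ∃ N, ∀ i ≥ N,
            LSIR.vnorm (LSIR.scl α (d - dhatα i)) / LSIR.vnorm (LSIR.scl α d) ≤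
              (1 + ε) * (4 * p * ur * LSIR.condAt Augα (LSIR.scl α d) + u)) ∧
        (C * (p * ur * LSIR.condSkeel Aug) < 1 → τ ≤ α → α ≤ τ⁻¹ →
          ∃ N, ∀ i ≥ N, LSIR.vnorm (d - dhatα i) / LSIR.vnorm d ≤
            (1 + ε) * (4 * p * ur * LSIR.condAt Aug d + u))) ∧
      -- backward error
      ((∀ i, LSIR.innerBackwardErr F A b Rhat 1 (k i) (dhat i) ≤ K * u) →
        C' p * (ψ * LSIR.cond2 Aug) < u⁻¹ →
        ∃ N, ∀ i ≥ N, LSIR.backwardErr Aug (LSIR.rhs n b) (dhat i) ≤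
          (1 + ε) * (p * max u (2 * Real.sqrt p * ur))) := by
  
  refine ⟨1000, by norm_num, fun K ε τ hK hε hτ => ?_⟩
  -- A single small parameter: the refinement lemmas need `η ≤ 1/100` and `100 η ≤ ε`.
  set η : ℝ := min ε 1 / 100 with hη
  have hη0 : 0 < η := by have := lt_min hε one_pos; positivity
  have hηε : 100 * η ≤ ε := by rw [hη]; linarith [min_le_left ε 1]
  have hη1 : η ≤ 1 / 100 := by rw [hη]; linarith [min_le_right ε 1]
  set t := τ⁻¹ with ht
  have ht0 : 0 < t := inv_pos.2 hτ
  set D : ℝ := 10000 * (1 + K) * (1 + t) ^ 3 with hD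
  have hD0 : 0 < D := by positivity
  obtain ⟨hD2, hDt, hD3, hD4, hD5⟩ := LSIR.const_bounds hK ht0
  rw [← hD] at hD2 hDt hD3 hD4 hD5
  refine ⟨D / η, by positivity, fun p => 100 * (1 + K) * (1 + (p : ℝ)) ^ 2 / η, ?_⟩
  intro m n s A b Ω Y Q R PQR F k d₀ x hn hArank hSrank hb hQR hQ _ hsk hur hx
    u ur Rhat β ψ ARinv d Aug p α Augα dhat dhatα
  have hA := LSIR.eq_zero_of_rank hArank
  have hS := LSIR.eq_zero_of_rank hSrank
  have hns : n ≤ s := by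
    have h1 := Matrix.rank_le_height (Ω * A)
    omega
  have : Nonempty (Fin n) := ⟨⟨0, hn⟩⟩
  have hequiv := LSIR.householderR_equiv PQR hns hn hS hsk
  have hSR : ∀ w, LSIR.vnorm ((Ω * A).mulVec w) = LSIR.vnorm (R.mulVec w) := fun w => by
    rw [hQR, ← Matrix.mulVec_mulVec, LSIR.vnorm_mulVec_of_orthonormal hQ]
  have h1 : ∀ w, LSIR.vnorm (R.mulVec w) ≤ 2 * LSIR.vnorm (Rhat.mulVec w) := fun w => by
    rw [← hSR]; exact (hequiv w).1
  have h2 : ∀ w, LSIR.vnorm (Rhat.mulVec w) ≤ 2 * LSIR.vnorm (R.mulVec w) := fun w => by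
    rw [← hSR]; exact (hequiv w).2
  have hTu : IsUnit Rhat.det := LSIR.isUnit_det_of_equiv hS fun w => (hequiv w).1
  have hRu : IsUnit R.det := LSIR.isUnit_det_of_ker fun v hv => hS v
    (LSIR.vnorm_eq_zero.1 (by rw [hSR, hv, LSIR.vnorm_zero]))
  have hβ : 1 ≤ β := LSIR.one_le_beta PQR (by norm_num) hn hsk
  have hκS : 1 ≤ LSIR.cond2 (Ω * A) := LSIR.one_le_cond2 hS
  have hψ : 1 ≤ ψ := LSIR.one_le_psi hβ hκS
  have hμ : max 1 (LSIR.norm2 Rhat) * max 1 (LSIR.norm2 Rhat⁻¹) ≤ 4 * ψ :=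
    LSIR.max_mul_max_le_psi hβ hκS (LSIR.norm2_le_of_equiv fun w => (hequiv w).2)
      (LSIR.norm2_inv_le_of_equiv hS fun w => (hequiv w).1)
  have hARker := LSIR.mul_inv_ker hA hRu
  have hκAR : 1 ≤ LSIR.cond2 ARinv := LSIR.one_le_cond2 hARker
  have hu : 0 < u := F.work.u_pos
  have hur0 : 0 < ur := F.res.u_pos
  have hd : Aug.mulVec d = LSIR.rhs n b := LSIR.augM_mulVec_solution hx
  have hA0 : A ≠ 0 := by
    rintro rfl
    have h0 := hA (fun _ => 1) (Matrix.zero_mulVec _)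
    simpa using congrFun h0 ⟨0, hn⟩
  have hKu : 0 < K * u := mul_pos hK hu
  have hcond : ∀ M : Matrix (Fin m ⊕ Fin n) (Fin m ⊕ Fin n) ℝ,
      D / η * (p * ur * LSIR.condSkeel M) < 1 → 2 * (p * ur * LSIR.condSkeel M) ≤ η := by
    intro M hM
    -- The condition with right-hand side 1 is the case of roundoff 1 of the general rescaling.
    have e := LSIR.le_of_mul_lt_inv hη0 one_pos rfl (by rwa [inv_one])
    rw [one_mul] at e
    have h0 : 0 ≤ (p : ℝ) * ur * LSIR.condSkeel M :=
      mul_nonneg (mul_nonneg (Nat.cast_nonneg _) hur0.le) (LSIR.norm2_nonneg _)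
    exact LSIR.mul_le_of_le h0 hD2 e
  refine ⟨fun hback hτN hc hX => ?_, fun hback hX => ?_, fun hback hX => ?_⟩
  · obtain ⟨l, hl0, hl, hlB⟩ := LSIR.split_cond_one hA hRu hTu h1 h2
    set N := LSIR.norm2 ARinv with hN
    set π := LSIR.norm2 (LSIR.pinv ARinv) with hπ
    set Mx := max 1 (Real.sqrt (1 + 4 * β⁻¹ * (π ^ 2)⁻¹) - 1)⁻¹ with hMx
    have hN0 : 0 < N := lt_of_lt_of_le hτ hτN
    have hπ0 : 0 < π := by
      rcases (LSIR.norm2_nonneg (LSIR.pinv ARinv)).lt_or_eq with h | h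
      · exact h
      · exfalso
        have : LSIR.cond2 ARinv = 0 := by rw [LSIR.cond2, ← h, mul_zero]
        linarith
    have hMx1 : 1 ≤ Mx := le_max_left _ _
    have hMxπ : π ^ 2 ≤ 2 * Mx := LSIR.sq_le_max_inv_sqrt hπ0 hβ
    have e := LSIR.le_of_mul_lt_inv hη0 hu rfl hX
    -- The lower bound `τ` on `‖A R⁻¹‖` lets `t N` dominate the constant 1 in `1 + 4 N` and makes
    -- `u` itself small.
    have hNt : 1 ≤ t * N := by
      rw [ht, inv_mul_eq_div, le_div_iff₀ hτ]; linarith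
    have hX1 : Mx * N * ψ ≤ β * Mx * N * ψ := by
      have : 0 ≤ Mx * N * ψ := by positivity
      nlinarith
    have hX2 : N ≤ Mx * N * ψ := by
      have : 1 ≤ Mx * ψ := one_le_mul_of_one_le_of_one_le hMx1 hψ
      nlinarith
    set X := β * Mx * N * ψ with hXd
    have huX : 0 ≤ u * X := by positivity
    have hu_le : u ≤ t * (u * X) := by
      have : u * 1 ≤ u * (t * X) := mul_le_mul_of_nonneg_left
        (hNt.trans (mul_le_mul_of_nonneg_left (hX2.trans hX1) ht0.le)) hu.le
      linarith
    -- The number `1152 = 4 · 4 · 72` collects the inner solve, the bound `4ψ`, and `9 · 8` from the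
    -- inverse augmented matrix.
    have hθ : 4 * (K * u * (LSIR.norm2 (LSIR.MLinv m Rhat * Aug) * l)) ≤ η := by
      have g1 : (1 + 4 * N) * (max 1 (LSIR.norm2 Rhat) * max 1 (LSIR.norm2 Rhat⁻¹)) *
          (9 * max 1 (4 * π ^ 2)) ≤ ((t + 4) * N) * (4 * ψ) * (9 * (8 * Mx)) := by
        refine mul_le_mul (mul_le_mul (by linarith) hμ (by positivity) (by positivity)) ?_
          (by positivity) (by positivity)
        have : max 1 (4 * π ^ 2) ≤ 8 * Mx := max_le (by linarith) (by linarith)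
        linarith
      have g2 := mul_le_mul_of_nonneg_left (hlB.trans g1) hKu.le
      have g3 := mul_le_mul_of_nonneg_left hX1
        (by positivity : 0 ≤ 1152 * K * (t + 4) * u)
      refine le_trans ?_ (LSIR.mul_le_of_le huX hD3 e)
      linarith
    have := LSIR.forward_scaled F hA hd hb one_pos hK.le hl0 hl hθ
      (hu_le.trans (LSIR.mul_le_of_le huX hDt e)) hη1 hε hηε (hcond _ hc) hback
    simpa only [LSIR.scl_one] using this
  · obtain ⟨hα0, l, hl0, hl, hlB⟩ := LSIR.split_cond_optimal hn hA hRu hTu h1 h2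
      (rfl : α = (Real.sqrt 2)⁻¹ * LSIR.sigmaMin (A * Rhat⁻¹))
    have e := LSIR.le_of_mul_lt_inv hη0 hu rfl hX
    set κ := LSIR.cond2 ARinv with hκ
    have hκψ : 1 ≤ κ * ψ := one_le_mul_of_one_le_of_one_le hκAR hψ
    have hβ2 : 1 ≤ β ^ 2 := one_le_pow₀ hβ
    have hX1 : κ * ψ ≤ β ^ 2 * κ * ψ := by nlinarith
    set X := β ^ 2 * κ * ψ with hXd
    have huX : 0 ≤ u * X := mul_nonneg hu.le (by linarith)
    have hu_le : u ≤ 1 * (u * X) := by nlinarith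
    have hu_η : u ≤ η := hu_le.trans (LSIR.mul_le_of_le huX (by linarith) e)
    have hθ : K * u * (LSIR.norm2 (LSIR.MLinv m Rhat * Augα) * l) ≤ 480 * K * (u * X) := by
      have g1 : 120 * κ * (max 1 (LSIR.norm2 Rhat) * max 1 (LSIR.norm2 Rhat⁻¹)) ≤
          120 * κ * (4 * ψ) := mul_le_mul_of_nonneg_left hμ (by linarith)
      have g2 := mul_le_mul_of_nonneg_left (hlB.trans g1) hKu.le
      have g3 := mul_le_mul_of_nonneg_left hX1 (by positivity : 0 ≤ 480 * K * u)
      linarith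
    refine ⟨fun hc => ?_, fun hc hτα hατ => ?_⟩
    · refine LSIR.forward_scaled F hA hd hb hα0 hK.le hl0 hl ?_ hu_η hη1 hε hηε (hcond _ hc) hback
      exact le_trans (by linarith) (LSIR.mul_le_of_le huX hD4 e)
    · have hτt : τ ≤ t := hτα.trans hατ
      -- `τ ≤ α ≤ τ⁻¹` forces `τ ≤ 1`, so `t` bounds 1, `α` and `α⁻¹` simultaneously.
      have ht1 : 1 ≤ t := by
        have : τ * t = 1 := mul_inv_cancel₀ hτ.ne'
        nlinarith
      refine LSIR.forward_unscaled F hA hd hb hα0 hK.le hl0 hl ht1 hατ (inv_anti₀ hτ hτα) ?_ hu_η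
        hη1 hε hηε (hcond _ hc) hback
      refine le_trans ?_ (LSIR.mul_le_of_le huX hD5 e)
      have := mul_le_mul_of_nonneg_left hθ (by positivity : 0 ≤ 4 * t ^ 2)
      linarith
  · have e := LSIR.le_of_mul_lt_inv hη0 hu rfl hX
    set κ := LSIR.cond2 Aug with hκ
    have hκ0 : 0 ≤ κ := mul_nonneg (LSIR.norm2_nonneg _) (LSIR.norm2_nonneg _)
    have huX : 0 ≤ u * (ψ * κ) := by positivity
    have hp0 : (0 : ℝ) ≤ p := Nat.cast_nonneg _
    have hp2 : 1 ≤ (1 + (p : ℝ)) ^ 2 := one_le_pow₀ (by linarith)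
    have hθ : 12 * (K * u * (max 1 (LSIR.norm2 Rhat) * max 1 (LSIR.norm2 Rhat⁻¹) * κ)) ≤ η := by
      have g := mul_le_mul_of_nonneg_left (mul_le_mul_of_nonneg_right hμ hκ0)
        (by positivity : 0 ≤ 12 * (K * u))
      refine le_trans ?_ (LSIR.mul_le_of_le (a := 48 * K) huX ?_ e)
      · linarith
      · nlinarith
    have hpκ : 2 * (p : ℝ) ^ 2 * (u * κ) ≤ η := by
      refine le_trans ?_ (LSIR.mul_le_of_le (a := 2 * (p : ℝ) ^ 2) huX ?_ e)
      · refine mul_le_mul_of_nonneg_left (mul_le_mul_of_nonneg_left ?_ hu.le) (by positivity)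
        exact le_mul_of_one_le_left hκ0 hψ
      · nlinarith [mul_nonneg hK.le (sq_nonneg (1 + (p : ℝ)))]
    obtain ⟨N, hN⟩ := LSIR.backward_unscaled F hA hA0 hd hb hTu hK.le hθ hη1 hur hpκ hback
    refine ⟨N, fun i hi => (hN i hi).trans (mul_le_mul_of_nonneg_right ?_ ?_)⟩
    · nlinarith
    · exact mul_nonneg hp0 (hu.le.trans (le_max_left _ _))
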